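/- **Theorem.** Let $q_4=e^{2\pi i/48}$. *The skein category.* For $q\in\mathbb C^\times$ let $\mathcal G_2(q)$ be the $\mathbb C$-linear strict pivotal monoidal category with objects $0,1,2,\dots$ (tensor product is addition) whose morphisms $m\to n$ are linear combinations of planar trivalent diagrams with $m$ lower and $n$ upper boundary points, generated by a symmetrically self-dual unoriented strand (cup $0\to2$ and cap $2\to0$ satisfying the zigzag identities) and a trivalent vertex $2\to1$, modulo the following relations. The loop equals $q^{10}+q^8+q^2+1+q^{-2}+q^{-8}+q^{-10}$; the lollipop (the $1$-gon) is $0$; the vertex is invariant under rotation by one click; the bigon equals $([7]_q-1)$ times a strand, where $[7]_q=q^6+q^4+q^2+1+q^{-2}+q^{-4}+q^{-6}$; the trigon equals $-(q^4+1+q^{-4})$ times the vertex; the tetragon equals $(q^2+q^{-2})$ times the sum of the two planar trees with two vertices and four leaves plus $(q^2+1+q^{-2})$ times the sum of the two planar pairings of four points; the pentagon equals minus the sum of the five planar trees with three vertices and five leaves minus the sum of the five diagrams consisting of a vertex and a disjoint arc. Let $\overline{\mathcal G_2(q)}$ be its semisimple quotient, i.e. the quotient by the tensor ideal of negligible morphisms: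 those $f:m\to n$ with $\operatorname{tr}(g\circ f)=0$ for all $g:n\to m$, where $\operatorname{tr}$ is the categorical trace. *The graph planar algebra.* Let $\Gamma_4$ be the graph with vertices $1,\dots,6$, loops at $2,3,5,6$, and edges $12,16,23,25,26,34,35,36,45,56$, and let $\lambda$ be a Frobenius–Perron eigenvector (a positive eigenvector) of its adjacency matrix. Let $\mathrm{GPA}(\Gamma_4)$ be the $\mathbb C$-linear monoidal category with objects $0,1,2,\dots$ (tensor product is addition) in which $\operatorname{Hom}(m\to n)$ has as basis the pairs $(p,q)$ of a path $p$ of length $m$ and a path $q$ of length $n$ with the same source and the same target; the composite of $(p,q)$ followed by $(p',q')$ is $\delta_{q=p'}(p,q')$, and $(p,q)\otimes(p',q')=(pp',qq')$ if the target of $p$ is the source of $p'$, and $0$ otherwise. Its evaluation $2\to0$ and coevaluation $0\to2$ are $$\mathrm{ev}=\sum_e\sqrt{\tfrac{\lambda_{t(e)}}{\lambda_{s(e)}}}\,(e\bar e,s(e)),\qquad \mathrm{coev}=\sum_e\sqrt{\tfrac{\lambda_{t(e)}}{\lambda_{s(e)}}}\,(s(e),e\bar e),$$ the sums running over all oriented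 edges $e$ from $s(e)$ to $t(e)$ (each loop counted once). *Claim.* There is a faithful $\mathbb C$-linear strict monoidal functor $\overline{F_4}:\overline{\mathcal G_2(q_4)}\hookrightarrow\mathrm{GPA}(\Gamma_4)$ which is the identity on objects, sends the cap to $\mathrm{ev}$ and the cup to $\mathrm{coev}$, and such that every coordinate of the image of the trivalent vertex in the basis $\{(p,q)\}$ of $\operatorname{Hom}(2\to1)$ is equal, up to sign, to one of the nine real numbers $$\begin{aligned}\alpha_1&=\sqrt{\tfrac12(1+2\sqrt2+\sqrt3+\sqrt6)},&\alpha_2&=\sqrt{\tfrac12(-1+\sqrt2+\sqrt3)},&\alpha_3&=\sqrt{\tfrac32\bigl(\sqrt{2+\sqrt3}-1\bigr)},\\ \alpha_4&=\sqrt{2+\sqrt3-\sqrt{2+\sqrt3}},&\alpha_5&=\sqrt{\tfrac12\bigl(\sqrt{2+\sqrt3}-1\bigr)},&\alpha_6&=\sqrt{\tfrac12\bigl(\sqrt3+\sqrt{2+\sqrt3}\bigr)},\\ \alpha_7&=\sqrt{1-\sqrt{\tfrac32}+\tfrac1{\sqrt2}},&\alpha_8&=\tfrac12\Bigl(\sqrt{1+\sqrt{6-3\sqrt3}}-\sqrt{\sqrt{2+\sqrt3}-1}\Bigr),&\alpha_9&=\tfrac12\Bigl(\sqrt{1+\sqrt{6-3\sqrt3}}+\sqrt{\sqrt{2+\sqrt3}-1}\Bigr),\end{aligned}$$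 and each of $\alpha_1,\dots,\alpha_9$ occurs, up to sign, as a coordinate. -/

import Mathlib

open CategoryTheory MonoidalCategory

/-! ## Linear skein categories on one symmetrically self-dual strand and a trivalent vertex -/

/-- Formal `ℂ`-linear expressions for planar diagrams with `m` lower and `n` upper boundary points,
built from the cap, the cup and the trivalent vertex.  `wires h` is the identity diagram on `m = n`
parallel strands, and `comp f g` is `f` followed by `g` (`g` stacked on top of `f`). -/
inductive Diagram : ℕ → ℕ → Type
  | wires {m n : ℕ} (h : m = n) : Diagram m n
  | cap : Diagram 2 0
  | cup : Diagram 0 2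
  | vertex : Diagram 2 1
  | comp {a b c : ℕ} (f : Diagram a b) (g : Diagram b c) : Diagram a c
  | tensor {a b c d : ℕ} (f : Diagram a b) (g : Diagram c d) : Diagram (a + c) (b + d)
  | zero {m n : ℕ} : Diagram m n
  | add {m n : ℕ} (f g : Diagram m n) : Diagram m n
  | smul {m n : ℕ} (z : ℂ) (f : Diagram m n) : Diagram m n

namespace Diagram

/-- The identity diagram on `n` strands. -/
abbrev one (n : ℕ) : Diagram n n := wires rfl

/-- The `ℂ`-linear strict monoidal congruence generated by a family `R` of relations: the laws of a
`ℂ`-linear strict monoidal category on the objects `0, 1, 2, …`, the two zigzag identities for the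
cup and the cap, and `R`. -/
inductive Cong (R : (m n : ℕ) → Diagram m n → Diagram m n → Prop) :
    {m n : ℕ} → Diagram m n → Diagram m n → Prop
  | rel {m n : ℕ} {f g : Diagram m n} (h : R m n f g) : Cong R f g
  | refl {m n : ℕ} (f : Diagram m n) : Cong R f f
  | symm {m n : ℕ} {f g : Diagram m n} (h : Cong R f g) : Cong R g f
  | trans {m n : ℕ} {f g h : Diagram m n} (h₁ : Cong R f g) (h₂ : Cong R g h) : Cong R f h
  | comp_congr {a b c : ℕ} {f f' : Diagram a b} {g g' : Diagram b c}
      (h₁ : Cong R f f') (h₂ : Cong R g g') : Cong R (comp f g) (comp f' g')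
  | tensor_congr {a b c d : ℕ} {f f' : Diagram a b} {g g' : Diagram c d}
      (h₁ : Cong R f f') (h₂ : Cong R g g') : Cong R (tensor f g) (tensor f' g')
  | add_congr {m n : ℕ} {f f' g g' : Diagram m n}
      (h₁ : Cong R f f') (h₂ : Cong R g g') : Cong R (add f g) (add f' g')
  | smul_congr {m n : ℕ} (z : ℂ) {f f' : Diagram m n} (h : Cong R f f') :
      Cong R (smul z f) (smul z f')
  | one_comp {a b : ℕ} (f : Diagram a b) : Cong R (comp (one a) f) f
  | comp_one {a b : ℕ} (f : Diagram a b) : Cong R (comp f (one b)) f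
  | comp_assoc {a b c d : ℕ} (f : Diagram a b) (g : Diagram b c) (h : Diagram c d) :
      Cong R (comp (comp f g) h) (comp f (comp g h))
  | one_tensor_one (a b : ℕ) : Cong R (tensor (one a) (one b)) (one (a + b))
  | interchange {a b c a' b' c' : ℕ} (f : Diagram a b) (g : Diagram b c)
      (f' : Diagram a' b') (g' : Diagram b' c') :
      Cong R (tensor (comp f g) (comp f' g')) (comp (tensor f f') (tensor g g'))
  | tensor_assoc {a b a' b' a'' b'' : ℕ}
      (f : Diagram a b) (g : Diagram a' b') (h : Diagram a'' b'') :
      Cong R (comp (tensor (tensor f g) h) (wires (Nat.add_assoc b b' b'')))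
        (comp (wires (Nat.add_assoc a a' a'')) (tensor f (tensor g h)))
  | one_zero_tensor {a b : ℕ} (f : Diagram a b) :
      Cong R (comp (tensor (one 0) f) (wires (Nat.zero_add b))) (comp (wires (Nat.zero_add a)) f)
  | tensor_one_zero {a b : ℕ} (f : Diagram a b) :
      Cong R (comp (tensor f (one 0)) (wires (Nat.add_zero b))) (comp (wires (Nat.add_zero a)) f)
  | add_assoc {m n : ℕ} (f g h : Diagram m n) : Cong R (add (add f g) h) (add f (add g h))
  | add_comm {m n : ℕ} (f g : Diagram m n) : Cong R (add f g) (add g f)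
  | zero_add {m n : ℕ} (f : Diagram m n) : Cong R (add zero f) f
  | one_smul {m n : ℕ} (f : Diagram m n) : Cong R (smul 1 f) f
  | zero_smul {m n : ℕ} (f : Diagram m n) : Cong R (smul 0 f) zero
  | mul_smul {m n : ℕ} (y z : ℂ) (f : Diagram m n) : Cong R (smul (y * z) f) (smul y (smul z f))
  | add_smul {m n : ℕ} (y z : ℂ) (f : Diagram m n) :
      Cong R (smul (y + z) f) (add (smul y f) (smul z f))
  | smul_add {m n : ℕ} (z : ℂ) (f g : Diagram m n) :
      Cong R (smul z (add f g)) (add (smul z f) (smul z g))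
  | add_comp {a b c : ℕ} (f f' : Diagram a b) (g : Diagram b c) :
      Cong R (comp (add f f') g) (add (comp f g) (comp f' g))
  | comp_add {a b c : ℕ} (f : Diagram a b) (g g' : Diagram b c) :
      Cong R (comp f (add g g')) (add (comp f g) (comp f g'))
  | smul_comp {a b c : ℕ} (z : ℂ) (f : Diagram a b) (g : Diagram b c) :
      Cong R (comp (smul z f) g) (smul z (comp f g))
  | comp_smul {a b c : ℕ} (z : ℂ) (f : Diagram a b) (g : Diagram b c) :
      Cong R (comp f (smul z g)) (smul z (comp f g))
  | add_tensor {a b c d : ℕ} (f f' : Diagram a b) (g : Diagram c d) :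
      Cong R (tensor (add f f') g) (add (tensor f g) (tensor f' g))
  | tensor_add {a b c d : ℕ} (f : Diagram a b) (g g' : Diagram c d) :
      Cong R (tensor f (add g g')) (add (tensor f g) (tensor f g'))
  | smul_tensor {a b c d : ℕ} (z : ℂ) (f : Diagram a b) (g : Diagram c d) :
      Cong R (tensor (smul z f) g) (smul z (tensor f g))
  | tensor_smul {a b c d : ℕ} (z : ℂ) (f : Diagram a b) (g : Diagram c d) :
      Cong R (tensor f (smul z g)) (smul z (tensor f g))
  | zigzag_left : Cong R (comp (@tensor 0 2 1 1 cup (one 1)) (@tensor 1 1 2 0 (one 1) cap)) (one 1)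
  | zigzag_right : Cong R (comp (@tensor 1 1 0 2 (one 1) cup) (@tensor 2 0 1 1 cap (one 1))) (one 1)

abbrev congSetoid (R : (m n : ℕ) → Diagram m n → Diagram m n → Prop) (m n : ℕ) :
    Setoid (Diagram m n) where
  r := Cong R
  iseqv := ⟨Cong.refl, Cong.symm, Cong.trans⟩

/-! ### Diagrams that occur in the skein relations -/

/-- The trivalent vertex with one lower and two upper legs. -/
def split : Diagram 1 2 :=
  comp (@tensor 1 1 0 2 (one 1) cup) (@tensor 2 1 1 1 vertex (one 1))

/-- The trivalent vertex with all three legs up. -/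
def tripod : Diagram 0 3 := comp cup (@tensor 1 2 1 1 split (one 1))

/-- Rotation by one click: the first of the upper boundary points is moved, underneath the diagram,
to the last position. -/
def rotate {n : ℕ} (f : Diagram 0 (n + 1)) : Diagram 0 (n + 1) :=
  comp (comp (comp (comp cup
    (@tensor 1 (1 + (n + 1)) 1 1 (@tensor 1 1 0 (n + 1) (one 1) f) (one 1)))
    (wires (by omega : 1 + (n + 1) + 1 = 2 + (n + 1))))
    (tensor cap (one (n + 1))))
    (wires (Nat.zero_add (n + 1)))

/-- An arc whose left half carries `k` outward legs: the boundary points are the `k` legs, followed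
by the two ends of the arc. -/
def fan : (k : ℕ) → Diagram 0 (k + 2)
  | 0 => cup
  | k + 1 => comp (comp (fan k) (@tensor k k 2 3 (one k) (@tensor 1 2 1 1 split (one 1))))
      (wires (by omega : k + 3 = k + 1 + 2))

/-- The `k`-gon: a closed loop with `k` trivalent vertices and `k` outward legs.  `polygon 0` is the
loop, `polygon 1` the lollipop, `polygon 2` the bigon, and so on. -/
def polygon (k : ℕ) : Diagram 0 k := comp (fan k) (@tensor k k 2 0 (one k) cap)

/-- A planar tree with two trivalent vertices and four leaves. -/
def tree4 : Diagram 0 4 := comp tripod (@tensor 1 2 2 2 split (one 2))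

/-- A planar tree with three trivalent vertices and five leaves. -/
def tree5 : Diagram 0 5 := comp tree4 (@tensor 1 2 3 3 split (one 3))

/-- Two parallel arcs. -/
def twoArcs : Diagram 0 4 := @tensor 0 2 0 2 cup cup

/-- A trivalent vertex next to an arc. -/
def tripodArc : Diagram 0 5 := @tensor 0 3 0 2 tripod cup

/-- The sum of the five rotations of a diagram with five boundary points. -/
def rotationSum5 (f : Diagram 0 5) : Diagram 0 5 :=
  add f (add (rotate f) (add (rotate (rotate f)) (add (rotate (rotate (rotate f)))
    (rotate (rotate (rotate (rotate f)))))))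

/-! ### Traces and negligible morphisms -/

/-- The coevaluation of `n` strands: `n` nested cups. -/
def coevN : (n : ℕ) → Diagram 0 (n + n)
  | 0 => one 0
  | n + 1 => comp (comp (comp (coevN n) (wires (by omega : n + n = n + 0 + n)))
      (tensor (tensor (one n) cup) (one n))) (wires (by omega : n + 2 + n = n + 1 + (n + 1)))

/-- The evaluation of `n` strands: `n` nested caps. -/
def evN : (n : ℕ) → Diagram (n + n) 0
  | 0 => one 0
  | n + 1 => comp (wires (by omega : n + 1 + (n + 1) = n + 2 + n))
      (comp (tensor (tensor (one n) cap) (one n)) (comp (wires (by omega : n + 0 + n = n + n)) (evN n)))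

/-- The categorical trace of an endomorphism of `n` strands, a morphism `0 → 0`. -/
def trace {n : ℕ} (f : Diagram n n) : Diagram 0 0 :=
  comp (coevN n) (comp (tensor f (one n)) (evN n))

/-- `f : m → n` is negligible modulo `R` if `tr (g ∘ f) = 0` for all `g : n → m`. -/
def Negligible (R : (m n : ℕ) → Diagram m n → Diagram m n → Prop) {m n : ℕ} (f : Diagram m n) :
    Prop :=
  ∀ g : Diagram n m, Cong R (trace (comp f g)) zero

end Diagram

/-- The monoidal category presented by the relations `R`: its objects are the natural numbers
(numbers of strands), its morphisms are diagrams modulo the congruence generated by `R`. -/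
structure SkeinCat (R : (m n : ℕ) → Diagram m n → Diagram m n → Prop) : Type where
  strands : ℕ

namespace SkeinCat

open Diagram

variable {R : (m n : ℕ) → Diagram m n → Diagram m n → Prop}

instance : Category (SkeinCat R) where
  Hom X Y := Quotient (congSetoid R X.strands Y.strands)
  id X := Quotient.mk _ (one X.strands)
  comp f g := Quotient.map₂ comp (fun _ _ h _ _ h' => Cong.comp_congr h h') f g
  id_comp f := Quotient.inductionOn f fun f => Quotient.sound (s := congSetoid R _ _) (Cong.one_comp f)
  comp_id f := Quotient.inductionOn f fun f => Quotient.sound (s := congSetoid R _ _) (Cong.comp_one f)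
  assoc f g h := Quotient.inductionOn₃ f g h fun f g h => Quotient.sound (s := congSetoid R _ _) (Cong.comp_assoc f g h)

/-- The morphism represented by a diagram. -/
def ofDiagram {m n : ℕ} (f : Diagram m n) : (⟨m⟩ : SkeinCat R) ⟶ ⟨n⟩ :=
  Quotient.mk (congSetoid R m n) f

theorem sound {m n : ℕ} {f g : Diagram m n} (h : Cong R f g) :
    (ofDiagram f : (⟨m⟩ : SkeinCat R) ⟶ ⟨n⟩) = ofDiagram g :=
  Quotient.sound (s := congSetoid R m n) h

instance (X Y : SkeinCat R) : Zero (X ⟶ Y) where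
  zero := Quotient.mk (congSetoid R X.strands Y.strands) zero

instance (X Y : SkeinCat R) : Add (X ⟶ Y) where
  add f g := Quotient.map₂ add (fun _ _ h _ _ h' => Cong.add_congr h h') f g

instance (X Y : SkeinCat R) : Neg (X ⟶ Y) where
  neg f := Quotient.map (smul (-1)) (fun _ _ h => Cong.smul_congr _ h) f

instance (X Y : SkeinCat R) : AddCommGroup (X ⟶ Y) where
  nsmul := nsmulRec
  zsmul := zsmulRec
  add_assoc f g h := Quotient.inductionOn₃ f g h fun f g h => sound (Cong.add_assoc f g h)
  add_comm f g := Quotient.inductionOn₂ f g fun f g => sound (Cong.add_comm f g)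
  zero_add f := Quotient.inductionOn f fun f => sound (Cong.zero_add f)
  add_zero f := Quotient.inductionOn f fun f =>
    sound ((Cong.add_comm f zero).trans (Cong.zero_add f))
  neg_add_cancel f := Quotient.inductionOn f fun f => sound <| by
    refine ((Cong.add_congr (Cong.refl _) (Cong.one_smul f).symm).trans
      (Cong.add_smul (-1) 1 f).symm).trans ?_
    rw [show (-1 : ℂ) + 1 = 0 by norm_num]
    exact Cong.zero_smul f

instance (X Y : SkeinCat R) : Module ℂ (X ⟶ Y) where
  smul z f := Quotient.map (smul z) (fun _ _ h => Cong.smul_congr z h) f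
  one_smul f := Quotient.inductionOn f fun f => sound (Cong.one_smul f)
  mul_smul y z f := Quotient.inductionOn f fun f => sound (Cong.mul_smul y z f)
  smul_zero z := sound <|
    ((Cong.smul_congr z (Cong.zero_smul zero).symm).trans (Cong.mul_smul z 0 zero).symm).trans <| by
      rw [mul_zero]; exact Cong.zero_smul _
  smul_add z f g := Quotient.inductionOn₂ f g fun f g => sound (Cong.smul_add z f g)
  add_smul y z f := Quotient.inductionOn f fun f => sound (Cong.add_smul y z f)
  zero_smul f := Quotient.inductionOn f fun f => sound (Cong.zero_smul f)

instance : Preadditive (SkeinCat R) where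
  homGroup _ _ := inferInstance
  add_comp _ _ _ f f' g := Quotient.inductionOn₃ f f' g fun f f' g =>
    sound (Cong.add_comp f f' g)
  comp_add _ _ _ f g g' := Quotient.inductionOn₃ f g g' fun f g g' =>
    sound (Cong.comp_add f g g')

instance : Linear ℂ (SkeinCat R) where
  homModule _ _ := inferInstance
  smul_comp _ _ _ z f g := Quotient.inductionOn₂ f g fun f g => sound (Cong.smul_comp z f g)
  comp_smul _ _ _ f z g := Quotient.inductionOn₂ g f fun g f => sound (Cong.comp_smul z f g)

/-- Relabelling of strands along an equality, as an isomorphism. -/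
def wiresIso {m n : ℕ} (h : m = n) : (⟨m⟩ : SkeinCat R) ≅ ⟨n⟩ where
  hom := ofDiagram (wires h)
  inv := ofDiagram (wires h.symm)
  hom_inv_id := by subst h; exact sound (Cong.one_comp _)
  inv_hom_id := by subst h; exact sound (Cong.one_comp _)

/-- Juxtaposition of morphisms. -/
def tensorMor {X Y X' Y' : SkeinCat R} (f : X ⟶ Y) (g : X' ⟶ Y') :
    (⟨X.strands + X'.strands⟩ : SkeinCat R) ⟶ ⟨Y.strands + Y'.strands⟩ :=
  Quotient.map₂ (sa := congSetoid R X.strands Y.strands) (sb := congSetoid R X'.strands Y'.strands)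
    (sc := congSetoid R (X.strands + X'.strands) (Y.strands + Y'.strands))
    tensor (fun _ _ h _ _ h' => Cong.tensor_congr h h') f g

theorem ofDiagram_wires_trans {a b c : ℕ} (h : a = b) (h' : b = c) :
    (ofDiagram (wires h) ≫ ofDiagram (wires h') : (⟨a⟩ : SkeinCat R) ⟶ ⟨c⟩) = ofDiagram (wires (h.trans h')) := by
  subst h h'; exact sound (Cong.one_comp _)

theorem tensor_wires {a b c d : ℕ} (h : a = b) (h' : c = d) :
    tensorMor (ofDiagram (wires h) : (⟨a⟩ : SkeinCat R) ⟶ ⟨b⟩) (ofDiagram (wires h') : (⟨c⟩ : SkeinCat R) ⟶ ⟨d⟩) =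
      ofDiagram (wires (congrArg₂ (· + ·) h h')) := by
  subst h h'; exact sound (Cong.one_tensor_one _ _)

instance : MonoidalCategoryStruct (SkeinCat R) where
  tensorObj X Y := ⟨X.strands + Y.strands⟩
  tensorUnit := ⟨0⟩
  tensorHom f g := tensorMor f g
  whiskerLeft X _ _ f := tensorMor (𝟙 X) f
  whiskerRight f Y := tensorMor f (𝟙 Y)
  associator X Y Z := wiresIso (Nat.add_assoc X.strands Y.strands Z.strands)
  leftUnitor X := wiresIso (Nat.zero_add X.strands)
  rightUnitor X := wiresIso (Nat.add_zero X.strands)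

instance : MonoidalCategory (SkeinCat R) := MonoidalCategory.ofTensorHom
  (id_tensorHom_id := fun _ _ => sound (Cong.one_tensor_one _ _))
  (id_tensorHom := fun _ _ _ _ => rfl)
  (tensorHom_id := fun _ _ => rfl)
  (tensorHom_comp_tensorHom := fun f₁ f₂ g₁ g₂ =>
    Quotient.inductionOn₂ f₁ f₂ fun _ _ => Quotient.inductionOn₂ g₁ g₂ fun _ _ =>
      sound (Cong.interchange _ _ _ _).symm)
  (associator_naturality := fun f₁ f₂ f₃ =>
    Quotient.inductionOn₃ f₁ f₂ f₃ fun f₁ f₂ f₃ => sound (Cong.tensor_assoc f₁ f₂ f₃))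
  (leftUnitor_naturality := fun f =>
    Quotient.inductionOn f fun f => sound (Cong.one_zero_tensor f))
  (rightUnitor_naturality := fun f =>
    Quotient.inductionOn f fun f => sound (Cong.tensor_one_zero f))
  (pentagon := fun W X Y Z => by
    have h₁ := tensor_wires (R := R) (Nat.add_assoc W.strands X.strands Y.strands)
      (rfl : Z.strands = Z.strands)
    have h₂ := tensor_wires (R := R) (rfl : W.strands = W.strands)
      (Nat.add_assoc X.strands Y.strands Z.strands)
    exact (congrArg₂ (fun a b => a ≫ ofDiagram (wires _) ≫ b) h₁ h₂).trans
      ((congrArg _ (ofDiagram_wires_trans _ _)).trans ((ofDiagram_wires_trans _ _).trans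
        (ofDiagram_wires_trans (R := R) (Nat.add_assoc (W.strands + X.strands) Y.strands Z.strands)
          (Nat.add_assoc W.strands X.strands (Y.strands + Z.strands))).symm)))
  (triangle := fun X Y => by
    have h₁ := tensor_wires (R := R) (rfl : X.strands = X.strands) (Nat.zero_add Y.strands)
    have h₂ := tensor_wires (R := R) (Nat.add_zero X.strands) (rfl : Y.strands = Y.strands)
    exact (congrArg _ h₁).trans ((ofDiagram_wires_trans _ _).trans h₂.symm))

end SkeinCat

/-! ## The `G₂` skein theory and its semisimple quotient -/

/-- The quantum integer `[n] = q^(n-1) + q^(n-3) + ⋯ + q^(1-n)`. -/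
noncomputable def quantumInt (q : ℂ) (n : ℕ) : ℂ :=
  ∑ i ∈ Finset.range n, q ^ ((n : ℤ) - 1 - 2 * (i : ℤ))

open Diagram in
/-- The relations of the `G₂` skein theory, written with all boundary points up. -/
inductive G2Rel (q : ℂ) : (m n : ℕ) → Diagram m n → Diagram m n → Prop
  | loop : G2Rel q 0 0 (polygon 0)
      (smul (q ^ (10 : ℤ) + q ^ (8 : ℤ) + q ^ (2 : ℤ) + 1 + q ^ (-2 : ℤ) + q ^ (-8 : ℤ) +
        q ^ (-10 : ℤ)) (one 0))
  | lollipop : G2Rel q 0 1 (polygon 1) zero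
  | rotate : G2Rel q 0 3 (Diagram.rotate tripod) tripod
  | bigon : G2Rel q 0 2 (polygon 2) (smul (quantumInt q 7 - 1) cup)
  | trigon : G2Rel q 0 3 (polygon 3) (smul (-(q ^ (4 : ℤ) + 1 + q ^ (-4 : ℤ))) tripod)
  | tetragon : G2Rel q 0 4 (polygon 4)
      (add (smul (q ^ (2 : ℤ) + q ^ (-2 : ℤ)) (add tree4 (Diagram.rotate tree4)))
        (smul (q ^ (2 : ℤ) + 1 + q ^ (-2 : ℤ)) (add twoArcs (Diagram.rotate twoArcs))))
  | pentagon : G2Rel q 0 5 (polygon 5)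
      (add (smul (-1) (rotationSum5 tree5)) (smul (-1) (rotationSum5 tripodArc)))

/-- The relations of the semisimple quotient: the `G₂` skein relations, and `f = 0` for every
morphism `f` of the `G₂` skein category that is negligible there. -/
inductive G2BarRel (q : ℂ) : (m n : ℕ) → Diagram m n → Diagram m n → Prop
  | skein {m n : ℕ} {f g : Diagram m n} (h : G2Rel q m n f g) : G2BarRel q m n f g
  | negligible {m n : ℕ} {f : Diagram m n} (h : Diagram.Negligible (G2Rel q) f) :
      G2BarRel q m n f Diagram.zero

/-- The skein category `𝒢₂(q)`. -/
abbrev G2Cat (q : ℂ) : Type := SkeinCat (G2Rel q)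

/-- The semisimple quotient of `𝒢₂(q)`: its quotient by the tensor ideal generated by the negligible
morphisms (in the pivotal category `𝒢₂(q)` the negligible morphisms already form a tensor ideal). -/
abbrev G2Bar (q : ℂ) : Type := SkeinCat (G2BarRel q)

/-! ## Graph planar algebras -/

/-- A graph with loops allowed and at most one edge between two vertices, given by its symmetric
adjacency relation. -/
structure LoopGraph (V : Type) where
  Adj : V → V → Prop
  symm : ∀ u v, Adj u v → Adj v u

namespace LoopGraph

variable {V : Type} (Γ : LoopGraph V)

/-- Paths with `n` edges in `Γ`, as sequences of `n + 1` vertices. -/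
def EdgePath (n : ℕ) : Type :=
  {p : Fin (n + 1) → V // ∀ i : Fin n, Γ.Adj (p i.castSucc) (p i.succ)}

noncomputable instance [Finite V] (n : ℕ) : Fintype (Γ.EdgePath n) :=
  haveI : Finite (Γ.EdgePath n) := Subtype.finite
  Fintype.ofFinite _

variable {Γ}

namespace EdgePath

@[ext] theorem ext {n : ℕ} {p q : Γ.EdgePath n} (h : ∀ i, p.1 i = q.1 i) : p = q :=
  Subtype.ext (funext h)

/-- The source of a path. -/
def src {n : ℕ} (p : Γ.EdgePath n) : V := p.1 0

/-- The target of a path. -/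
def tgt {n : ℕ} (p : Γ.EdgePath n) : V := p.1 (Fin.last n)

/-- Two paths are parallel if they have the same source and the same target. -/
def Parallel {m n : ℕ} (p : Γ.EdgePath m) (q : Γ.EdgePath n) : Prop := p.src = q.src ∧ p.tgt = q.tgt

/-- A path regarded as a path of an equal length. -/
def cast {m n : ℕ} (h : m = n) (p : Γ.EdgePath m) : Γ.EdgePath n :=
  ⟨fun i => p.1 ⟨i.1, by omega⟩, fun i => p.2 ⟨i.1, by omega⟩⟩

/-- The first `m` edges of a path. -/
def left {m n : ℕ} (p : Γ.EdgePath (m + n)) : Γ.EdgePath m :=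
  ⟨fun i => p.1 ⟨i.1, by omega⟩, fun i => p.2 ⟨i.1, by omega⟩⟩

/-- The last `n` edges of a path. -/
def right {m n : ℕ} (p : Γ.EdgePath (m + n)) : Γ.EdgePath n :=
  ⟨fun i => p.1 ⟨m + i.1, by omega⟩, fun i => p.2 ⟨m + i.1, by omega⟩⟩

/-- The concatenation of two composable paths. -/
def append {m n : ℕ} (p : Γ.EdgePath m) (q : Γ.EdgePath n) (h : p.tgt = q.src) : Γ.EdgePath (m + n) :=
  ⟨fun i => if hi : i.1 ≤ m then p.1 ⟨i.1, by omega⟩ else q.1 ⟨i.1 - m, by omega⟩, fun i => by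
    by_cases h₁ : i.1 + 1 ≤ m
    · have h₂ : i.1 ≤ m := by omega
      simp only [Fin.val_castSucc, Fin.val_succ, h₁, h₂, dif_pos]
      exact p.2 ⟨i.1, by omega⟩
    · by_cases h₂ : i.1 ≤ m
      · have h₃ : i.1 = m := by omega
        have h₄ := q.2 ⟨0, by omega⟩
        have h₅ : p.1 ⟨i.1, by omega⟩ = q.1 ⟨0, by omega⟩ := by
          rw [show (⟨i.1, by omega⟩ : Fin (m + 1)) = Fin.last m from Fin.ext h₃]
          exact h
        simp only [Fin.val_castSucc, Fin.val_succ, h₁, h₂, dif_pos, dif_neg, not_false_eq_true]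
        rw [h₅, show (⟨i.1 + 1 - m, by omega⟩ : Fin (n + 1)) = ⟨1, by omega⟩ from
          Fin.ext (by simp; omega)]
        exact h₄
      · have h₄ := q.2 ⟨i.1 - m, by omega⟩
        simp only [Fin.val_castSucc, Fin.val_succ, h₁, h₂, dif_neg, not_false_eq_true]
        rw [show (⟨i.1 + 1 - m, by omega⟩ : Fin (n + 1)) = ⟨i.1 - m + 1, by omega⟩ from
          Fin.ext (by simp; omega)]
        exact h₄⟩

theorem src_left {m n : ℕ} (p : Γ.EdgePath (m + n)) : (left p).src = p.src := rfl

theorem tgt_right {m n : ℕ} (p : Γ.EdgePath (m + n)) : (right p).tgt = p.tgt := rfl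

theorem tgt_left {m n : ℕ} (p : Γ.EdgePath (m + n)) : (left p).tgt = (right p).src := rfl

theorem left_append {m n : ℕ} (p : Γ.EdgePath m) (q : Γ.EdgePath n) (h : p.tgt = q.src) :
    left (append p q h) = p := by
  ext i
  have hi : i.1 ≤ m := by omega
  simp [left, append, hi]

theorem right_append {m n : ℕ} (p : Γ.EdgePath m) (q : Γ.EdgePath n) (h : p.tgt = q.src) :
    right (append p q h) = q := by
  ext i
  by_cases hi : i.1 = 0
  · have hi' : i = 0 := Fin.ext hi
    subst hi'
    have h₁ : m + ((0 : Fin (n + 1)) : ℕ) ≤ m := by simp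
    simp only [right, append, h₁, dif_pos]
    exact h
  · have h₁ : ¬ m + i.1 ≤ m := by omega
    simp only [right, append, h₁, dif_neg, not_false_eq_true, Nat.add_sub_cancel_left]

theorem eq_of_left_right {m n : ℕ} {p q : Γ.EdgePath (m + n)} (h₁ : left p = left q)
    (h₂ : right p = right q) : p = q := by
  ext i
  by_cases hi : i.1 ≤ m
  · exact congrFun (congrArg Subtype.val h₁) ⟨i.1, by omega⟩
  · have := congrFun (congrArg Subtype.val h₂) ⟨i.1 - m, by omega⟩
    simp only [right] at this
    rwa [show (⟨m + (i.1 - m), by omega⟩ : Fin (m + n + 1)) = i from Fin.ext (by simp; omega)] at this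

end EdgePath

variable (Γ)

/-- The space with basis the pairs `(p, q)` of a path `p` of length `m` and a parallel path `q` of
length `n`: a vector is given by its coefficients, which vanish on pairs that are not parallel. -/
def HomSpace (m n : ℕ) : Submodule ℂ (Γ.EdgePath m → Γ.EdgePath n → ℂ) where
  carrier := {f | ∀ p q, ¬ p.Parallel q → f p q = 0}
  add_mem' hf hg p q h := by simp [hf p q h, hg p q h]
  zero_mem' _ _ _ := rfl
  smul_mem' z f hf p q h := by simp [hf p q h]

end LoopGraph

/-- The graph planar algebra of `Γ`: its objects are the natural numbers. -/
structure GPA {V : Type} (Γ : LoopGraph V) : Type where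
  len : ℕ

namespace GPA

open LoopGraph

variable {V : Type} {Γ : LoopGraph V}

open scoped Classical in
/-- The identity, up to an equality of lengths. -/
noncomputable def castMap {m n : ℕ} (h : m = n) : Γ.HomSpace m n :=
  ⟨fun p q => if p.cast h = q then 1 else 0, fun p q hpq => if_neg fun hq => hpq <| by
    subst h hq; exact ⟨rfl, rfl⟩⟩

/-- The tensor product `(p, q) ⊗ (p', q') = (pp', qq')`, which is zero unless the paths are
composable. -/
noncomputable def tensorMap {a b c d : ℕ} (f : Γ.HomSpace a b) (g : Γ.HomSpace c d) :
    Γ.HomSpace (a + c) (b + d) :=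
  ⟨fun p q => f.1 p.left q.left * g.1 p.right q.right, fun p q hpq => by
    by_cases h₁ : p.left.Parallel q.left
    · have h₂ : ¬ p.right.Parallel q.right := fun h₂ => hpq ⟨h₁.1, h₂.2⟩
      exact mul_eq_zero_of_right _ (g.2 _ _ h₂)
    · exact mul_eq_zero_of_left (f.2 _ _ h₁) _⟩


theorem hom_ext {a b : ℕ} {f g : Γ.HomSpace a b} (h : ∀ p q, f.1 p q = g.1 p q) : f = g :=
  Subtype.ext (funext fun p => funext fun q => h p q)

theorem tensorMap_id {a b : ℕ} :
    tensorMap (castMap rfl : Γ.HomSpace a a) (castMap rfl : Γ.HomSpace b b) = castMap rfl :=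
  hom_ext fun p q => by
    classical
    simp only [tensorMap, castMap, ite_mul, one_mul, zero_mul, ← ite_and]
    refine if_congr ⟨fun h => EdgePath.eq_of_left_right h.1 h.2, ?_⟩ rfl rfl
    rintro rfl
    exact ⟨rfl, rfl⟩

theorem tensorMap_castMap {a b c d : ℕ} (h : a = b) (h' : c = d) :
    tensorMap (castMap h : Γ.HomSpace a b) (castMap h') = castMap (congrArg₂ (· + ·) h h') := by
  subst h h'; exact tensorMap_id

variable [Finite V]

/-- The composition `(p, q) ≫ (q', r) = δ_{q = q'} (p, r)`. -/
noncomputable def compMap {a b c : ℕ} (f : Γ.HomSpace a b) (g : Γ.HomSpace b c) :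
    Γ.HomSpace a c :=
  ⟨fun p r => ∑ q, f.1 p q * g.1 q r, fun p r hpr => Finset.sum_eq_zero fun q _ => by
    by_cases h₁ : p.Parallel q
    · have h₂ : ¬ q.Parallel r := fun h₂ => hpr ⟨h₁.1.trans h₂.1, h₁.2.trans h₂.2⟩
      rw [g.2 _ _ h₂, mul_zero]
    · rw [f.2 _ _ h₁, zero_mul]⟩

theorem compMap_castMap {a b c : ℕ} (f : Γ.HomSpace a b) (h : b = c) (p : Γ.EdgePath a)
    (r : Γ.EdgePath c) : (compMap f (castMap h)).1 p r = f.1 p (r.cast h.symm) := by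
  subst h
  classical
  have : ∀ q : Γ.EdgePath b, q.cast rfl = q := fun q => rfl
  simp [compMap, castMap, this]

theorem castMap_compMap {a b c : ℕ} (h : a = b) (f : Γ.HomSpace b c) (p : Γ.EdgePath a)
    (r : Γ.EdgePath c) : (compMap (castMap h) f).1 p r = f.1 (p.cast h) r := by
  classical
  simp [compMap, castMap]

theorem comp_id' {a b : ℕ} (f : Γ.HomSpace a b) : compMap f (castMap rfl) = f :=
  hom_ext fun p r => compMap_castMap f rfl p r

theorem id_comp' {a b : ℕ} (f : Γ.HomSpace a b) : compMap (castMap rfl) f = f :=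
  hom_ext fun p r => castMap_compMap rfl f p r

theorem castMap_trans {a b c : ℕ} (h : a = b) (h' : b = c) :
    compMap (castMap h : Γ.HomSpace a b) (castMap h') = castMap (h.trans h') := by
  subst h'; exact comp_id' _

theorem interchange {a b c a' b' c' : ℕ} (f : Γ.HomSpace a b) (g : Γ.HomSpace b c)
    (f' : Γ.HomSpace a' b') (g' : Γ.HomSpace b' c') :
    compMap (tensorMap f f') (tensorMap g g') = tensorMap (compMap f g) (compMap f' g') :=
  hom_ext fun p r => by
    classical
    simp only [compMap, tensorMap, Finset.sum_mul_sum, ← Finset.sum_product']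
    refine Finset.sum_of_injOn (fun q : Γ.EdgePath (b + b') => (q.left, q.right)) ?_ (by simp) ?_ ?_
    · intro q _ q' _ h
      exact EdgePath.eq_of_left_right (congrArg Prod.fst h) (congrArg Prod.snd h)
    · rintro ⟨q, q'⟩ - hq
      by_cases h : q.tgt = q'.src
      · exact absurd ⟨EdgePath.append q q' h, by simp, by
          simp [EdgePath.left_append, EdgePath.right_append]⟩ hq
      · by_cases h₁ : p.left.Parallel q
        · have h₂ : ¬ p.right.Parallel q' := fun h₂ => h (h₁.2.symm.trans h₂.1)
          simp [f'.2 _ _ h₂]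
        · simp [f.2 _ _ h₁]
    · intro q _
      ring

noncomputable instance : Category (GPA Γ) where
  Hom X Y := Γ.HomSpace X.len Y.len
  id X := castMap rfl
  comp f g := compMap f g
  id_comp f := id_comp' f
  comp_id f := comp_id' f
  assoc f g h := hom_ext fun p r => by
    simp only [compMap, Finset.sum_mul, Finset.mul_sum]
    rw [Finset.sum_comm]
    exact Finset.sum_congr rfl fun _ _ => Finset.sum_congr rfl fun _ _ => mul_assoc _ _ _

/-- The coefficient of a morphism on the basis vector `(p, q)`. -/
def coeff {m n : ℕ} (f : (⟨m⟩ : GPA Γ) ⟶ ⟨n⟩) (p : Γ.EdgePath m) (q : Γ.EdgePath n) : ℂ := f.1 p q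

noncomputable instance : Preadditive (GPA Γ) where
  homGroup X Y := inferInstanceAs (AddCommGroup (Γ.HomSpace X.len Y.len))
  add_comp _ _ _ f f' g := hom_ext fun p r => by
    change ∑ q, (f.1 p q + f'.1 p q) * g.1 q r = _ + _
    simp only [add_mul, Finset.sum_add_distrib]
    rfl
  comp_add _ _ _ f g g' := hom_ext fun p r => by
    change ∑ q, f.1 p q * (g.1 q r + g'.1 q r) = _ + _
    simp only [mul_add, Finset.sum_add_distrib]
    rfl

noncomputable instance : Linear ℂ (GPA Γ) where
  homModule X Y := inferInstanceAs (Module ℂ (Γ.HomSpace X.len Y.len))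
  smul_comp _ _ _ z f g := hom_ext fun p r => by
    change ∑ q, (z * f.1 p q) * g.1 q r = z * ∑ q, f.1 p q * g.1 q r
    simp only [Finset.mul_sum, mul_assoc]
  comp_smul _ _ _ f z g := hom_ext fun p r => by
    change ∑ q, f.1 p q * (z * g.1 q r) = z * ∑ q, f.1 p q * g.1 q r
    simp only [Finset.mul_sum, mul_left_comm]

/-- The identity, up to an equality of lengths, as an isomorphism. -/
noncomputable def castIso {m n : ℕ} (h : m = n) : (⟨m⟩ : GPA Γ) ≅ ⟨n⟩ where
  hom := castMap h
  inv := castMap h.symm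
  hom_inv_id := castMap_trans h h.symm
  inv_hom_id := castMap_trans h.symm h

noncomputable instance : MonoidalCategoryStruct (GPA Γ) where
  tensorObj X Y := ⟨X.len + Y.len⟩
  tensorUnit := ⟨0⟩
  tensorHom f g := tensorMap f g
  whiskerLeft X _ _ f := tensorMap (castMap rfl : Γ.HomSpace X.len X.len) f
  whiskerRight f Y := tensorMap f (castMap rfl : Γ.HomSpace Y.len Y.len)
  associator X Y Z := castIso (Nat.add_assoc X.len Y.len Z.len)
  leftUnitor X := castIso (Nat.zero_add X.len)
  rightUnitor X := castIso (Nat.add_zero X.len)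

noncomputable instance : MonoidalCategory (GPA Γ) := MonoidalCategory.ofTensorHom
  (id_tensorHom_id := fun _ _ => tensorMap_id)
  (id_tensorHom := fun _ _ _ _ => rfl)
  (tensorHom_id := fun _ _ => rfl)
  (tensorHom_comp_tensorHom := fun f₁ f₂ g₁ g₂ => interchange f₁ g₁ f₂ g₂)
  (associator_naturality := fun {X₁ X₂ X₃ Y₁ Y₂ Y₃} f₁ f₂ f₃ => hom_ext fun p r => by
    have h₁ := compMap_castMap (tensorMap (tensorMap f₁ f₂) f₃)
      (Nat.add_assoc Y₁.len Y₂.len Y₃.len) p r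
    have h₂ := castMap_compMap (Nat.add_assoc X₁.len X₂.len X₃.len)
      (tensorMap f₁ (tensorMap f₂ f₃)) p r
    refine h₁.trans (Eq.trans ?_ h₂.symm)
    have e₁ : ∀ {a b c : ℕ} (s : Γ.EdgePath (a + b + c)),
        s.right = ((s.cast (Nat.add_assoc a b c)).right).right := fun {a b c} s =>
      EdgePath.ext fun i => congrArg s.1 (Fin.ext (Nat.add_assoc a b i.1))
    have e₂ : ∀ {a b c : ℕ} (s : Γ.EdgePath (a + (b + c))),
        (s.cast (Nat.add_assoc a b c).symm).right = s.right.right := fun {a b c} s =>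
      EdgePath.ext fun i => congrArg s.1 (Fin.ext (Nat.add_assoc a b i.1))
    change (f₁.1 p.left.left (r.cast _).left.left * f₂.1 p.left.right (r.cast _).left.right) *
      f₃.1 p.right (r.cast _).right = f₁.1 (p.cast _).left r.left *
      (f₂.1 (p.cast _).right.left r.right.left * f₃.1 (p.cast _).right.right r.right.right)
    rw [e₁, e₂, mul_assoc]
    rfl)
  (leftUnitor_naturality := fun {X Y} f => hom_ext fun p r => by
    have h₁ := compMap_castMap (tensorMap (castMap rfl : Γ.HomSpace 0 0) f)
      (Nat.zero_add Y.len) p r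
    have h₂ := castMap_compMap (Nat.zero_add X.len) f p r
    refine h₁.trans (Eq.trans ?_ h₂.symm)
    have e : ∀ {a : ℕ} (s : Γ.EdgePath (0 + a)), s.right = s.cast (Nat.zero_add a) :=
      fun {a} s => EdgePath.ext fun i => congrArg s.1 (Fin.ext (Nat.zero_add i.1))
    by_cases hpr : (p.cast (Nat.zero_add X.len)).Parallel r
    · have h₃ : (castMap rfl : Γ.HomSpace 0 0).1 p.left (r.cast (Nat.zero_add Y.len).symm).left =
          1 := if_pos (EdgePath.ext fun i => by
        have hi : i = 0 := Fin.fin_one_eq_zero i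
        subst hi
        exact hpr.1)
      change (castMap rfl : Γ.HomSpace 0 0).1 p.left _ * f.1 p.right (r.cast _).right = _
      rw [h₃, one_mul, e, e]
      rfl
    · change (castMap rfl : Γ.HomSpace 0 0).1 p.left _ * f.1 p.right (r.cast _).right = _
      rw [e, e, f.2 _ _ hpr]
      exact mul_eq_zero_of_right _ (f.2 _ _ hpr))
  (rightUnitor_naturality := fun {X Y} f => hom_ext fun p r => by
    have h₁ := compMap_castMap (tensorMap f (castMap rfl : Γ.HomSpace 0 0))
      (Nat.add_zero Y.len) p r
    have h₂ := castMap_compMap (Nat.add_zero X.len) f p r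
    refine h₁.trans (Eq.trans ?_ h₂.symm)
    by_cases hpr : EdgePath.Parallel p r
    · have h₃ : (castMap rfl : Γ.HomSpace 0 0).1 p.right (r.cast (Nat.add_zero Y.len).symm).right =
          1 := if_pos (EdgePath.ext fun i => by
        have hi : i = 0 := Fin.fin_one_eq_zero i
        subst hi
        exact hpr.2)
      change f.1 p.left (r.cast _).left * (castMap rfl : Γ.HomSpace 0 0).1 p.right _ = _
      rw [h₃, mul_one]
      rfl
    · exact (mul_eq_zero_of_left (f.2 _ _ hpr) _).trans (f.2 _ _ hpr).symm)
  (pentagon := fun W X Y Z => by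
    have h₁ := tensorMap_castMap (Γ := Γ) (Nat.add_assoc W.len X.len Y.len)
      (rfl : Z.len = Z.len)
    have h₂ := tensorMap_castMap (Γ := Γ) (rfl : W.len = W.len)
      (Nat.add_assoc X.len Y.len Z.len)
    exact (congrArg₂ (fun a b => compMap a (compMap (castMap _) b)) h₁ h₂).trans
      ((congrArg _ (castMap_trans _ _)).trans ((castMap_trans _ _).trans
        (castMap_trans (Γ := Γ) (Nat.add_assoc (W.len + X.len) Y.len Z.len)
          (Nat.add_assoc W.len X.len (Y.len + Z.len))).symm)))
  (triangle := fun X Y => by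
    have h₁ := tensorMap_castMap (Γ := Γ) (rfl : X.len = X.len) (Nat.zero_add Y.len)
    have h₂ := tensorMap_castMap (Γ := Γ) (Nat.add_zero X.len) (rfl : Y.len = Y.len)
    exact (congrArg _ h₁).trans ((castMap_trans _ _).trans h₂.symm))

end GPA

/-! ### The pivotal structure of a graph planar algebra -/

namespace LoopGraph

variable {V : Type} (Γ : LoopGraph V)

open scoped Classical in
/-- The adjacency matrix. -/
noncomputable def adjMatrix : Matrix V V ℝ := fun u v => if Γ.Adj u v then 1 else 0

/-- A Frobenius-Perron eigenvector of the adjacency matrix: an eigenvector with positive entries. -/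
def IsFrobeniusPerron [Fintype V] (lam : V → ℝ) : Prop :=
  (∀ v, 0 < lam v) ∧ ∃ d : ℝ, Γ.adjMatrix.mulVec lam = d • lam

end LoopGraph

namespace GPA

open LoopGraph

variable {V : Type} (Γ : LoopGraph V) [Finite V] (lam : V → ℝ)

open scoped Classical in
/-- The evaluation `2 → 0`: the sum over all edges `e` of `√(lam (t e) / lam (s e)) (e ē, s e)`. -/
noncomputable def ev : (⟨2⟩ : GPA Γ) ⟶ ⟨0⟩ :=
  ⟨fun p q => if p.Parallel q then ((√(lam (p.1 1) / lam (p.1 0)) : ℝ) : ℂ) else 0,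
    fun _ _ h => if_neg h⟩

open scoped Classical in
/-- The coevaluation `0 → 2`: the sum over all edges `e` of `√(lam (t e) / lam (s e)) (s e, e ē)`. -/
noncomputable def coev : (⟨0⟩ : GPA Γ) ⟶ ⟨2⟩ :=
  ⟨fun p q => if p.Parallel q then ((√(lam (q.1 1) / lam (q.1 0)) : ℝ) : ℂ) else 0,
    fun _ _ h => if_neg h⟩

end GPA

/-! ## Monoidal functors from skein categories to graph planar algebras -/

/-- A monoidal functor from a skein category to a graph planar algebra is strict if it sends the
object `n` to `n` and its structure morphisms are identities. -/
structure IsStrict {R : (m n : ℕ) → Diagram m n → Diagram m n → Prop} {V : Type} [Finite V]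
    {Γ : LoopGraph V} (F : SkeinCat R ⥤ GPA Γ) [F.Monoidal] : Prop where
  obj_eq : ∀ X, F.obj X = ⟨X.strands⟩
  ε_eq : Functor.LaxMonoidal.ε F = eqToHom (obj_eq (𝟙_ (SkeinCat R))).symm
  μ_eq : ∀ X Y, Functor.LaxMonoidal.μ F X Y =
    eqToHom ((congrArg₂ tensorObj (obj_eq X) (obj_eq Y)).trans (obj_eq (X ⊗ Y)).symm)

/-- The image of a diagram under a strict monoidal functor. -/
noncomputable def IsStrict.image {R : (m n : ℕ) → Diagram m n → Diagram m n → Prop} {V : Type}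
    [Finite V] {Γ : LoopGraph V} {F : SkeinCat R ⥤ GPA Γ} [F.Monoidal] (hF : IsStrict F) {m n : ℕ}
    (f : Diagram m n) : (⟨m⟩ : GPA Γ) ⟶ ⟨n⟩ :=
  eqToHom (hF.obj_eq ⟨m⟩).symm ≫ F.map (SkeinCat.ofDiagram f) ≫ eqToHom (hF.obj_eq ⟨n⟩)

/-! ## The level 4 data -/

/-- `q₄ = exp (2πi / 48)`. -/
noncomputable def q₄ : ℂ := Complex.exp (2 * Real.pi * Complex.I / 48)

/-- The level 4 module fusion graph.  The vertices `1, …, 6` are `0, …, 5` here. -/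
def Γ₄ : LoopGraph (Fin 6) where
  Adj u v := s(u, v) ∈ ({s(1, 1), s(2, 2), s(4, 4), s(5, 5), s(0, 1), s(0, 5), s(1, 2), s(1, 4),
    s(1, 5), s(2, 3), s(2, 4), s(2, 5), s(3, 4), s(4, 5)} : Finset (Sym2 (Fin 6)))
  symm u v h := by rw [Sym2.eq_swap (a := v) (b := u)]; exact h

/-- The absolute values of the coordinates of the image of the trivalent vertex. -/
noncomputable def α₄ : Fin 9 → ℝ :=
  ![√(1 / 2 * (1 + 2 * √2 + √3 + √6)),
    √(1 / 2 * (-1 + √2 + √3)),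
    √(3 / 2 * (√(2 + √3) - 1)),
    √(2 + √3 - √(2 + √3)),
    √(1 / 2 * (√(2 + √3) - 1)),
    √(1 / 2 * (√3 + √(2 + √3))),
    √(1 - √(3 / 2) + 1 / √2),
    1 / 2 * (√(1 + √(6 - 3 * √3)) - √(√(2 + √3) - 1)),
    1 / 2 * (√(1 + √(6 - 3 * √3)) + √(√(2 + √3) - 1))]

/-!
The functor is built directly from a *cell function*: a symmetric real function on the triangles of
`Γ₄` which, scaled by square roots of the eigenvector, gives the coefficients of the trivalent
vertex.  Three facts have to be proved.

*The functor respects the skein relations* (`GPA.interp_eq_of_G2Rel`,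
`Code.satisfiesPolygonIdentities`).  The coefficient of a diagram with no lower boundary points on a
closed path of `Γ₄` is a universal scaling factor times an *amplitude* (`GPA.HasAmplitude`); rotating
a diagram rotates the argument of its amplitude, and the amplitude of a polygon is a sum over one
inner vertex of a product of cells.  The skein relations thereby become identities between cells, one
for each closed path of length at most five.  The values of the cell function lie in a tower of three
quadratic extensions of `ℤ[√2, √3]`.  Elements of the tower are represented exactly, with a sound
test for zero (`RealCode`, `QuadExt`), so that the kernel verifies the identities by evaluation.  For
the pentagon, one closed path in each orbit under rotation and reflection is enough.

*The functor descends to the semisimple quotient* (`GPA.interp_eq_zero_of_trace`).  The cells are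
real and the evaluation is the transpose of the coevaluation, so that reflecting a diagram amounts to
taking the conjugate transpose of its image.  The trace of `f` composed with its reflection is then,
at each vertex, a sum of the squared absolute values of the coefficients of `f` with its lower
strands bent up.  If it vanishes, then so does the image of `f`.

*The functor is faithful* (`GPA.negligible_of_interp_eq_zero`).  If the image of `f` vanishes, then
so does the image of each trace `tr (g ∘ f)`.  The skein relations reduce every closed diagram to a
multiple `z` of the empty diagram (`SkeinCat.exists_cong_smul_one`), and the empty diagram has
nonzero image, whence `z = 0` and `f` is negligible.

The reduction of closed diagrams usually rests on Euler's formula, which provides a face with at most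
five sides.  For formal composites, planarity is replaced by an induction on the number of vertices.
Diagrams are built upwards by stacking *strips*: horizontal paths with their ends pointing up and at
most two legs pointing down.  It is shown that adding a vertex or a cap on top of such a web gives a
combination of such webs with no more vertices.  The only obstruction is a strip with three legs.
It is pushed down through the web, and grows into a *ladder*, a row of adjacent strips, whenever it
meets the end of a strip with two legs, until it closes off a face with at most five sides, to which
a skein relation applies, or can be rewritten in terms of shorter strips.
-/

/-! ### Stacking diagrams -/

namespace SkeinCat
open Diagram

variable {R : (m n : ℕ) → Diagram m n → Diagram m n → Prop}

/-- The strand relabelling `m → n` along an equality. -/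
def relabel {m n : ℕ} (h : m = n) : (⟨m⟩ : SkeinCat R) ⟶ ⟨n⟩ := ofDiagram (wires h)

@[simp] theorem relabel_rfl {m : ℕ} (h : m = m) : (relabel h : (⟨m⟩ : SkeinCat R) ⟶ ⟨m⟩) = 𝟙 _ := rfl

@[simp] theorem relabel_trans {a b c : ℕ} (h : a = b) (h' : b = c) :
    (relabel h ≫ relabel h' : (⟨a⟩ : SkeinCat R) ⟶ ⟨c⟩) = relabel (h.trans h') :=
  ofDiagram_wires_trans h h'

@[simp] theorem relabel_trans_assoc {a b c : ℕ} {X : SkeinCat R} (h : a = b) (h' : b = c)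
    (f : (⟨c⟩ : SkeinCat R) ⟶ X) :
    relabel h ≫ relabel h' ≫ f = relabel (h.trans h') ≫ f := by
  rw [← Category.assoc, relabel_trans]

theorem ofDiagram_comp {a b c : ℕ} (f : Diagram a b) (g : Diagram b c) :
    (ofDiagram (comp f g) : (⟨a⟩ : SkeinCat R) ⟶ ⟨c⟩) = ofDiagram f ≫ ofDiagram g := rfl

theorem ofDiagram_tensor_assoc {a b a' b' a'' b'' : ℕ} (f : Diagram a b) (g : Diagram a' b')
    (h : Diagram a'' b'') :
    (ofDiagram (tensor (tensor f g) h) : (⟨a + a' + a''⟩ : SkeinCat R) ⟶ ⟨b + b' + b''⟩) =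
      relabel (Nat.add_assoc a a' a'') ≫ ofDiagram (tensor f (tensor g h)) ≫
        relabel (Nat.add_assoc b b' b'').symm := by
  have := sound (R := R) (Cong.tensor_assoc f g h)
  rw [ofDiagram_comp, ofDiagram_comp] at this
  change _ ≫ relabel _ = relabel _ ≫ _ at this
  rw [← Category.assoc, ← this, Category.assoc, relabel_trans, relabel_rfl, Category.comp_id]

theorem ofDiagram_tensor_comp {a b c a' b' c' : ℕ} (f : Diagram a b) (g : Diagram b c)
    (f' : Diagram a' b') (g' : Diagram b' c') :
    (ofDiagram (tensor (comp f g) (comp f' g')) : (⟨a + a'⟩ : SkeinCat R) ⟶ ⟨c + c'⟩) =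
      ofDiagram (tensor f f') ≫ ofDiagram (tensor g g') :=
  sound (Cong.interchange f g f' g')

theorem ofDiagram_tensor_congr {a b c d : ℕ} {f f' : Diagram a b} {g g' : Diagram c d}
    (hf : Cong R f f') (hg : Cong R g g') :
    (ofDiagram (tensor f g) : (⟨a + c⟩ : SkeinCat R) ⟶ ⟨b + d⟩) = ofDiagram (tensor f' g') :=
  sound (Cong.tensor_congr hf hg)

/-- The two ways of sliding `f` past `g` along juxtaposed strands. -/
theorem ofDiagram_slide {a b c d : ℕ} (f : Diagram a b) (g : Diagram c d) :
    (ofDiagram (tensor f (one c)) ≫ ofDiagram (tensor (one b) g) :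
      (⟨a + c⟩ : SkeinCat R) ⟶ ⟨b + d⟩) =
      ofDiagram (tensor (one a) g) ≫ ofDiagram (tensor f (one d)) := by
  rw [← ofDiagram_tensor_comp, ← ofDiagram_tensor_comp]
  exact ofDiagram_tensor_congr ((Cong.comp_one f).trans (Cong.one_comp f).symm)
    ((Cong.one_comp g).trans (Cong.comp_one g).symm)

theorem ofDiagram_tensor {a b c d : ℕ} (f : Diagram a b) (g : Diagram c d) :
    (ofDiagram (tensor f g) : (⟨a + c⟩ : SkeinCat R) ⟶ ⟨b + d⟩) =
      ofDiagram (tensor f (one c)) ≫ ofDiagram (tensor (one b) g) := by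
  rw [← ofDiagram_tensor_comp]
  exact ofDiagram_tensor_congr (Cong.comp_one f).symm (Cong.one_comp g).symm

/-- The diagram `g` with `i` strands to its left and `r` strands to its right. -/
def layer {a b : ℕ} (i : ℕ) (g : Diagram a b) (r : ℕ) : Diagram (i + a + r) (i + b + r) :=
  tensor (tensor (one i) g) (one r)

theorem layer_comp {a b c : ℕ} (i : ℕ) (g : Diagram a b) (h : Diagram b c) (r : ℕ) :
    (ofDiagram (layer i (comp g h) r) : (⟨i + a + r⟩ : SkeinCat R) ⟶ ⟨i + c + r⟩) =
      ofDiagram (layer i g r) ≫ ofDiagram (layer i h r) := by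
  unfold layer
  rw [← ofDiagram_tensor_comp]
  exact ofDiagram_tensor_congr (((Cong.tensor_congr (Cong.one_comp _).symm (Cong.refl _)).trans
    (Cong.interchange _ _ _ _))) (Cong.one_comp _).symm

/-- Strands to the left of a layer can be split off. -/
theorem layer_add {a b : ℕ} (m k : ℕ) (g : Diagram a b) (r : ℕ) :
    (ofDiagram (layer (m + k) g r) : (⟨m + k + a + r⟩ : SkeinCat R) ⟶ ⟨m + k + b + r⟩) =
      relabel (by omega) ≫ ofDiagram (tensor (one m) (layer k g r)) ≫ relabel (by omega) := by
  have h₁ : (ofDiagram (tensor (one (m + k)) g) : (⟨m + k + a⟩ : SkeinCat R) ⟶ ⟨m + k + b⟩) =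
      relabel (Nat.add_assoc m k a) ≫ ofDiagram (tensor (one m) (tensor (one k) g)) ≫
        relabel (Nat.add_assoc m k b).symm := by
    rw [← ofDiagram_tensor_assoc]
    exact ofDiagram_tensor_congr (Cong.one_tensor_one m k).symm (Cong.refl g)
  have h₂ : (ofDiagram (layer (m + k) g r) : (⟨m + k + a + r⟩ : SkeinCat R) ⟶ ⟨m + k + b + r⟩) =
      relabel (by omega) ≫ ofDiagram (tensor (tensor (one m) (tensor (one k) g)) (one r)) ≫
        relabel (by omega) := by
    have e : ∀ {x y : ℕ} (h : x = y), (relabel (congrArg (· + r) h) :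
        (⟨x + r⟩ : SkeinCat R) ⟶ ⟨y + r⟩) = ofDiagram (tensor (wires h) (one r)) := by
      rintro x _ rfl
      exact (sound (Cong.one_tensor_one x r)).symm
    rw [e (Nat.add_assoc m k a), e (Nat.add_assoc m k b).symm, ← ofDiagram_tensor_comp,
      ← ofDiagram_tensor_comp]
    have h₃ := congrArg (fun x => tensorMor x (𝟙 (⟨r⟩ : SkeinCat R))) h₁
    refine Eq.trans h₃ ?_
    exact ofDiagram_tensor_congr (Cong.refl _) ((Cong.one_comp _).trans (Cong.one_comp _)).symm
  rw [h₂, ofDiagram_tensor_assoc]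
  simp only [Category.assoc, relabel_trans, relabel_trans_assoc]
  rfl

variable (R) in
/-- Morphisms out of `0`, with all numbers of upper boundary points at once. -/
abbrev Vectors : Type := (n : ℕ) → ((⟨0⟩ : SkeinCat R) ⟶ ⟨n⟩)

/-- Stacking `g`, with its leftmost leg at position `i`, on top of a vector.  The components on too
few strands are sent to zero. -/
def op {a b : ℕ} (g : Diagram a b) (i : ℕ) : Vectors R →ₗ[ℂ] Vectors R where
  toFun f n := if h : i + b ≤ n then
    f (i + a + (n - (i + b))) ≫ ofDiagram (layer i g (n - (i + b))) ≫ relabel (by omega) else 0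
  map_add' f f' := by
    funext n
    by_cases h : i + b ≤ n <;> simp [h]
  map_smul' z f := by
    funext n
    by_cases h : i + b ≤ n <;> simp [h]

theorem op_apply {a b : ℕ} (g : Diagram a b) (i r : ℕ) (f : Vectors R) {n : ℕ}
    (h : i + b + r = n) :
    op g i f n = f (i + a + r) ≫ ofDiagram (layer i g r) ≫ relabel h := by
  have h₁ : i + b ≤ n := by omega
  have h₂ : n - (i + b) = r := by omega
  change dite _ _ _ = _
  rw [dif_pos h₁]
  subst h₂
  rfl

theorem op_apply_of_lt {a b : ℕ} (g : Diagram a b) (i : ℕ) (f : Vectors R) {n : ℕ}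
    (h : n < i + b) : op g i f n = 0 := dif_neg (by omega)

theorem vec_relabel (f : Vectors R) {m n : ℕ} (h : m = n) : f m ≫ relabel h = f n := by
  subst h; simp

theorem op_congr {a b : ℕ} {g h : Diagram a b} (e : Cong R g h) (i : ℕ) :
    (op g i : Vectors R →ₗ[ℂ] Vectors R) = op h i := by
  ext f n
  rcases lt_or_ge n (i + b) with hn | hn
  · rw [op_apply_of_lt _ _ _ hn, op_apply_of_lt _ _ _ hn]
  · obtain ⟨r, rfl⟩ := Nat.exists_eq_add_of_le hn
    rw [op_apply _ _ r _ rfl, op_apply _ _ r _ rfl]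
    congr 2
    exact ofDiagram_tensor_congr (Cong.tensor_congr (Cong.refl _) e) (Cong.refl _)

theorem op_comp {a b c : ℕ} (g : Diagram a b) (h : Diagram b c) (i : ℕ) (f : Vectors R) :
    op (comp g h) i f = op h i (op g i f) := by
  funext n
  rcases lt_or_ge n (i + c) with hn | hn
  · rw [op_apply_of_lt _ _ _ hn, op_apply_of_lt _ _ _ hn]
  · obtain ⟨r, rfl⟩ := Nat.exists_eq_add_of_le hn
    rw [op_apply _ _ r _ rfl, op_apply _ _ r _ rfl, op_apply _ _ r _ rfl, layer_comp]
    simp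

/-- Diagrams stacked at disjoint places commute. -/
theorem op_comm {a b c d : ℕ} (g : Diagram a b) (h : Diagram c d) (i k : ℕ) (f : Vectors R) :
    op h (i + b + k) (op g i f) = op g i (op h (i + a + k) f) := by
  funext n
  rcases lt_or_ge n (i + b + k + d) with hn | hn
  · rw [op_apply_of_lt _ _ _ hn]
    rcases lt_or_ge n (i + b) with hn' | hn'
    · rw [op_apply_of_lt _ _ _ hn']
    · obtain ⟨r, rfl⟩ := Nat.exists_eq_add_of_le hn'
      rw [op_apply _ _ r _ rfl, op_apply_of_lt _ _ _ (by omega)]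
      simp
  · obtain ⟨r, rfl⟩ := Nat.exists_eq_add_of_le hn
    rw [op_apply _ _ r _ rfl, op_apply _ _ (k + c + r) _ (by omega),
      op_apply g _ (k + d + r) _ (by omega), op_apply h _ r _ (by omega), layer_add, layer_add]
    rw [← vec_relabel f (show i + a + k + c + r = i + a + (k + c + r) by omega)]
    have e : (ofDiagram (layer i g (k + c + r)) ≫ ofDiagram (tensor (one (i + b)) (layer k h r)) :
        (⟨i + a + (k + c + r)⟩ : SkeinCat R) ⟶ ⟨i + b + (k + d + r)⟩) =
        ofDiagram (tensor (one (i + a)) (layer k h r)) ≫ ofDiagram (layer i g (k + d + r)) :=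
      ofDiagram_slide (tensor (one i) g) (layer k h r)
    have e' := congrArg (fun x => f (i + a + k + c + r) ≫ relabel (by omega) ≫ x ≫
      relabel (show i + b + (k + d + r) = i + b + k + d + r by omega)) e
    simpa only [Category.assoc, relabel_trans, relabel_trans_assoc, relabel_rfl, Category.comp_id,
      Category.id_comp] using e'

theorem op_tensor {a b c d : ℕ} (g : Diagram a b) (h : Diagram c d) (i : ℕ) (f : Vectors R) :
    op (tensor g h) i f = op h (i + b) (op g i f) := by
  funext n
  rcases lt_or_ge n (i + b + d) with hn | hn
  · rw [op_apply_of_lt _ _ _ hn, op_apply_of_lt _ _ _ (by omega)]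
  · obtain ⟨r, rfl⟩ := Nat.exists_eq_add_of_le hn
    rw [op_apply _ _ r _ (by omega), op_apply _ _ r _ rfl, op_apply _ _ (c + r) _ (by omega)]
    have h₁ : (ofDiagram (layer i (tensor g h) r) :
        (⟨i + (a + c) + r⟩ : SkeinCat R) ⟶ ⟨i + (b + d) + r⟩) =
        relabel (by omega) ≫ ofDiagram (layer i g (c + r)) ≫ relabel (by omega) ≫
          ofDiagram (layer (i + b) h r) ≫ relabel (by omega) := by
      have e : ∀ {x y : ℕ} (h : x = y), (relabel (congrArg (· + r) h) :
          (⟨x + r⟩ : SkeinCat R) ⟶ ⟨y + r⟩) = ofDiagram (tensor (wires h) (one r)) := by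
        rintro x _ rfl
        exact (sound (Cong.one_tensor_one x r)).symm
      have e₁ : (ofDiagram (tensor (one i) (tensor g h)) :
          (⟨i + (a + c)⟩ : SkeinCat R) ⟶ ⟨i + (b + d)⟩) =
          relabel (Nat.add_assoc i a c).symm ≫ ofDiagram (tensor (tensor (one i) g) h) ≫
            relabel (Nat.add_assoc i b d) := by
        rw [ofDiagram_tensor_assoc]
        simp
      have e₂ : (ofDiagram (layer i (tensor g h) r) :
          (⟨i + (a + c) + r⟩ : SkeinCat R) ⟶ ⟨i + (b + d) + r⟩) =
          relabel (by omega) ≫ ofDiagram (tensor (tensor (tensor (one i) g) h) (one r)) ≫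
            relabel (by omega) := by
        rw [e (Nat.add_assoc i a c).symm, e (Nat.add_assoc i b d), ← ofDiagram_tensor_comp,
          ← ofDiagram_tensor_comp]
        refine Eq.trans (congrArg (fun x => tensorMor x (𝟙 (⟨r⟩ : SkeinCat R))) e₁) ?_
        exact ofDiagram_tensor_congr (Cong.refl _)
          ((Cong.one_comp _).trans (Cong.one_comp _)).symm
      rw [e₂, ofDiagram_tensor_assoc, ofDiagram_tensor]
      unfold layer
      rw [ofDiagram_tensor_assoc (one (i + b)) h (one r)]
      simp only [Category.assoc, relabel_trans, relabel_trans_assoc, relabel_rfl, Category.id_comp]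
    rw [h₁, ← vec_relabel f (show i + (a + c) + r = i + a + (c + r) by omega)]
    simp only [Category.assoc, relabel_trans, relabel_rfl, Category.comp_id]

theorem op_one {k : ℕ} (i : ℕ) (f : Vectors R) (n : ℕ) :
    op (one k) i f n = if i + k ≤ n then f n else 0 := by
  split_ifs with hn
  · obtain ⟨r, rfl⟩ := Nat.exists_eq_add_of_le hn
    rw [op_apply _ _ r _ rfl]
    have : (ofDiagram (layer i (one k) r) : (⟨i + k + r⟩ : SkeinCat R) ⟶ ⟨i + k + r⟩) = 𝟙 _ :=
      sound ((Cong.tensor_congr (Cong.one_tensor_one i k) (Cong.refl _)).trans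
        (Cong.one_tensor_one (i + k) r))
    rw [this]
    simp
  · exact op_apply_of_lt _ _ _ (by omega)

theorem op_wires {a b : ℕ} (h : a = b) (i : ℕ) (f : Vectors R) :
    op (wires h) i f = op (one a) i f := by
  subst h; rfl

theorem op_add {a b : ℕ} (g h : Diagram a b) (i : ℕ) (f : Vectors R) :
    op (add g h) i f = op g i f + op h i f := by
  funext n
  rcases lt_or_ge n (i + b) with hn | hn
  · rw [Pi.add_apply]; simp only [op_apply_of_lt _ _ _ hn, add_zero]
  · obtain ⟨r, rfl⟩ := Nat.exists_eq_add_of_le hn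
    rw [Pi.add_apply]
    simp only [op_apply _ _ r _ rfl]
    have : (ofDiagram (layer i (add g h) r) : (⟨i + a + r⟩ : SkeinCat R) ⟶ ⟨i + b + r⟩) =
        ofDiagram (layer i g r) + ofDiagram (layer i h r) :=
      sound ((Cong.tensor_congr (Cong.tensor_add _ _ _) (Cong.refl _)).trans
        (Cong.add_tensor _ _ _))
    rw [this]
    simp

theorem op_smul {a b : ℕ} (z : ℂ) (g : Diagram a b) (i : ℕ) (f : Vectors R) :
    op (smul z g) i f = z • op g i f := by
  funext n
  rcases lt_or_ge n (i + b) with hn | hn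
  · rw [Pi.smul_apply]; simp only [op_apply_of_lt _ _ _ hn, smul_zero]
  · obtain ⟨r, rfl⟩ := Nat.exists_eq_add_of_le hn
    rw [Pi.smul_apply]
    simp only [op_apply _ _ r _ rfl]
    have : (ofDiagram (layer i (smul z g) r) : (⟨i + a + r⟩ : SkeinCat R) ⟶ ⟨i + b + r⟩) =
        z • ofDiagram (layer i g r) :=
      sound ((Cong.tensor_congr (Cong.tensor_smul _ _ _) (Cong.refl _)).trans
        (Cong.smul_tensor _ _ _))
    rw [this]
    simp

theorem op_zero {a b : ℕ} (i : ℕ) (f : Vectors R) :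
    op (zero : Diagram a b) i f = 0 := by
  rw [← op_congr (Cong.zero_smul (zero : Diagram a b)), op_smul, zero_smul]

/-! ### Moving vertices, caps and strips -/

/-- The vector `f` lives on `n` strands. -/
def OnStrands (n : ℕ) (f : Vectors R) : Prop := ∀ m, m ≠ n → f m = 0

theorem OnStrands.op {a b : ℕ} (g : Diagram a b) {i n m : ℕ} {f : Vectors R}
    (hf : OnStrands n f) (hm : m + a = n + b) : OnStrands m (op g i f) := by
  intro l hl
  rcases lt_or_ge l (i + b) with h | h
  · exact op_apply_of_lt _ _ _ h
  · obtain ⟨r, rfl⟩ := Nat.exists_eq_add_of_le h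
    rw [op_apply _ _ r _ rfl, hf _ (by omega)]
    simp

theorem OnStrands.op_one {k i n : ℕ} {f : Vectors R} (hf : OnStrands n f) (h : i + k ≤ n) :
    SkeinCat.op (one k) i f = f := by
  funext m
  rw [SkeinCat.op_one]
  split_ifs with hm
  · rfl
  · exact (hf m (by omega)).symm

/-- Commutation of diagrams at disjoint places, for arbitrary positions. -/
theorem op_comm_le {a b c d : ℕ} (g : Diagram a b) (h : Diagram c d) {i j j' : ℕ}
    (hij : i + b ≤ j) (hj : j' + b = j + a) (f : Vectors R) :
    op h j (op g i f) = op g i (op h j' f) := by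
  obtain ⟨k, rfl⟩ := Nat.exists_eq_add_of_le hij
  obtain rfl : j' = i + a + k := by omega
  exact op_comm g h i k f

theorem op_op_one_of_le {a b k : ℕ} (g : Diagram a b) {i j : ℕ} (h : i + k ≤ j + a)
    (f : Vectors R) : op g j (op (one k) i f) = op g j f := by
  funext n
  rcases lt_or_ge n (j + b) with hn | hn
  · rw [op_apply_of_lt _ _ _ hn, op_apply_of_lt _ _ _ hn]
  · obtain ⟨r, rfl⟩ := Nat.exists_eq_add_of_le hn
    rw [op_apply _ _ r _ rfl, op_apply _ _ r _ rfl, op_one, if_pos (by omega)]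

/-- The components of `f` on fewer than `t` strands vanish. -/
def MinStrands (t : ℕ) (f : Vectors R) : Prop := ∀ n, n < t → f n = 0

theorem MinStrands.op_one {t i k : ℕ} {f : Vectors R} (hf : MinStrands t f) (h : i + k ≤ t) :
    SkeinCat.op (one k) i f = f := by
  funext m
  rw [SkeinCat.op_one]
  split_ifs with hm
  · rfl
  · exact (hf m (by omega)).symm

theorem minStrands_op {a b : ℕ} (g : Diagram a b) (i : ℕ) (f : Vectors R) :
    MinStrands (i + b) (op g i f) := fun _ hn => op_apply_of_lt _ _ _ hn

theorem MinStrands.op {a b t u : ℕ} (g : Diagram a b) (i : ℕ) {f : Vectors R}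
    (hf : MinStrands t f) (h : u + a ≤ t + b) : MinStrands u (op g i f) := by
  intro n hn
  rcases lt_or_ge n (i + b) with h' | h'
  · exact op_apply_of_lt _ _ _ h'
  · obtain ⟨r, rfl⟩ := Nat.exists_eq_add_of_le h'
    rw [op_apply _ _ r _ rfl, hf _ (by omega)]
    simp

theorem op_tensor_one {a b k : ℕ} (g : Diagram a b) (i : ℕ) (f : Vectors R) :
    op (tensor g (one k)) i f = op g i (op (one k) (i + a) f) := by
  rw [op_tensor]
  exact op_comm_le g (one k) le_rfl (by omega) f

theorem op_one_tensor {a b k : ℕ} (g : Diagram a b) (i : ℕ) (f : Vectors R) :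
    op (tensor (one k) g) i f = op g (i + k) f := by
  rw [op_tensor, op_op_one_of_le _ (by omega)]

theorem op_cap_cup_right (i : ℕ) (f : Vectors R) :
    op cap (i + 1) (op cup i f) = op (one 1) i f := by
  rw [← op_congr Cong.zigzag_left, op_comp, op_one_tensor, op_tensor_one,
    ← op_comm_le cup (one 1) (le_refl (i + 2)) (by omega), op_op_one_of_le _ (by omega)]

theorem op_cap_cup_left (i : ℕ) (f : Vectors R) :
    op cap i (op cup (i + 1) f) = op (one 1) i f := by
  rw [← op_congr Cong.zigzag_right, op_comp, op_one_tensor, op_tensor_one,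
    (minStrands_op cup (i + 1) f).op_one (by omega)]

theorem op_split (i : ℕ) (f : Vectors R) : op split i f = op vertex i (op cup (i + 1) f) := by
  rw [split, op_comp, op_one_tensor, op_tensor_one,
    (minStrands_op cup (i + 1) f).op_one (by omega)]

theorem op_tripod (i : ℕ) (f : Vectors R) : op tripod i f = op split i (op cup i f) := by
  rw [tripod, op_comp, op_tensor_one, (minStrands_op cup i f).op_one (by omega)]

theorem op_rotate {n : ℕ} (g : Diagram 0 (n + 1)) (i : ℕ) (f : Vectors R) :
    op (rotate g) i f = op cap i (op g (i + 1) (op cup i f)) := by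
  have h₁ : MinStrands (i + (n + 3)) (op g (i + 1) (op cup i f)) :=
    (minStrands_op cup i f).op g _ (by omega)
  rw [rotate, op_comp, op_comp, op_comp, op_comp, op_wires (Nat.zero_add (n + 1)), op_tensor_one,
    op_wires (by omega : 1 + (n + 1) + 1 = 2 + (n + 1)), op_tensor_one,
    op_one_tensor, (minStrands_op cup i f).op_one (by omega), h₁.op_one (by omega),
    h₁.op_one (by omega), (h₁.op (u := i + (n + 1)) cap i (by omega)).op_one (by omega)]

/-- A horizontal path with `k` vertices, its `k` legs down and its two ends up. -/
def strip : (k : ℕ) → Diagram k 2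
  | 0 => cup
  | k + 1 => comp (tensor (strip k) (one 1)) (@tensor 1 1 2 1 (one 1) vertex)

theorem op_strip_zero (i : ℕ) (f : Vectors R) : op (strip 0) i f = op cup i f := rfl

theorem op_strip_succ (k i : ℕ) (f : Vectors R) :
    op (strip (k + 1)) i f = op vertex (i + 1) (op (strip k) i f) := by
  rw [strip, op_comp, op_one_tensor, op_tensor_one,
    ← op_comm_le (strip k) (one 1) (le_refl (i + 2)) (by omega), op_op_one_of_le _ (by omega)]

variable {q : ℂ}

/-- The rotation relation with one leg bent down. -/
theorem op_cap_split_cup (i : ℕ) (f : Vectors (G2Rel q)) :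
    op cap i (op split (i + 1) (op cup (i + 1) f)) = op split i f := by
  have h : op cap (i + 2) (op tripod i f) = op split i f := by
    rw [op_tripod, op_comm_le split cap le_rfl rfl, op_cap_cup_right, op_op_one_of_le _ le_rfl]
  rw [← op_congr (Cong.rel G2Rel.rotate), op_rotate, op_tripod,
    op_comm_le cap cap (i := i) (j := i + 2) (j' := i + 4) (by omega) (by omega),
    op_comm_le split cap (j := i + 4) (j' := i + 3) (by omega) (by omega),
    op_comm_le cup cap (i := i + 1) (j := i + 3) (j' := i + 1) (by omega) (by omega),
    op_cap_cup_right] at h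
  rw [← h, op_op_one_of_le _ (by omega)]

theorem op_cap_split_right (i : ℕ) (f : Vectors R) :
    op cap (i + 1) (op split i f) = op vertex i f := by
  rw [op_split, op_comm_le vertex cap (i := i) (j := i + 1) (j' := i + 2) (by omega) (by omega),
    op_cap_cup_right, op_op_one_of_le _ (by omega)]

/-- The rotation invariance of the vertex: a leg can be bent on either side. -/
theorem op_vertex_cup (i : ℕ) (f : Vectors (G2Rel q)) :
    op vertex (i + 1) (op cup i f) = op split i f := by
  rw [← op_cap_split_right, ← op_cap_split_cup (i + 1),
    op_comm_le cup cup (i := i) (j := i + 2) (j' := i) (by omega) (by omega),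
    op_comm_le cup split (i := i) (j := i + 2) (j' := i) (by omega) (by omega), op_cap_cup_right,
    (minStrands_op split i _).op_one (by omega),
    op_comm_le split cap (i := i) (j := i + 2) (j' := i + 1) (by omega) (by omega),
    op_cap_cup_right, op_op_one_of_le _ (by omega)]

theorem op_cap_split_left (i : ℕ) (f : Vectors (G2Rel q)) :
    op cap i (op split (i + 1) f) = op vertex i f := by
  rw [← op_vertex_cup, ← op_comm_le cap vertex (i := i) (j := i) (by omega) (by omega),
    op_cap_cup_left, op_op_one_of_le _ (by omega)]

theorem op_cap_vertex (i : ℕ) (f : Vectors (G2Rel q)) :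
    op cap i (op vertex (i + 1) f) = op cap i (op vertex i f) := by
  rw [← op_cap_split_right, ← op_cap_split_left,
    op_comm_le cap cap (i := i) (j := i) (j' := i + 2) (by omega) (by omega)]

theorem op_vertex_strip (k i : ℕ) (f : Vectors (G2Rel q)) :
    op vertex i (op (strip k) (i + 1) f) = op (strip (k + 1)) i f := by
  induction k with
  | zero => rw [op_strip_zero, ← op_split, op_strip_succ, op_strip_zero, op_vertex_cup]
  | succ k ih =>
    rw [op_strip_succ, op_strip_succ (k + 1), ← ih,
      op_comm_le vertex vertex (i := i) (j := i + 1) (j' := i + 2) (by omega) (by omega)]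

/-- A strip whose last leg is the left end of another strip. -/
theorem op_strip_strip_right (a b i : ℕ) (f : Vectors (G2Rel q)) :
    op (strip (a + 1)) i (op (strip b) (i + a) f) =
      op (strip (b + 1)) (i + 1) (op (strip a) i f) := by
  rw [op_strip_succ, ← op_vertex_strip b (i + 1),
    op_comm_le (strip a) (strip b) (i := i) (j := i + 1 + 1) (j' := i + a) (by omega) (by omega)]

/-- A strip whose first leg is the right end of another strip. -/
theorem op_strip_strip_left (a b i : ℕ) (f : Vectors (G2Rel q)) :
    op (strip (a + 1)) (i + 1) (op (strip b) i f) =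
      op (strip (b + 1)) i (op (strip a) (i + b) f) := by
  rw [← op_vertex_strip, op_comm_le (strip b) (strip a) (i := i) (j := i + 1 + 1) (j' := i + b)
    (by omega) (by omega), op_strip_succ]

theorem op_split_eq_strip (i : ℕ) (f : Vectors (G2Rel q)) : op split i f = op (strip 1) i f := by
  rw [op_strip_succ, op_strip_zero, op_vertex_cup]

/-- Splitting off `k` legs, one after the other, to the left. -/
def comb (f : Vectors R) (i : ℕ) : ℕ → Vectors R
  | 0 => f
  | k + 1 => op split (i + k) (comb f i k)

theorem op_fan (k i : ℕ) (f : Vectors R) : op (fan k) i f = comb (op cup i f) i k := by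
  induction k with
  | zero => rfl
  | succ k ih =>
    have h : ∀ k, MinStrands (i + k + 2) (comb (op cup i f) i k) := by
      intro k
      induction k with
      | zero => exact minStrands_op cup i f
      | succ k ih => exact ih.op _ _ (by omega)
    rw [fan, op_comp, op_comp, op_wires, op_one_tensor, op_tensor_one, ih, (h k).op_one (by omega),
      comb, ((h k).op (u := i + k + 3) split (i + k) (by omega)).op_one (by omega)]

theorem op_polygon (k i : ℕ) (f : Vectors R) :
    op (polygon k) i f = op cap (i + k) (comb (op cup i f) i k) := by
  rw [polygon, op_comp, op_one_tensor, op_fan]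

theorem op_vertex_comb (k i : ℕ) (f : Vectors R) :
    op vertex (i + k + 1) (comb f i k) = comb (op vertex (i + 1) f) i k := by
  induction k with
  | zero => rfl
  | succ k ih =>
    rw [comb, comb, ← ih, op_comm_le split vertex (j := i + (k + 1) + 1) (j' := i + k + 1)
      (by omega) (by omega)]

/-- A polygon whose last `l` legs are bent down. -/
theorem op_cap_comb_strip (m l i : ℕ) (f : Vectors (G2Rel q)) :
    op cap (i + m + 1) (op vertex (i + m + 1) (comb (op (strip l) i f) i (m + 1))) =
      op vertex (i + m) (comb (op (strip (l + 1)) i f) i m) := by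
  rw [← op_cap_vertex, show i + m + 1 + 1 = i + (m + 1) + 1 by omega, op_vertex_comb, comb,
    op_cap_split_right, op_strip_succ]

/-- Joining the strands `i + 1, …, i + k` to the `k` strands after them, from the inside out. -/
def nestedCaps (i : ℕ) : ℕ → Vectors R → Vectors R
  | 0, f => f
  | k + 1, f => nestedCaps i k (op cap (i + k + 1) f)

/-- A polygon with one leg up and the other legs down is a strip closed off by a vertex. -/
theorem nestedCaps_polygon (k i : ℕ) (f : Vectors (G2Rel q)) :
    nestedCaps i k (op (polygon (k + 1)) i f) = op vertex i (op (strip k) i f) := by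
  have h : ∀ m l, nestedCaps i m (op vertex (i + m) (comb (op (strip l) i f) i m)) =
      op vertex i (op (strip (m + l)) i f) := by
    intro m
    induction m with
    | zero => intro l; rw [Nat.zero_add]; rfl
    | succ m ih =>
      intro l
      rw [nestedCaps, ← add_assoc i m 1, op_cap_comb_strip, ih]
      rw [show m + (l + 1) = m + 1 + l by omega]
  rw [op_polygon, comb, ← add_assoc, op_cap_split_right]
  exact h k 0

theorem op_vertex_strip_zero (i : ℕ) (f : Vectors (G2Rel q)) :
    op vertex i (op (strip 0) i f) = 0 := by
  rw [← nestedCaps_polygon, op_congr (Cong.rel G2Rel.lollipop), op_zero]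
  rfl

theorem op_vertex_strip_one (i : ℕ) (f : Vectors (G2Rel q)) :
    op vertex i (op (strip 1) i f) = (quantumInt q 7 - 1) • op (one 1) i f := by
  rw [← nestedCaps_polygon, op_congr (Cong.rel G2Rel.bigon), op_smul, ← op_cap_cup_right]
  exact map_smul (op cap (i + 1)) _ _

/-! ### Webs and the reduction of closed diagrams -/

/-- The empty diagram. -/
def emptyWeb : Vectors R := fun n => if h : 0 = n then relabel h else 0

/-- The vector is represented by a diagram with `N` vertices and `n` upper boundary points that is
built, from bottom to top, by adding strips with at most two vertices. -/
inductive Web : ℕ → ℕ → Vectors (G2Rel q) → Prop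
  | nil : Web 0 0 emptyWeb
  | cons {N n m k i : ℕ} {f : Vectors (G2Rel q)} (hf : Web N n f) (hk : k ≤ 2) (hi : i + k ≤ n)
      (hm : m + k = n + 2) : Web (N + k) m (op (strip k) i f)

theorem Web.onStrands {N n : ℕ} {f : Vectors (G2Rel q)} (hf : Web N n f) : OnStrands n f := by
  induction hf with
  | nil => intro m hm; exact dif_neg hm.symm
  | cons hf hk hi hm ih => exact ih.op _ hm

variable (q) in
/-- The span of the webs with at most `N` vertices and exactly `n` upper boundary points. -/
def webSpan (N n : ℕ) : Submodule ℂ (Vectors (G2Rel q)) :=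
  Submodule.span ℂ {f | ∃ N' ≤ N, Web N' n f}

theorem Web.mem {N N' n : ℕ} {f : Vectors (G2Rel q)} (hf : Web N' n f) (h : N' ≤ N) :
    f ∈ webSpan q N n := Submodule.subset_span ⟨N', h, hf⟩

theorem webSpan_mono {N N' n : ℕ} (h : N ≤ N') : webSpan q N n ≤ webSpan q N' n :=
  Submodule.span_mono <| by
    rintro _ ⟨M, hM, hf⟩
    exact ⟨M, hM.trans h, hf⟩

theorem Web.eq_emptyWeb {N n : ℕ} {f : Vectors (G2Rel q)} (hf : Web N n f) (hn : n = 0) :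
    f = emptyWeb := by
  cases hf with
  | nil => rfl
  | cons hf hk hi hm => omega

theorem map_mem_of_web {N n : ℕ} (L : Vectors (G2Rel q) →ₗ[ℂ] Vectors (G2Rel q))
    (P : Submodule ℂ (Vectors (G2Rel q))) (h : ∀ N' ≤ N, ∀ f, Web N' n f → L f ∈ P)
    {f : Vectors (G2Rel q)} (hf : f ∈ webSpan q N n) : L f ∈ P :=
  (Submodule.span_le (p := P.comap L)).2 (by
    rintro _ ⟨N', hN, hf⟩
    exact h N' hN _ hf) hf

theorem onStrands_of_mem {N n : ℕ} {f : Vectors (G2Rel q)} (hf : f ∈ webSpan q N n) :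
    OnStrands n f := by
  intro m hm
  refine (Submodule.span_le (p := (LinearMap.proj (R := ℂ) m).ker)).2 ?_ hf
  rintro f ⟨N', -, hf⟩
  exact hf.onStrands m hm

theorem strip_mem {N n m k i : ℕ} {f : Vectors (G2Rel q)} (hf : f ∈ webSpan q N n) (hk : k ≤ 2)
    (hi : i + k ≤ n) (hm : m + k = n + 2) : op (strip k) i f ∈ webSpan q (N + k) m :=
  map_mem_of_web _ _ (fun _ hN _ hf => (hf.cons hk hi hm).mem (by omega)) hf

theorem cup_mem {N n i : ℕ} {f : Vectors (G2Rel q)} (hf : f ∈ webSpan q N n)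
    (hi : i ≤ n) : op cup i f ∈ webSpan q N (n + 2) :=
  strip_mem (k := 0) hf (by omega) (by omega) (by omega)

theorem split_mem {N n i : ℕ} {f : Vectors (G2Rel q)} (hf : f ∈ webSpan q N n)
    (hi : i + 1 ≤ n) : op split i f ∈ webSpan q (N + 1) (n + 1) := by
  rw [op_split_eq_strip]
  exact strip_mem hf (by omega) (by omega) (by omega)

/-- The induction hypothesis on the number of vertices: below `K` vertices, webs span a space that
is closed under stacking a vertex or a cap. -/
def ClosedBelow (q : ℂ) (K : ℕ) : Prop :=
  (∀ {N n m i : ℕ} {f : Vectors (G2Rel q)}, N + 1 < K → f ∈ webSpan q N n → i + 2 ≤ n →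
    m + 1 = n → op vertex i f ∈ webSpan q (N + 1) m) ∧
  ∀ {N n m i : ℕ} {f : Vectors (G2Rel q)}, N < K → f ∈ webSpan q N n → i + 2 ≤ n →
    m + 2 = n → op cap i f ∈ webSpan q N m

theorem nestedCaps_mem {K N n m k i : ℕ} (hK : ClosedBelow q K) {f : Vectors (G2Rel q)}
    (hN : N < K) (hf : f ∈ webSpan q N n) (hi : i + 2 * k + 1 ≤ n) (hm : m + 2 * k = n) :
    nestedCaps i k f ∈ webSpan q N m := by
  induction k generalizing n f with
  | zero => obtain rfl : m = n := by omega
            exact hf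
  | succ k ih =>
    exact ih (n := n - 2) (hK.2 hN hf (by omega) (by omega)) (by omega) (by omega)

/-- Stacking the diagram `g` adds at most `v` vertices. -/
def AddsVertices (q : ℂ) (K v : ℕ) {e : ℕ} (g : Diagram 0 e) : Prop :=
  ∀ ⦃N n i : ℕ⦄ ⦃f : Vectors (G2Rel q)⦄, N + v < K → f ∈ webSpan q N n → i ≤ n →
    op g i f ∈ webSpan q (N + v) (n + e)

namespace AddsVertices
variable {K v e : ℕ}

theorem smul {g : Diagram 0 e} (hg : AddsVertices q K v g) (z : ℂ) :
    AddsVertices q K v (smul z g) := fun _ _ _ _ hN hf hi => by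
  rw [op_smul]; exact Submodule.smul_mem _ _ (hg hN hf hi)

theorem add {g h : Diagram 0 e} (hg : AddsVertices q K v g) (hh : AddsVertices q K v h) :
    AddsVertices q K v (add g h) := fun _ _ _ _ hN hf hi => by
  rw [op_add]; exact Submodule.add_mem _ (hg hN hf hi) (hh hN hf hi)

theorem rotate (hK : ClosedBelow q K) {g : Diagram 0 (e + 1)} (hg : AddsVertices q K v g) :
    AddsVertices q K v (rotate g) := fun _ _ _ _ hN hf hi => by
  rw [op_rotate]
  exact hK.2 hN (hg hN (cup_mem hf hi) (by omega)) (by omega) (by omega)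

theorem mono {w : ℕ} {g : Diagram 0 e} (hg : AddsVertices q K v g) (h : v ≤ w) :
    AddsVertices q K w g := fun _ _ _ _ hN hf hi => webSpan_mono (by omega) (hg (by omega) hf hi)

theorem split {l : ℕ} {g : Diagram 0 (1 + l)} (hg : AddsVertices q K v g) :
    AddsVertices q K (v + 1) (comp g (tensor split (one l))) := fun N n i f hN hf hi => by
  have h : op g i f ∈ webSpan q (N + v) (n + (1 + l)) := hg (by omega) hf hi
  rw [op_comp, op_tensor_one, (onStrands_of_mem h).op_one (by omega)]
  have := split_mem (i := i) h (by omega)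
  have e : n + (1 + l) + 1 = n + (2 + l) := by omega
  rwa [e] at this

theorem arc {l : ℕ} {g : Diagram 0 l} (hg : AddsVertices q K v g) :
    AddsVertices q K v (tensor g cup) := fun _ n i f hN hf hi => by
  rw [op_tensor]
  have h : op g i f ∈ webSpan q _ (n + l) := hg hN hf hi
  have h' := cup_mem (i := i + l) h (by omega)
  exact h'

theorem cup : AddsVertices q K 0 cup := fun _ _ _ _ _ hf hi => cup_mem hf hi

theorem tripod : AddsVertices q K 1 tripod := (cup.split (l := 1) :)
theorem tree4 : AddsVertices q K 2 tree4 := (tripod.split (l := 2) :)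
theorem tree5 : AddsVertices q K 3 tree5 := (tree4.split (l := 3) :)
theorem twoArcs : AddsVertices q K 0 twoArcs := cup.arc
theorem tripodArc : AddsVertices q K 1 tripodArc := tripod.arc

theorem rotationSum5 (hK : ClosedBelow q K) {g : Diagram 0 5} (hg : AddsVertices q K v g) :
    AddsVertices q K v (rotationSum5 g) :=
  hg.add ((hg.rotate hK).add (((hg.rotate hK).rotate hK).add
    ((((hg.rotate hK).rotate hK).rotate hK).add ((((hg.rotate hK).rotate hK).rotate hK).rotate hK))))

/-- The skein relations remove at least two vertices from a polygon with at most five sides. -/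
theorem polygon_mem (hK : ClosedBelow q K) {b : ℕ} (hb : b ≤ 3) {N n i : ℕ}
    {f : Vectors (G2Rel q)} (hN : N + b < K) (hf : f ∈ webSpan q N n) (hi : i ≤ n) :
    op (polygon (b + 2)) i f ∈ webSpan q (N + b) (n + (b + 2)) := by
  have key : ∀ {e w : ℕ} {g h : Diagram 0 e}, Cong (G2Rel q) g h → AddsVertices q K w h →
      AddsVertices q K w g := fun c hh _ _ _ _ hN hf hi => by rw [op_congr c]; exact hh hN hf hi
  interval_cases b
  · exact key (Cong.rel G2Rel.bigon) (cup.smul _) hN hf hi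
  · exact key (Cong.rel G2Rel.trigon) (tripod.smul _) hN hf hi
  · exact key (Cong.rel G2Rel.tetragon) (((tree4.add (tree4.rotate hK)).smul _).add
      (((twoArcs.add (twoArcs.rotate hK)).mono (by omega)).smul _)) hN hf hi
  · exact key (Cong.rel G2Rel.pentagon) (((tree5.rotationSum5 hK).smul _).add
      (((tripodArc.rotationSum5 hK).mono (by omega)).smul _)) hN hf hi

end AddsVertices

/-- A strip with at most four vertices that is closed off by a vertex. -/
theorem vertex_strip_mem {K N n m b i : ℕ} (hK : ClosedBelow q K) {f : Vectors (G2Rel q)}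
    (hf : f ∈ webSpan q N n) (hb : b ≤ 3) (hN : N + b < K) (hi : i + b + 1 ≤ n) (hm : m + b = n) :
    op vertex i (op (strip (b + 1)) i f) ∈ webSpan q (N + b) m := by
  rw [← nestedCaps_polygon]
  exact nestedCaps_mem hK hN (AddsVertices.polygon_mem hK hb hN hf (by omega)) (by omega) (by omega)

theorem strip_two_strip_mem {K N n m k i : ℕ} (hK : ClosedBelow q K) {f : Vectors (G2Rel q)}
    (hf : f ∈ webSpan q N n) (hk : k ≤ 3) (hN : N + k < K) (hi : i + k ≤ n) (hm : m + k = n + 2) :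
    op (strip 2) i (op (strip k) i f) ∈ webSpan q (N + k) m := by
  rw [op_strip_succ, op_strip_succ, op_strip_zero,
    ← op_comm_le cup (strip k) (i := i) (j := i + 2) (by omega) (by omega), op_vertex_strip]
  exact vertex_strip_mem hK (cup_mem hf (by omega)) hk hN (by omega) (by omega)

theorem strip_mem_of_lt {K N n m k i : ℕ} (hK : ClosedBelow q K) {f : Vectors (G2Rel q)}
    (hf : f ∈ webSpan q N n) (hN : N + k < K) (hi : i + k ≤ n) (hm : m + k = n + 2) :
    op (strip k) i f ∈ webSpan q (N + k) m := by
  induction k generalizing m with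
  | zero => exact strip_mem hf (by omega) hi hm
  | succ k ih =>
    rw [op_strip_succ]
    exact hK.1 (by omega) (ih (m := m + 1) (by omega) (by omega) (by omega)) (by omega) rfl

/-- A row of `r + 1` adjacent faces: `r + 3` legs down, `r + 2` legs up. -/
def ladder : ℕ → ℕ → (Vectors (G2Rel q) →ₗ[ℂ] Vectors (G2Rel q))
  | 0, i => op (strip 3) i
  | r + 1, i => ladder r (i + 1) ∘ₗ op (strip 2) i

theorem ladder_zero (i : ℕ) (f : Vectors (G2Rel q)) : ladder 0 i f = op (strip 3) i f := rfl

theorem ladder_succ (r i : ℕ) (f : Vectors (G2Rel q)) :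
    ladder (r + 1) i f = ladder r (i + 1) (op (strip 2) i f) := rfl

/-- A ladder may as well be grown from its right end. -/
theorem ladder_succ_right (r i : ℕ) (f : Vectors (G2Rel q)) :
    ladder (r + 1) i f = ladder r i (op (strip 2) (i + r + 2) f) := by
  induction r generalizing i f with
  | zero => exact (op_strip_strip_right 2 2 i f).symm
  | succ r ih =>
    rw [ladder_succ, ih, ladder_succ, op_comm_le (strip 2) (strip 2) (i := i)
      (j := i + 1 + r + 2) (j' := i + (r + 1) + 2) (by omega) (by omega)]

theorem ladder_comm_right {a b : ℕ} (g : Diagram a b) {r i j : ℕ} (h : i + r + 2 ≤ j)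
    (f : Vectors (G2Rel q)) : op g j (ladder r i f) = ladder r i (op g (j + 1) f) := by
  induction r generalizing i f with
  | zero => exact op_comm_le (strip 3) g (by omega) (by omega) f
  | succ r ih =>
    rw [ladder_succ, ladder_succ, ih (by omega), op_comm_le (strip 2) g (by omega) rfl]

theorem ladder_comm_left {a b : ℕ} (g : Diagram a b) {r i j j' : ℕ} (h : i + b ≤ j)
    (hj : j' + b = j + a) (f : Vectors (G2Rel q)) :
    ladder r j (op g i f) = op g i (ladder r j' f) := by
  induction r generalizing j j' f with
  | zero => exact op_comm_le g (strip 3) h hj f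
  | succ r ih =>
    rw [ladder_succ, ladder_succ, op_comm_le g (strip 2) h hj,
      ih (j' := j' + 1) (by omega) (by omega)]

theorem ladder_mem {K N n m r i : ℕ} (hK : ClosedBelow q K) {f : Vectors (G2Rel q)}
    (hf : f ∈ webSpan q N n) (hN : N + 2 * r + 3 < K) (hi : i + r + 3 ≤ n) (hm : m + 1 = n) :
    ladder r i f ∈ webSpan q (N + 2 * r + 3) m := by
  induction r generalizing N i f with
  | zero => exact strip_mem_of_lt hK hf (by omega) (by omega) (by omega)
  | succ r ih =>
    rw [ladder_succ]
    have := ih (i := i + 1) (N := N + 2) (f := op (strip 2) i f)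
      (strip_mem hf le_rfl (by omega) rfl) (by omega) (by omega)
    rwa [show N + 2 + 2 * r + 3 = N + 2 * (r + 1) + 3 by omega] at this

theorem ladder_strip_last_mem {N n m k r i : ℕ} {f : Vectors (G2Rel q)}
    (hf : f ∈ webSpan q N n) (hk : k ≤ 1) (hi : i + r + 2 + k ≤ n) (hm : m + k = n + 1) :
    ladder r i (op (strip k) (i + r + 2) f) ∈ webSpan q (N + k + 2 * r + 3) m := by
  induction r generalizing N i f with
  | zero =>
    rw [ladder_zero]
    refine (congrArg (· ∈ _) (op_strip_strip_right 2 k i f)).mpr ?_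
    exact webSpan_mono (by omega) (strip_mem (strip_mem (n := n) (m := n) (k := 2) hf le_rfl
      (by omega) (by omega)) (by omega) (by omega) (by omega))
  | succ r ih =>
    rw [ladder_succ, ← op_comm_le (strip 2) (strip k) (i := i) (j := i + (r + 1) + 2) (by omega) rfl]
    have := ih (i := i + 1) (N := N + 2) (f := op (strip 2) i f)
      (strip_mem hf le_rfl (by omega) rfl) (by omega)
    rwa [show N + 2 + k + 2 * r + 3 = N + k + 2 * (r + 1) + 3 by omega,
      show i + 1 + r + 2 = i + (r + 1) + 2 by omega] at this

theorem ladder_strip_before_mem {N n m k r i : ℕ} {f : Vectors (G2Rel q)}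
    (hf : f ∈ webSpan q N n) (hk : k ≤ 1) (hi : i + r + 2 + k ≤ n) (hm : m + k = n + 1) :
    ladder r (i + 1) (op (strip k) i f) ∈ webSpan q (N + k + 2 * r + 3) m := by
  induction r generalizing N f with
  | zero =>
    rw [ladder_zero, op_strip_strip_left 2 k i f]
    exact webSpan_mono (by omega) (strip_mem (strip_mem (n := n) (m := n) (k := 2) hf le_rfl
      (by omega) (by omega)) (by omega) (by omega) (by omega))
  | succ r ih =>
    rw [ladder_succ_right, op_comm_le (strip k) (strip 2) (i := i) (j := i + 1 + r + 2)
      (j' := i + r + 1 + k) (by omega) (by omega)]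
    have := ih (N := N + 2) (f := op (strip 2) (i + r + 1 + k) f)
      (strip_mem hf le_rfl (by omega) rfl) (by omega)
    rwa [show N + 2 + k + 2 * r + 3 = N + k + 2 * (r + 1) + 3 by omega] at this

theorem ladder_strip_first_mem {K N n m k r i : ℕ} (hK : ClosedBelow q K)
    {f : Vectors (G2Rel q)} (hf : f ∈ webSpan q N n) (hk : k ≤ 3) (hN : N + k + 2 * r + 1 < K)
    (hi : i + k ≤ n) (hi' : i + r + 3 + k ≤ n + 2) (hm : m + k = n + 1) :
    ladder r i (op (strip k) i f) ∈ webSpan q (N + k + 2 * r + 1) m := by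
  cases r with
  | zero =>
    rw [ladder_zero, op_strip_succ]
    exact hK.1 (by omega) (strip_two_strip_mem (m := m + 1) hK hf hk (by omega) hi (by omega))
      (by omega) rfl
  | succ r =>
    rw [ladder_succ]
    exact ladder_mem hK (strip_two_strip_mem (m := m + 1) hK hf hk (by omega) hi (by omega))
      (by omega) (by omega) rfl

/-- A ladder on top of both ends of a strip closes a face with at most five sides. -/
theorem ladder_strip_inside_mem {K N n m k r i j : ℕ} (hK : ClosedBelow q K)
    {f : Vectors (G2Rel q)} (hf : f ∈ webSpan q N n) (hk : k ≤ 2) (hN : N + k + 2 * r + 1 < K)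
    (hj : j + k ≤ n) (hij : i ≤ j) (hji : j ≤ i + r + 1) (hi : i + r + 3 + k ≤ n + 2)
    (hm : m + k = n + 1) :
    ladder r i (op (strip k) j f) ∈ webSpan q (N + k + 2 * r + 1) m := by
  induction r generalizing N i f with
  | zero =>
    obtain rfl | rfl : j = i ∨ j = i + 1 := by omega
    · exact ladder_strip_first_mem (r := 0) (k := k) (N := N) hK hf (by omega) hN hj hi hm
    · have h := strip_two_strip_mem (m := m + 1) (i := i + 1) hK hf (by omega) (by omega) hj
        (by omega)
      have h' := hK.1 (i := i) (m := m) (by omega) h (by omega) rfl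
      rwa [op_vertex_strip] at h'
  | succ r ih =>
    rcases hij.eq_or_lt with rfl | hij
    · exact ladder_strip_first_mem hK hf (by omega) hN hj hi hm
    rcases (show i + 1 ≤ j from hij).eq_or_lt with rfl | hij
    · rw [ladder_succ, op_strip_strip_right 1 k i f]
      have := ladder_strip_first_mem (m := m) (r := r) (i := i + 1) (k := k + 1) hK
        (strip_mem (k := 1) (i := i) (m := n + 1) hf (by omega) (by omega) (by omega)) (by omega)
        (by omega) (by omega) (by omega) (by omega)
      rwa [show N + 1 + (k + 1) + 2 * r + 1 = N + k + 2 * (r + 1) + 1 by omega] at this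
    · rw [ladder_succ, ← op_comm_le (strip 2) (strip k) (i := i) (j := j) (by omega) rfl]
      have := ih (i := i + 1) (N := N + 2) (f := op (strip 2) i f)
        (strip_mem hf le_rfl (by omega) rfl) (by omega) (by omega) (by omega) (by omega)
      rwa [show N + 2 + k + 2 * r + 1 = N + k + 2 * (r + 1) + 1 by omega] at this

/-- A ladder on top of a web can be pushed down, growing at its ends, until it closes a small face
or can be replaced by strips with at most two vertices.  It cannot be pushed all the way down, since
it needs at least three strands. -/
theorem Web.ladder_mem {K N n : ℕ} (hK : ClosedBelow q K) {f : Vectors (G2Rel q)}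
    (hf : Web N n f) : ∀ {m r i : ℕ}, N + 2 * r + 3 ≤ K → i + r + 3 ≤ n → m + 1 = n →
    ladder r i f ∈ webSpan q (N + 2 * r + 3) m := by
  induction hf with
  | nil => intros; omega
  | @cons N n n' k j f hf hk hj hn' ih =>
    intro m r i hN hi hm
    rcases le_or_gt (i + r + 3) j with h | h
    · obtain ⟨j, rfl⟩ : ∃ j', j = j' + 1 := ⟨j - 1, by omega⟩
      rw [← ladder_comm_right (strip k) (by omega)]
      exact webSpan_mono (by omega) (strip_mem (ih (m := n - 1) (r := r) (i := i) (by omega)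
        (by omega) (by omega)) hk (by omega) (by omega))
    rcases (show j ≤ i + r + 2 by omega).eq_or_lt with rfl | h
    · rcases hk.eq_or_lt with rfl | hk
      · rw [← ladder_succ_right]
        exact webSpan_mono (by omega) (ih (by omega) (by omega) (by omega))
      · exact ladder_strip_last_mem (hf.mem le_rfl) (by omega) (by omega) (by omega)
    rcases le_or_gt i j with h' | h'
    · exact webSpan_mono (by omega) (ladder_strip_inside_mem hK (hf.mem le_rfl) hk (by omega) hj h'
        (by omega) (by omega) (by omega))
    rcases (show j + 1 ≤ i by omega).eq_or_lt with rfl | h'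
    · rcases hk.eq_or_lt with rfl | hk
      · rw [← ladder_succ]
        exact webSpan_mono (by omega) (ih (by omega) (by omega) (by omega))
      · exact ladder_strip_before_mem (hf.mem le_rfl) (by omega) (by omega) (by omega)
    · rw [ladder_comm_left (strip k) (j' := i + k - 2) (by omega) (by omega)]
      exact webSpan_mono (by omega) (strip_mem (ih (m := n - 1) (r := r) (i := i + k - 2) (by omega)
        (by omega) (by omega)) hk (by omega) (by omega))

/-- The inductive step for a vertex: it commutes with the last strip, extends it by a leg, or closes
it off to a face with at most three sides. -/
theorem Web.vertex_mem {K N n : ℕ} (hK : ClosedBelow q K) {f : Vectors (G2Rel q)}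
    (hf : Web N n f) : ∀ {m i : ℕ}, N + 1 ≤ K → i + 2 ≤ n → m + 1 = n →
    op vertex i f ∈ webSpan q (N + 1) m := by
  induction hf with
  | nil => intros; omega
  | @cons N n n' k j f hf hk hj hn' ih =>
    intro m i hN hi hm
    have hladder : ∀ i, k = 2 → i + 3 ≤ n → op (strip (k + 1)) i f ∈ webSpan q (N + k + 1) m := by
      rintro i rfl hi
      exact hf.ladder_mem hK (r := 0) (by omega) (by omega) (by omega)
    have hstrip : ∀ i, i + k + 1 ≤ n → op (strip (k + 1)) i f ∈ webSpan q (N + k + 1) m := by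
      intro i hi
      rcases hk.eq_or_lt with rfl | hk
      · exact hladder i rfl (by omega)
      · exact webSpan_mono (by omega) (strip_mem (hf.mem le_rfl) (by omega) (by omega) (by omega))
    rcases le_or_gt (i + 2) j with h | h
    · obtain ⟨j, rfl⟩ : ∃ j', j = j' + 1 := ⟨j - 1, by omega⟩
      rw [← op_comm_le vertex (strip k) (i := i) (j := j) (by omega) (by omega)]
      exact webSpan_mono (by omega) (strip_mem (ih (m := n - 1) (i := i) (by omega)
        (by omega) (by omega)) hk (by omega) (by omega))
    rcases (show j ≤ i + 1 by omega).eq_or_lt with rfl | h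
    · rw [op_vertex_strip]
      exact hstrip i (by omega)
    rcases (show j ≤ i by omega).eq_or_lt with rfl | h
    · cases k with
      | zero =>
        rw [op_vertex_strip_zero]
        exact Submodule.zero_mem _
      | succ k =>
        exact webSpan_mono (by omega) (vertex_strip_mem (b := k) hK (hf.mem le_rfl) (by omega)
          (by omega) (by omega) (by omega))
    rcases (show j + 1 ≤ i by omega).eq_or_lt with rfl | h
    · rw [← op_strip_succ]
      exact hstrip j (by omega)
    · rw [op_comm_le (strip k) vertex (i := j) (j' := i + k - 2) (by omega) (by omega)]
      exact webSpan_mono (by omega) (strip_mem (ih (m := n - 1) (i := i + k - 2) (by omega)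
        (by omega) (by omega)) hk (by omega) (by omega))

/-- The inductive step for a cap: it commutes with the last strip, bends one of its ends down, or
closes it off. -/
theorem Web.cap_mem {K N n : ℕ} (hK : ClosedBelow q K)
    (hv : ∀ {N n m i : ℕ} {f : Vectors (G2Rel q)}, N + 1 ≤ K → f ∈ webSpan q N n → i + 2 ≤ n →
      m + 1 = n → op vertex i f ∈ webSpan q (N + 1) m) {f : Vectors (G2Rel q)}
    (hf : Web N n f) : ∀ {m i : ℕ}, N ≤ K → i + 2 ≤ n → m + 2 = n →
    op cap i f ∈ webSpan q N m := by
  induction hf with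
  | nil => intros; omega
  | @cons N n n' k j f hf hk hj hn' ih =>
    intro m i hN hi hm
    rcases le_or_gt (i + 2) j with h | h
    · obtain ⟨j, rfl⟩ : ∃ j', j = j' + 2 := ⟨j - 2, by omega⟩
      rw [← op_comm_le cap (strip k) (i := i) (j := j) (by omega) (by omega)]
      exact strip_mem (ih (m := n - 2) (i := i) (by omega) (by omega) (by omega)) hk (by omega)
        (by omega)
    rcases (show j ≤ i + 1 by omega).eq_or_lt with rfl | h
    · interval_cases k
      · rw [op_strip_zero, op_cap_cup_left, hf.onStrands.op_one (by omega)]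
        obtain rfl : n = m := by omega
        exact hf.mem le_rfl
      · rw [← op_split_eq_strip, op_cap_split_left]
        exact hv (by omega) (hf.mem le_rfl) (by omega) (by omega)
      · rw [← op_vertex_strip, op_cap_vertex, ← op_comm_le vertex (strip 1) (i := i) (j := i + 1)
          (by omega) (by omega), ← op_split_eq_strip, op_cap_split_left]
        exact hv (by omega) (hv (m := m + 1) (by omega) (hf.mem le_rfl) (by omega) (by omega))
          (by omega) rfl
    rcases (show j ≤ i by omega).eq_or_lt with rfl | h
    · interval_cases k
      · have h := op_polygon 0 j f
        rw [op_congr (Cong.rel G2Rel.loop), op_smul, hf.onStrands.op_one (by omega)] at h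
        refine (congrArg (· ∈ _) h).mp (Submodule.smul_mem _ _ ?_)
        obtain rfl : n = m := by omega
        exact hf.mem le_rfl
      · rw [op_strip_succ, op_cap_vertex, op_vertex_strip_zero, map_zero]
        exact Submodule.zero_mem _
      · rw [op_strip_succ, op_cap_vertex, op_vertex_strip_one, hf.onStrands.op_one (by omega),
          map_smul]
        exact Submodule.smul_mem _ _ (webSpan_mono (by omega)
          (hK.2 (by omega) (hf.mem le_rfl) (by omega) (by omega)))
    rcases (show j + 1 ≤ i by omega).eq_or_lt with rfl | h
    · interval_cases k
      · rw [op_strip_zero, op_cap_cup_right, hf.onStrands.op_one (by omega)]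
        obtain rfl : n = m := by omega
        exact hf.mem le_rfl
      · rw [← op_split_eq_strip, op_cap_split_right]
        exact hv (by omega) (hf.mem le_rfl) (by omega) (by omega)
      · rw [op_strip_succ, ← op_cap_vertex, op_comm_le (strip 1) vertex (i := j) (j := j + 1 + 1)
          (j' := j + 1) (by omega) (by omega), ← op_split_eq_strip, op_cap_split_right]
        exact hv (by omega) (hv (m := m + 1) (by omega) (hf.mem le_rfl) (by omega) (by omega))
          (by omega) rfl
    · rw [op_comm_le (strip k) cap (i := j) (j' := i + k - 2) (by omega) (by omega)]
      exact strip_mem (ih (m := n - 2) (i := i + k - 2) (by omega)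
        (by omega) (by omega)) hk (by omega) (by omega)

/-- Stacking a vertex or a cap on a web gives a combination of webs with no more vertices than the
resulting diagram. -/
theorem closedBelow (q : ℂ) (K : ℕ) : ClosedBelow q K := by
  induction K with
  | zero => exact ⟨fun h => absurd h (by omega), fun h => absurd h (by omega)⟩
  | succ K ih =>
    have hv : ∀ {N n m i : ℕ} {f : Vectors (G2Rel q)}, N + 1 ≤ K → f ∈ webSpan q N n →
        i + 2 ≤ n → m + 1 = n → op vertex i f ∈ webSpan q (N + 1) m :=
      fun hN hf hi hm => map_mem_of_web _ _ (fun _ hN' _ hf =>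
        webSpan_mono (by omega) (hf.vertex_mem ih (by omega) hi hm)) hf
    exact ⟨fun hN hf hi hm => hv (by omega) hf hi hm, fun hN hf hi hm =>
      map_mem_of_web _ _ (fun _ hN' _ hf =>
        webSpan_mono (by omega) (hf.cap_mem ih hv (by omega) hi hm)) hf⟩

/-- Every diagram preserves the span of the webs. -/
theorem op_mem {a b : ℕ} (g : Diagram a b) : ∀ {N n m i : ℕ} {f : Vectors (G2Rel q)},
    f ∈ webSpan q N n → i + a ≤ n → m + a = n + b → ∃ N', op g i f ∈ webSpan q N' m := by
  induction g with
  | wires h =>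
    intro N n m i f hf hi hm
    subst h
    obtain rfl : m = n := by omega
    exact ⟨N, by rwa [(onStrands_of_mem hf).op_one hi]⟩
  | cap => exact fun {N n m i f} hf hi hm =>
      ⟨N, (closedBelow q (N + 1)).2 (by omega) hf hi hm⟩
  | cup =>
    intro N n m i f hf hi hm
    obtain rfl : m = n + 2 := hm
    exact ⟨N, cup_mem hf hi⟩
  | vertex => exact fun {N n m i f} hf hi hm =>
      ⟨N + 1, (closedBelow q (N + 2)).1 (by omega) hf hi (by omega)⟩
  | @comp a b c g h ihg ihh =>
    intro N n m i f hf hi hm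
    obtain ⟨N₁, h₁⟩ := ihg (m := n - a + b) hf hi (by omega)
    obtain ⟨N₂, h₂⟩ := ihh (m := m) h₁ (i := i) (by omega) (by omega)
    exact ⟨N₂, by rwa [op_comp]⟩
  | @tensor a b c d g h ihg ihh =>
    intro N n m i f hf hi hm
    obtain ⟨N₁, h₁⟩ := ihg (m := n - a + b) (i := i) hf (by omega) (by omega)
    obtain ⟨N₂, h₂⟩ := ihh (m := m) h₁ (i := i + b) (by omega) (by omega)
    exact ⟨N₂, by rwa [op_tensor]⟩
  | zero => exact fun {N n m i f} hf hi hm => ⟨0, by rw [op_zero]; exact Submodule.zero_mem _⟩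
  | add g h ihg ihh =>
    intro N n m i f hf hi hm
    obtain ⟨N₁, h₁⟩ := ihg hf hi hm
    obtain ⟨N₂, h₂⟩ := ihh hf hi hm
    exact ⟨max N₁ N₂, by
      rw [op_add]
      exact Submodule.add_mem _ (webSpan_mono (le_max_left _ _) h₁)
        (webSpan_mono (le_max_right _ _) h₂)⟩
  | smul z g ih =>
    intro N n m i f hf hi hm
    obtain ⟨N', h⟩ := ih hf hi hm
    exact ⟨N', by rw [op_smul]; exact Submodule.smul_mem _ _ h⟩

/-- The skein relations evaluate every closed diagram to a multiple of the empty diagram. -/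
theorem exists_cong_smul_one (g : Diagram 0 0) : ∃ z : ℂ, Cong (G2Rel q) g (smul z (one 0)) := by
  obtain ⟨N, h⟩ := op_mem (q := q) g (N := 0) (n := 0) (m := 0) (i := 0) (Web.nil.mem le_rfl)
    le_rfl rfl
  have hle : webSpan q N 0 ≤ Submodule.span ℂ {emptyWeb} := by
    refine Submodule.span_le.2 ?_
    rintro f ⟨N', -, hf⟩
    rw [hf.eq_emptyWeb rfl]
    exact Submodule.mem_span_singleton_self _
  obtain ⟨z, hz⟩ := Submodule.mem_span_singleton.1 (hle h)
  refine ⟨z, ?_⟩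
  have h₀ := congrFun hz 0
  rw [op_apply g 0 0 emptyWeb rfl] at h₀
  have h₁ : (ofDiagram (layer 0 g 0) : (⟨0⟩ : G2Cat q) ⟶ ⟨0⟩) = ofDiagram g := by
    have e₁ := sound (R := G2Rel q) (Cong.tensor_one_zero (tensor (one 0) g))
    have e₂ := sound (R := G2Rel q) (Cong.one_zero_tensor g)
    have e₃ := sound (R := G2Rel q) (Cong.comp_one (layer 0 g 0))
    have e₄ := sound (R := G2Rel q) (Cong.one_comp (tensor (one 0) g))
    have e₅ := sound (R := G2Rel q) (Cong.comp_one (tensor (one 0) g))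
    have e₆ := sound (R := G2Rel q) (Cong.one_comp g)
    exact e₃.symm.trans (e₁.trans (e₄.trans (e₅.symm.trans (e₂.trans e₆))))
  have h₂ : (emptyWeb : Vectors (G2Rel q)) 0 = 𝟙 _ := rfl
  have h₃ : (ofDiagram g : (⟨0⟩ : G2Cat q) ⟶ ⟨0⟩) = z • 𝟙 _ := by
    rw [← h₁, ← h₂]
    refine Eq.trans ?_ h₀.symm
    change _ = 𝟙 _ ≫ ofDiagram (layer 0 g 0) ≫ 𝟙 _
    rw [Category.id_comp, Category.comp_id]
  exact Quotient.exact h₃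

end SkeinCat

/-! ### Interpretations of diagrams in a graph planar algebra -/

namespace GPA
open LoopGraph Diagram

variable {V : Type} {Γ : LoopGraph V}

theorem tensorMap_add {a b c d : ℕ} (f : Γ.HomSpace a b) (g g' : Γ.HomSpace c d) :
    tensorMap f (g + g') = tensorMap f g + tensorMap f g' := hom_ext fun _ _ => mul_add _ _ _

theorem add_tensorMap {a b c d : ℕ} (f f' : Γ.HomSpace a b) (g : Γ.HomSpace c d) :
    tensorMap (f + f') g = tensorMap f g + tensorMap f' g := hom_ext fun _ _ => add_mul _ _ _

theorem tensorMap_smul {a b c d : ℕ} (z : ℂ) (f : Γ.HomSpace a b) (g : Γ.HomSpace c d) :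
    tensorMap f (z • g) = z • tensorMap f g := hom_ext fun _ _ => mul_left_comm _ _ _

theorem smul_tensorMap {a b c d : ℕ} (z : ℂ) (f : Γ.HomSpace a b) (g : Γ.HomSpace c d) :
    tensorMap (z • f) g = z • tensorMap f g := hom_ext fun _ _ => mul_assoc _ _ _

theorem zero_tensorMap {a b c d : ℕ} (g : Γ.HomSpace c d) :
    tensorMap (0 : Γ.HomSpace a b) g = 0 := hom_ext fun _ _ => zero_mul _

variable [Finite V]

theorem zero_compMap {a b c : ℕ} (g : Γ.HomSpace b c) : compMap (0 : Γ.HomSpace a b) g = 0 :=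
  hom_ext fun _ _ => Finset.sum_eq_zero fun _ _ => zero_mul _

theorem compMap_zero {a b c : ℕ} (f : Γ.HomSpace a b) : compMap f (0 : Γ.HomSpace b c) = 0 :=
  hom_ext fun _ _ => Finset.sum_eq_zero fun _ _ => mul_zero _

/-- Interpretation of diagrams in a graph planar algebra, given the images of the cap, the cup and
the trivalent vertex. -/
noncomputable def realize (e : Γ.HomSpace 2 0) (c : Γ.HomSpace 0 2) (t : Γ.HomSpace 2 1) :
    {m n : ℕ} → Diagram m n → Γ.HomSpace m n
  | _, _, .wires h => castMap h
  | _, _, .cap => e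
  | _, _, .cup => c
  | _, _, .vertex => t
  | _, _, .comp f g => compMap (realize e c t f) (realize e c t g)
  | _, _, .tensor f g => tensorMap (realize e c t f) (realize e c t g)
  | _, _, .zero => 0
  | _, _, .add f g => realize e c t f + realize e c t g
  | _, _, .smul z f => z • realize e c t f

section

variable {R : (m n : ℕ) → Diagram m n → Diagram m n → Prop}
  {e : Γ.HomSpace 2 0} {c : Γ.HomSpace 0 2} {t : Γ.HomSpace 2 1}

/-- An interpretation that satisfies the zigzag identities and the relations `R` factors through the
category presented by `R`. -/
theorem realize_eq_of_cong
    (hl : @compMap V Γ _ 1 3 1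
      (@tensorMap V Γ 0 2 1 1 c (castMap rfl)) (@tensorMap V Γ 1 1 2 0 (castMap rfl) e) =
        castMap rfl)
    (hr : @compMap V Γ _ 1 3 1
      (@tensorMap V Γ 1 1 0 2 (castMap rfl) c) (@tensorMap V Γ 2 0 1 1 e (castMap rfl)) =
        castMap rfl)
    (hR : ∀ {m n : ℕ} {f g : Diagram m n}, R m n f g → realize e c t f = realize e c t g)
    {m n : ℕ} {f g : Diagram m n} (h : Cong R f g) : realize e c t f = realize e c t g := by
  induction h with
  | rel h => exact hR h
  | refl f => rfl
  | symm h ih => exact ih.symm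
  | trans h₁ h₂ ih₁ ih₂ => exact ih₁.trans ih₂
  | comp_congr h₁ h₂ ih₁ ih₂ => exact congrArg₂ compMap ih₁ ih₂
  | tensor_congr h₁ h₂ ih₁ ih₂ => exact congrArg₂ tensorMap ih₁ ih₂
  | add_congr h₁ h₂ ih₁ ih₂ => exact congrArg₂ (· + ·) ih₁ ih₂
  | smul_congr z h ih => exact congrArg (z • ·) ih
  | one_comp f => exact id_comp' _
  | comp_one f => exact comp_id' _
  | @comp_assoc a b c' d f g h =>
    exact Category.assoc (obj := GPA Γ) (W := ⟨a⟩) (X := ⟨b⟩) (Y := ⟨c'⟩) (Z := ⟨d⟩)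
      (realize e c t f) (realize e c t g) (realize e c t h)
  | one_tensor_one a b => exact tensorMap_id
  | interchange f g f' g' => exact (GPA.interchange _ _ _ _).symm
  | @tensor_assoc a b a' b' a'' b'' f g h =>
    exact MonoidalCategory.associator_naturality (C := GPA Γ) (X₁ := ⟨a⟩) (X₂ := ⟨a'⟩)
      (X₃ := ⟨a''⟩) (Y₁ := ⟨b⟩) (Y₂ := ⟨b'⟩) (Y₃ := ⟨b''⟩) (realize e c t f) (realize e c t g)
      (realize e c t h)
  | @one_zero_tensor a b f =>
    exact MonoidalCategory.leftUnitor_naturality (C := GPA Γ) (X := ⟨a⟩) (Y := ⟨b⟩)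
      (realize e c t f)
  | @tensor_one_zero a b f =>
    exact MonoidalCategory.rightUnitor_naturality (C := GPA Γ) (X := ⟨a⟩) (Y := ⟨b⟩)
      (realize e c t f)
  | add_assoc f g h => exact add_assoc _ _ _
  | add_comm f g => exact add_comm _ _
  | zero_add f => exact zero_add _
  | one_smul f => exact one_smul ℂ _
  | zero_smul f => exact zero_smul ℂ _
  | mul_smul y z f => exact mul_smul y z _
  | add_smul y z f => exact add_smul y z _
  | smul_add z f g => exact smul_add z _ _
  | @add_comp a b c' f f' g =>
    exact Preadditive.add_comp (C := GPA Γ) ⟨a⟩ ⟨b⟩ ⟨c'⟩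
      (realize e c t f) (realize e c t f') (realize e c t g)
  | @comp_add a b c' f g g' =>
    exact Preadditive.comp_add (C := GPA Γ) ⟨a⟩ ⟨b⟩ ⟨c'⟩
      (realize e c t f) (realize e c t g) (realize e c t g')
  | @smul_comp a b c' z f g =>
    exact Linear.smul_comp (C := GPA Γ) ⟨a⟩ ⟨b⟩ ⟨c'⟩ z
      (realize e c t f) (realize e c t g)
  | @comp_smul a b c' z f g =>
    exact Linear.comp_smul (C := GPA Γ) ⟨a⟩ ⟨b⟩ ⟨c'⟩
      (realize e c t f) z (realize e c t g)
  | add_tensor f f' g => exact add_tensorMap _ _ _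
  | tensor_add f g g' => exact tensorMap_add _ _ _
  | smul_tensor z f g => exact smul_tensorMap _ _ _
  | tensor_smul z f g => exact tensorMap_smul _ _ _
  | zigzag_left => exact hl
  | zigzag_right => exact hr

variable (h : ∀ {m n : ℕ} {f g : Diagram m n}, Cong R f g → realize e c t f = realize e c t g)

/-- The functor given by an interpretation that respects the congruence generated by `R`. -/
noncomputable def realizeFunctor : SkeinCat R ⥤ GPA Γ where
  obj X := ⟨X.strands⟩
  map f := Quotient.lift (realize e c t) (fun _ _ hfg => h hfg) f
  map_id _ := rfl
  map_comp f g := Quotient.inductionOn₂ f g fun _ _ => rfl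

/-- The monoidal structure of `realizeFunctor`, all of whose structure maps are identities. -/
noncomputable def realizeFunctorCore : (realizeFunctor h).CoreMonoidal where
  εIso := Iso.refl _
  μIso _ _ := Iso.refl _
  μIso_hom_natural_left f _ := Quotient.inductionOn f fun _ =>
    (Category.comp_id _).trans (Category.id_comp _).symm
  μIso_hom_natural_right _ f := Quotient.inductionOn f fun _ =>
    (Category.comp_id _).trans (Category.id_comp _).symm
  associativity _ _ _ :=
    ((congrArg₂ compMap tensorMap_id (id_comp' _)).trans (id_comp' _)).trans
      ((congrArg (compMap _) ((congrArg₂ compMap tensorMap_id rfl).trans (id_comp' _))).trans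
        (comp_id' _)).symm
  left_unitality _ :=
    ((congrArg₂ compMap tensorMap_id (id_comp' _)).trans (id_comp' _)).symm
  right_unitality _ :=
    ((congrArg₂ compMap tensorMap_id (id_comp' _)).trans (id_comp' _)).symm

noncomputable instance : (realizeFunctor h).Monoidal := (realizeFunctorCore h).toMonoidal

theorem realizeFunctor_isStrict : IsStrict (realizeFunctor h) where
  obj_eq _ := rfl
  ε_eq := rfl
  μ_eq _ _ := rfl

instance : (realizeFunctor h).Additive where
  map_add {_ _ f g} := Quotient.inductionOn₂ f g fun _ _ => rfl

instance : (realizeFunctor h).Linear ℂ where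
  map_smul f _ := Quotient.inductionOn f fun _ => rfl

theorem realizeFunctor_image {m n : ℕ} (f : Diagram m n) :
    (realizeFunctor_isStrict h).image f = realize e c t f :=
  (Category.id_comp _).trans (Category.comp_id _)

end

end GPA

/-! ### Coefficients on sequences of vertices -/

namespace LoopGraph

variable {V : Type} {Γ : LoopGraph V}

variable (Γ) in
/-- The first `n + 1` terms of a sequence of vertices form a path. -/
def IsWalk (s : ℕ → V) (n : ℕ) : Prop := ∀ i < n, Γ.Adj (s i) (s (i + 1))

/-- The path formed by the first `n + 1` terms of a sequence. -/
def IsWalk.path {s : ℕ → V} {n : ℕ} (h : Γ.IsWalk s n) : Γ.EdgePath n :=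
  ⟨fun i => s i, fun i => h i i.2⟩

theorem IsWalk.congr {s t : ℕ → V} {n : ℕ} (h : Γ.IsWalk s n) (e : ∀ i ≤ n, s i = t i) :
    Γ.IsWalk t n := fun i hi => by
  rw [← e i hi.le, ← e (i + 1) hi]; exact h i hi

theorem isWalk_add {s : ℕ → V} {m n : ℕ} :
    Γ.IsWalk s (m + n) ↔ Γ.IsWalk s m ∧ Γ.IsWalk (fun i => s (m + i)) n := by
  refine ⟨fun h => ⟨fun i hi => h i (by omega), fun i hi => h (m + i) (by omega)⟩, fun h i hi => ?_⟩
  rcases lt_or_ge i m with h' | h'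
  · exact h.1 i h'
  · obtain ⟨j, rfl⟩ := Nat.exists_eq_add_of_le h'
    exact h.2 j (by omega)

/-- A path as a sequence of vertices that is constant from its target on. -/
def EdgePath.seq {n : ℕ} (p : Γ.EdgePath n) : ℕ → V := fun i => p.1 ⟨min i n, by omega⟩

theorem EdgePath.seq_apply {n : ℕ} (p : Γ.EdgePath n) (i : Fin (n + 1)) : p.seq i = p.1 i :=
  congrArg p.1 (Fin.ext (min_eq_left (by omega)))

theorem EdgePath.isWalk_seq {n : ℕ} (p : Γ.EdgePath n) : Γ.IsWalk p.seq n := fun i hi => by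
  have h := p.2 ⟨i, hi⟩
  rwa [← p.seq_apply, ← p.seq_apply] at h

theorem EdgePath.path_seq {n : ℕ} (p : Γ.EdgePath n) : p.isWalk_seq.path = p :=
  EdgePath.ext fun i => p.seq_apply i

end LoopGraph

namespace GPA
open LoopGraph

variable {V : Type} {Γ : LoopGraph V}

open scoped Classical in
/-- The coefficient of a morphism on the paths formed by the beginnings of two sequences, with value
zero if these are not paths. -/
noncomputable def entry {a b : ℕ} (f : Γ.HomSpace a b) (q r : ℕ → V) : ℂ :=
  if h : Γ.IsWalk q a ∧ Γ.IsWalk r b then f.1 h.1.path h.2.path else 0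

section
variable {a b c d : ℕ}

theorem entry_of_isWalk (f : Γ.HomSpace a b) {q r : ℕ → V} (hq : Γ.IsWalk q a)
    (hr : Γ.IsWalk r b) : entry f q r = f.1 hq.path hr.path := dif_pos ⟨hq, hr⟩

theorem entry_seq (f : Γ.HomSpace a b) (p : Γ.EdgePath a) (q : Γ.EdgePath b) :
    entry f p.seq q.seq = f.1 p q := by
  rw [entry_of_isWalk f p.isWalk_seq q.isWalk_seq, p.path_seq, q.path_seq]

theorem isWalk_of_entry_ne_zero {f : Γ.HomSpace a b} {q r : ℕ → V} (h : entry f q r ≠ 0) :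
    Γ.IsWalk q a ∧ Γ.IsWalk r b := by
  by_contra h'
  exact h (dif_neg h')

theorem parallel_of_entry_ne_zero {f : Γ.HomSpace a b} {q r : ℕ → V} (h : entry f q r ≠ 0) :
    q 0 = r 0 ∧ q a = r b := by
  obtain ⟨hq, hr⟩ := isWalk_of_entry_ne_zero h
  rw [entry_of_isWalk f hq hr] at h
  by_contra h'
  exact h (f.2 _ _ h')

theorem entry_congr (f : Γ.HomSpace a b) {q q' r r' : ℕ → V} (hq : ∀ i ≤ a, q i = q' i)
    (hr : ∀ i ≤ b, r i = r' i) : entry f q r = entry f q' r' := by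
  by_cases h : Γ.IsWalk q a ∧ Γ.IsWalk r b
  · rw [entry_of_isWalk f h.1 h.2, entry_of_isWalk f (h.1.congr hq) (h.2.congr hr)]
    exact congrArg₂ f.1 (EdgePath.ext fun i => hq i.1 (by omega))
      (EdgePath.ext fun i => hr i.1 (by omega))
  · rw [entry, dif_neg h, entry, dif_neg]
    exact fun h' => h ⟨h'.1.congr fun i hi => (hq i hi).symm, h'.2.congr fun i hi => (hr i hi).symm⟩

theorem ext_entry {f g : Γ.HomSpace a b} (h : ∀ q r, Γ.IsWalk q a → Γ.IsWalk r b → q 0 = r 0 →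
    q a = r b → entry f q r = entry g q r) : f = g := by
  refine hom_ext fun p q => ?_
  by_cases hpq : p.Parallel q
  · rw [← entry_seq, ← entry_seq]
    refine h _ _ p.isWalk_seq q.isWalk_seq hpq.1 ?_
    have h₁ := p.seq_apply (Fin.last a)
    have h₂ := q.seq_apply (Fin.last b)
    simp only [Fin.val_last] at h₁ h₂
    rw [h₁, h₂]
    exact hpq.2
  · rw [f.2 _ _ hpq, g.2 _ _ hpq]

theorem entry_tensorMap (f : Γ.HomSpace a b) (g : Γ.HomSpace c d) (q r : ℕ → V) :
    entry (tensorMap f g) q r =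
      entry f q r * entry g (fun i => q (a + i)) (fun i => r (b + i)) := by
  by_cases h : Γ.IsWalk q (a + c) ∧ Γ.IsWalk r (b + d)
  · rw [entry_of_isWalk _ h.1 h.2, entry_of_isWalk _ (isWalk_add.1 h.1).1 (isWalk_add.1 h.2).1,
      entry_of_isWalk _ (isWalk_add.1 h.1).2 (isWalk_add.1 h.2).2]
    rfl
  · rw [entry, dif_neg h]
    by_contra h'
    obtain ⟨h₁, h₂⟩ := mul_ne_zero_iff.1 (Ne.symm h')
    exact h ⟨isWalk_add.2 ⟨(isWalk_of_entry_ne_zero h₁).1, (isWalk_of_entry_ne_zero h₂).1⟩,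
      isWalk_add.2 ⟨(isWalk_of_entry_ne_zero h₁).2, (isWalk_of_entry_ne_zero h₂).2⟩⟩

theorem entry_tensorMap_of {f : Γ.HomSpace a b} {g : Γ.HomSpace c d} {q r : ℕ → V} {x y : ℂ}
    (hf : entry f q r = x) (hg : entry g (fun i => q (a + i)) (fun i => r (b + i)) = y) :
    entry (tensorMap f g) q r = x * y := by
  rw [entry_tensorMap, hf, hg]

theorem ne_zero_of_entry_tensorMap_ne_zero {f : Γ.HomSpace a b} {g : Γ.HomSpace c d} {q r : ℕ → V}
    (h : entry (tensorMap f g) q r ≠ 0) :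
    entry f q r ≠ 0 ∧ entry g (fun i => q (a + i)) (fun i => r (b + i)) ≠ 0 := by
  rwa [entry_tensorMap, mul_ne_zero_iff] at h

theorem entry_castMap_self (h : a = b) {q r : ℕ → V} (hq : Γ.IsWalk q a)
    (hqr : ∀ i ≤ a, q i = r i) : entry (castMap h : Γ.HomSpace a b) q r = 1 := by
  subst h
  rw [entry_of_isWalk _ hq (hq.congr hqr)]
  exact if_pos (EdgePath.ext fun i => hqr i (by omega))

theorem eq_of_entry_castMap_ne_zero (h : a = b) {q r : ℕ → V}
    (hne : entry (castMap h : Γ.HomSpace a b) q r ≠ 0) : ∀ i ≤ a, q i = r i := by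
  subst h
  obtain ⟨hq, hr⟩ := isWalk_of_entry_ne_zero hne
  rw [entry_of_isWalk _ hq hr] at hne
  intro i hi
  have h' : hq.path.cast rfl = hr.path := by
    by_contra h'
    exact hne (if_neg h')
  exact congrArg (fun p : Γ.EdgePath a => p.1 ⟨i, by omega⟩) h'

theorem entry_add (f g : Γ.HomSpace a b) (q r : ℕ → V) :
    entry (f + g) q r = entry f q r + entry g q r := by
  by_cases h : Γ.IsWalk q a ∧ Γ.IsWalk r b
  · simp only [entry_of_isWalk _ h.1 h.2]; rfl
  · simp only [entry, dif_neg h, add_zero]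

theorem entry_smul (z : ℂ) (f : Γ.HomSpace a b) (q r : ℕ → V) :
    entry (z • f) q r = z * entry f q r := by
  by_cases h : Γ.IsWalk q a ∧ Γ.IsWalk r b
  · simp only [entry_of_isWalk _ h.1 h.2]; rfl
  · simp only [entry, dif_neg h, mul_zero]

theorem entry_zero (q r : ℕ → V) : entry (0 : Γ.HomSpace a b) q r = 0 := by
  by_contra h
  obtain ⟨hq, hr⟩ := isWalk_of_entry_ne_zero h
  exact h (entry_of_isWalk _ hq hr)

variable [Finite V]

theorem compMap_assoc (f : Γ.HomSpace a b) (g : Γ.HomSpace b c) (h : Γ.HomSpace c d) :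
    compMap (compMap f g) h = compMap f (compMap g h) :=
  Category.assoc (obj := GPA Γ) (W := ⟨a⟩) (X := ⟨b⟩) (Y := ⟨c⟩) (Z := ⟨d⟩) f g h

theorem entry_compMap_castMap (f : Γ.HomSpace a b) (h : b = c) (q r : ℕ → V) :
    entry (compMap f (castMap h)) q r = entry f q r := by
  subst h; rw [comp_id']

/-- The sum over the intermediate paths of a composite may be taken over any family of sequences
that represents, once each, all paths with a nonzero contribution. -/
theorem entry_compMap {ι : Type} [Fintype ι] (w : ι → ℕ → V) (f : Γ.HomSpace a b)
    (g : Γ.HomSpace b c) {q r : ℕ → V} (hq : Γ.IsWalk q a) (hr : Γ.IsWalk r c)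
    (hinj : ∀ x y, (∀ i ≤ b, w x i = w y i) → x = y)
    (hsurj : ∀ p, Γ.IsWalk p b → entry f q p ≠ 0 → entry g p r ≠ 0 →
      ∃ x, ∀ i ≤ b, w x i = p i) :
    entry (compMap f g) q r = ∑ x, entry f q (w x) * entry g (w x) r := by
  classical
  rw [entry_of_isWalk _ hq hr]
  change ∑ p, f.1 hq.path p * g.1 p hr.path = _
  have e : ∀ {p} (hp : Γ.IsWalk p b), f.1 hq.path hp.path * g.1 hp.path hr.path =
      entry f q p * entry g p r := fun hp => by
    rw [entry_of_isWalk f hq hp, entry_of_isWalk g hp hr]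
  have hw : ∀ {x}, entry f q (w x) * entry g (w x) r ≠ 0 → Γ.IsWalk (w x) b := fun h =>
    (isWalk_of_entry_ne_zero (mul_ne_zero_iff.1 h).1).2
  refine (Finset.sum_bij_ne_zero (fun x _ h => (hw h).path) (fun _ _ _ => Finset.mem_univ _)
    ?_ ?_ fun x _ h => (e (hw h)).symm).symm
  · intro x _ hx y _ hy hxy
    exact hinj x y fun i hi => congrArg (fun p : Γ.EdgePath b => p.1 ⟨i, by omega⟩) hxy
  · intro p _ hp
    have h₀ := e p.isWalk_seq
    rw [p.path_seq] at h₀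
    rw [h₀] at hp
    obtain ⟨h₁, h₂⟩ := mul_ne_zero_iff.1 hp
    obtain ⟨x, hx⟩ := hsurj p.seq p.isWalk_seq h₁ h₂
    refine ⟨x, Finset.mem_univ _, ?_, ?_⟩
    · rw [entry_congr f (fun _ _ => rfl) hx, entry_congr g hx fun _ _ => rfl]
      exact hp
    · exact EdgePath.ext fun i => (hx i.1 (by omega)).trans (p.seq_apply i)

theorem exists_of_entry_compMap_ne_zero {f : Γ.HomSpace a b} {g : Γ.HomSpace b c} {q r : ℕ → V}
    (h : entry (compMap f g) q r ≠ 0) : ∃ p, entry f q p ≠ 0 ∧ entry g p r ≠ 0 := by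
  obtain ⟨hq, hr⟩ := isWalk_of_entry_ne_zero h
  rw [entry_of_isWalk _ hq hr] at h
  obtain ⟨p, -, hp⟩ := Finset.exists_ne_zero_of_sum_ne_zero h
  refine ⟨p.seq, mul_ne_zero_iff.1 ?_⟩
  rwa [entry_of_isWalk f hq p.isWalk_seq, entry_of_isWalk g p.isWalk_seq hr, p.path_seq]

/-- A composite with at most one intermediate path. -/
theorem entry_compMap_single (w : ℕ → V) (f : Γ.HomSpace a b)
    (g : Γ.HomSpace b c) {q r : ℕ → V} (hq : Γ.IsWalk q a) (hr : Γ.IsWalk r c)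
    (hw : ∀ p, Γ.IsWalk p b → entry f q p ≠ 0 → entry g p r ≠ 0 → ∀ i ≤ b, w i = p i) :
    entry (compMap f g) q r = entry f q w * entry g w r := by
  rw [entry_compMap (fun _ : Unit => w) f g hq hr (fun _ _ _ => rfl)
    (fun p h₁ h₂ h₃ => ⟨(), hw p h₁ h₂ h₃⟩)]
  simp
end
end GPA

/-! ### Cell functions -/

namespace GPA
open LoopGraph Diagram

variable {V : Type} {Γ : LoopGraph V}

open scoped Classical in
/-- The morphism `2 → 1` with coefficient `t u v w * √(lam v)` on the path `u, v, w` and the edge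
`u, w`. -/
noncomputable def trivalent (lam : V → ℝ) (t : V → V → V → ℝ) : Γ.HomSpace 2 1 :=
  ⟨fun p q => if p.Parallel q then ((t (p.1 0) (p.1 1) (p.1 2) * √(lam (p.1 1)) : ℝ) : ℂ) else 0,
    fun _ _ h => if_neg h⟩

variable (Γ) in
/-- A function on triples of vertices that is invariant under permutations and supported on the
triangles of the graph. -/
structure IsCellFunction (t : V → V → V → ℝ) : Prop where
  swap_left : ∀ u v w, t u v w = t v u w
  swap_right : ∀ u v w, t u v w = t u w v
  eq_zero : ∀ u v w, ¬ Γ.Adj u v → t u v w = 0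

variable (Γ) in
/-- The interpretation of diagrams given by the evaluation, the coevaluation and the trivalent vertex
of a cell function. -/
noncomputable abbrev interp [Finite V] (lam : V → ℝ) (t : V → V → V → ℝ) {m n : ℕ}
    (d : Diagram m n) : Γ.HomSpace m n :=
  realize (ev Γ lam) (coev Γ lam) (trivalent lam t) d

variable {lam : V → ℝ} {t : V → V → V → ℝ}

theorem entry_ev [Finite V] (hlam : ∀ v, 0 < lam v) {q r : ℕ → V} (hq : Γ.IsWalk q 2)
    (h₀ : q 0 = r 0) (h₂ : q 2 = q 0) :
    entry (ev Γ lam : Γ.HomSpace 2 0) q r = ((√(lam (q 1)) / √(lam (q 0)) : ℝ) : ℂ) := by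
  rw [entry_of_isWalk _ hq (fun i hi => absurd hi (Nat.not_lt_zero i)), ← Real.sqrt_div (hlam _).le]
  exact if_pos ⟨h₀, h₂.trans h₀⟩

theorem entry_coev [Finite V] (hlam : ∀ v, 0 < lam v) {q r : ℕ → V} (hr : Γ.IsWalk r 2)
    (h₀ : q 0 = r 0) (h₂ : r 2 = r 0) :
    entry (coev Γ lam : Γ.HomSpace 0 2) q r = ((√(lam (r 1)) / √(lam (r 0)) : ℝ) : ℂ) := by
  rw [entry_of_isWalk _ (fun i hi => absurd hi (Nat.not_lt_zero i)) hr, ← Real.sqrt_div (hlam _).le]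
  exact if_pos ⟨h₀, h₀.trans h₂.symm⟩

theorem entry_trivalent {q r : ℕ → V} (hq : Γ.IsWalk q 2) (hr : Γ.IsWalk r 1)
    (h₀ : q 0 = r 0) (h₂ : q 2 = r 1) :
    entry (trivalent lam t : Γ.HomSpace 2 1) q r =
      ((t (q 0) (q 1) (q 2) * √(lam (q 1)) : ℝ) : ℂ) := by
  rw [entry_of_isWalk _ hq hr]
  exact if_pos ⟨h₀, h₂⟩

theorem isWalk_two {s : ℕ → V} : Γ.IsWalk s 2 ↔ Γ.Adj (s 0) (s 1) ∧ Γ.Adj (s 1) (s 2) :=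
  ⟨fun h => ⟨h 0 (by omega), h 1 (by omega)⟩, fun h i hi => by
    match i, hi with
    | 0, _ => exact h.1
    | 1, _ => exact h.2⟩

theorem isWalk_one {s : ℕ → V} : Γ.IsWalk s 1 ↔ Γ.Adj (s 0) (s 1) :=
  ⟨fun h => h 0 (by omega), fun h i hi => by
    match i, hi with
    | 0, _ => exact h⟩

theorem isWalk_zero {s : ℕ → V} : Γ.IsWalk s 0 := fun i hi => absurd hi (Nat.not_lt_zero i)

/-- The sequence with the term after position `k` left out. -/
def skip (k : ℕ) (s : ℕ → V) (i : ℕ) : V := if i ≤ k then s i else s (i + 1)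

theorem skip_of_le {k i : ℕ} (s : ℕ → V) (h : i ≤ k) : skip k s i = s i := if_pos h

theorem skip_of_lt {k i : ℕ} (s : ℕ → V) (h : k < i) : skip k s i = s (i + 1) :=
  if_neg (by omega)

variable [Finite V]

/-- The evaluation and the coevaluation satisfy the first zigzag identity. -/
theorem zigzag_left (hlam : ∀ v, 0 < lam v) : @compMap V Γ _ 1 3 1
    (@tensorMap V Γ 0 2 1 1 (coev Γ lam) (castMap rfl))
    (@tensorMap V Γ 1 1 2 0 (castMap rfl) (ev Γ lam)) = castMap rfl := by
  refine ext_entry fun q r hq hr h₀ h₁ => ?_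
  have hq₁ : Γ.Adj (q 0) (q 1) := isWalk_one.1 hq
  have hq₂ : Γ.Adj (q 1) (q 0) := Γ.symm _ _ hq₁
  have hsq : ∀ v, √(lam v) ≠ 0 := fun v => (Real.sqrt_pos.2 (hlam v)).ne'
  have hqr : ∀ i ≤ 1, q i = r i := fun i hi => by interval_cases i; exacts [h₀, h₁]
  let w : ℕ → V := fun i => match i with | 0 => q 0 | 1 => q 1 | 2 => q 0 | _ => q 1
  have e₁ : entry (@tensorMap V Γ 0 2 1 1 (coev Γ lam) (castMap rfl)) q w =
      ((√(lam (q 1)) / √(lam (q 0)) : ℝ) : ℂ) := by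
    refine Eq.trans (entry_tensorMap_of ?_ ?_) (mul_one _)
    · exact entry_coev hlam (isWalk_two.2 ⟨hq₁, hq₂⟩) rfl rfl
    · exact entry_castMap_self _ (isWalk_one.2 hq₁) fun i hi => by interval_cases i <;> rfl
  have e₂ : entry (@tensorMap V Γ 1 1 2 0 (castMap rfl) (ev Γ lam)) w r =
      ((√(lam (q 0)) / √(lam (q 1)) : ℝ) : ℂ) := by
    refine Eq.trans (entry_tensorMap_of ?_ ?_) (one_mul _)
    · exact entry_castMap_self _ (isWalk_one.2 hq₁) fun i hi => by
        interval_cases i; exacts [h₀, h₁]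
    · exact entry_ev hlam (isWalk_two.2 ⟨hq₂, hq₁⟩) h₁ rfl
  rw [entry_compMap_single w _ _ hq hr, e₁, e₂, entry_castMap_self rfl hq hqr,
    ← Complex.ofReal_mul, div_mul_div_cancel₀ (hsq _), div_self (hsq _), Complex.ofReal_one]
  intro p hp h₂ h₃
  obtain ⟨h₂, h₂'⟩ := ne_zero_of_entry_tensorMap_ne_zero h₂
  obtain ⟨h₃, h₃'⟩ := ne_zero_of_entry_tensorMap_ne_zero h₃
  have e₃ := eq_of_entry_castMap_ne_zero _ h₂'
  have e₄ := eq_of_entry_castMap_ne_zero _ h₃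
  intro i hi
  interval_cases i
  exacts [(parallel_of_entry_ne_zero h₂).1, h₁.trans (e₄ 1 le_rfl).symm, e₃ 0 zero_le_one,
    e₃ 1 le_rfl]

/-- The evaluation and the coevaluation satisfy the second zigzag identity. -/
theorem zigzag_right (hlam : ∀ v, 0 < lam v) : @compMap V Γ _ 1 3 1
    (@tensorMap V Γ 1 1 0 2 (castMap rfl) (coev Γ lam))
    (@tensorMap V Γ 2 0 1 1 (ev Γ lam) (castMap rfl)) = castMap rfl := by
  refine ext_entry fun q r hq hr h₀ h₁ => ?_
  have hq₁ : Γ.Adj (q 0) (q 1) := isWalk_one.1 hq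
  have hq₂ : Γ.Adj (q 1) (q 0) := Γ.symm _ _ hq₁
  have hsq : ∀ v, √(lam v) ≠ 0 := fun v => (Real.sqrt_pos.2 (hlam v)).ne'
  have hqr : ∀ i ≤ 1, q i = r i := fun i hi => by interval_cases i; exacts [h₀, h₁]
  let w : ℕ → V := fun i => match i with | 0 => q 0 | 1 => q 1 | 2 => q 0 | _ => q 1
  have e₁ : entry (@tensorMap V Γ 1 1 0 2 (castMap rfl) (coev Γ lam)) q w =
      ((√(lam (q 0)) / √(lam (q 1)) : ℝ) : ℂ) := by
    refine Eq.trans (entry_tensorMap_of ?_ ?_) (one_mul _)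
    · exact entry_castMap_self _ (isWalk_one.2 hq₁) fun i hi => by interval_cases i <;> rfl
    · exact entry_coev hlam (isWalk_two.2 ⟨hq₂, hq₁⟩) rfl rfl
  have e₂ : entry (@tensorMap V Γ 2 0 1 1 (ev Γ lam) (castMap rfl)) w r =
      ((√(lam (q 1)) / √(lam (q 0)) : ℝ) : ℂ) := by
    refine Eq.trans (entry_tensorMap_of ?_ ?_) (mul_one _)
    · exact entry_ev hlam (isWalk_two.2 ⟨hq₁, hq₂⟩) h₀ rfl
    · exact entry_castMap_self _ (isWalk_one.2 hq₁) fun i hi => by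
        interval_cases i; exacts [h₀, h₁]
  rw [entry_compMap_single w _ _ hq hr, e₁, e₂, entry_castMap_self rfl hq hqr,
    ← Complex.ofReal_mul, div_mul_div_cancel₀ (hsq _), div_self (hsq _), Complex.ofReal_one]
  intro p hp h₂ h₃
  obtain ⟨h₂, h₂'⟩ := ne_zero_of_entry_tensorMap_ne_zero h₂
  obtain ⟨h₃, h₃'⟩ := ne_zero_of_entry_tensorMap_ne_zero h₃
  have e₃ := eq_of_entry_castMap_ne_zero _ h₂
  have e₄ := eq_of_entry_castMap_ne_zero _ h₃'
  intro i hi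
  interval_cases i
  exacts [e₃ 0 zero_le_one, e₃ 1 le_rfl, h₀.trans (e₄ 0 zero_le_one).symm,
    h₁.trans (e₄ 1 le_rfl).symm]

/-- The coefficients of the trivalent vertex with two legs up. -/
theorem entry_split (hlam : ∀ v, 0 < lam v) (ht : IsCellFunction Γ t) {q r : ℕ → V}
    (hq : Γ.IsWalk q 1) (hr : Γ.IsWalk r 2) (h₀ : q 0 = r 0) (h₂ : q 1 = r 2) :
    entry (interp Γ lam t split) q r =
      ((t (r 0) (r 1) (r 2) * √(lam (r 1)) : ℝ) : ℂ) := by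
  have hq₁ : Γ.Adj (q 0) (q 1) := isWalk_one.1 hq
  have hr₁ : Γ.Adj (r 0) (r 1) := hr 0 (by omega)
  have hr₂ : Γ.Adj (r 1) (q 1) := h₂ ▸ hr 1 (by omega)
  have hsq : ∀ v, √(lam v) ≠ 0 := fun v => (Real.sqrt_pos.2 (hlam v)).ne'
  let w : ℕ → V := fun i => match i with | 0 => q 0 | 1 => q 1 | 2 => r 1 | _ => q 1
  have e₁ : entry (interp Γ lam t (@tensor 1 1 0 2 (one 1) cup)) q w =
      ((√(lam (r 1)) / √(lam (q 1)) : ℝ) : ℂ) := by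
    refine Eq.trans (entry_tensorMap_of ?_ ?_) (one_mul _)
    · exact entry_castMap_self _ (isWalk_one.2 hq₁) fun i hi => by interval_cases i <;> rfl
    · exact entry_coev hlam (isWalk_two.2 ⟨Γ.symm _ _ hr₂, hr₂⟩) rfl rfl
  have e₂ : entry (interp Γ lam t (@tensor 2 1 1 1 vertex (one 1))) w r =
      ((t (q 0) (q 1) (r 1) * √(lam (q 1)) : ℝ) : ℂ) := by
    refine Eq.trans (entry_tensorMap_of ?_ ?_) (mul_one _)
    · exact entry_trivalent (isWalk_two.2 ⟨hq₁, Γ.symm _ _ hr₂⟩) (isWalk_one.2 hr₁) h₀ rfl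
    · exact entry_castMap_self _ (isWalk_one.2 hr₂) fun i hi => by
        interval_cases i; exacts [rfl, h₂]
  refine (entry_compMap_single w _ _ hq hr ?_).trans ?_
  · intro p hp h₃ h₄
    obtain ⟨h₃, h₃'⟩ := ne_zero_of_entry_tensorMap_ne_zero h₃
    obtain ⟨h₄, h₄'⟩ := ne_zero_of_entry_tensorMap_ne_zero h₄
    have e₃ := eq_of_entry_castMap_ne_zero _ h₃
    have e₄ := eq_of_entry_castMap_ne_zero _ h₄'
    intro i hi
    interval_cases i
    exacts [e₃ 0 zero_le_one, e₃ 1 le_rfl, (e₄ 0 zero_le_one).symm, h₂.trans (e₄ 1 le_rfl).symm]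
  · rw [e₁, e₂, ← Complex.ofReal_mul, h₀, h₂, ht.swap_right]
    field_simp [hsq]

/-- Splitting the strand after position `k` into two strands. -/
theorem entry_split_layer (hlam : ∀ v, 0 < lam v) (ht : IsCellFunction Γ t) {k n : ℕ}
    (f : Γ.HomSpace 0 (k + (1 + n))) {q s : ℕ → V} (hs : Γ.IsWalk s (k + (2 + n))) :
    entry (compMap f (tensorMap (castMap rfl : Γ.HomSpace k k)
      (tensorMap (interp Γ lam t split) (castMap rfl : Γ.HomSpace n n)))) q s =
      entry f q (skip k s) * ((t (s k) (s (k + 1)) (s (k + 2)) * √(lam (s (k + 1))) : ℝ) : ℂ) := by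
  have h₁ := isWalk_add.1 hs
  have h₂ := isWalk_add.1 h₁.2
  rw [entry_compMap_single (skip k s) _ _ isWalk_zero hs]
  · by_cases hw : Γ.IsWalk (skip k s) (k + (1 + n))
    · congr 1
      have h₃ := isWalk_add.1 hw
      have h₄ := isWalk_add.1 h₃.2
      rw [entry_tensorMap, entry_tensorMap, entry_castMap_self _ h₃.1 (fun i hi => skip_of_le s hi),
        entry_castMap_self _ h₄.2 (fun i _ =>
          (skip_of_lt s (by omega)).trans (congrArg s (by omega))), one_mul, mul_one]
      exact entry_split hlam ht h₄.1 h₂.1 (skip_of_le s le_rfl) (skip_of_lt s (by omega))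
    · have : entry f q (skip k s) = 0 := by
        by_contra h
        exact hw (isWalk_of_entry_ne_zero h).2
      rw [this, zero_mul, zero_mul]
  · intro p hp _ h i hi
    obtain ⟨h₃, h₄⟩ := ne_zero_of_entry_tensorMap_ne_zero h
    obtain ⟨h₄, h₅⟩ := ne_zero_of_entry_tensorMap_ne_zero h₄
    rcases le_or_gt i k with hik | hik
    · rw [skip_of_le s hik, eq_of_entry_castMap_ne_zero _ h₃ i hik]
    · obtain ⟨j, rfl⟩ := Nat.exists_eq_add_of_le hik
      rw [skip_of_lt s hik]
      have := eq_of_entry_castMap_ne_zero _ h₅ j (by omega)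
      refine Eq.trans (congrArg s (by omega)) (this.symm.trans (congrArg p (by omega)))

/-- Splitting the first strand into two strands. -/
theorem entry_split_first (hlam : ∀ v, 0 < lam v) (ht : IsCellFunction Γ t) {n : ℕ}
    (f : Γ.HomSpace 0 (1 + n)) {q s : ℕ → V} (hs : Γ.IsWalk s (2 + n)) :
    entry (compMap f (tensorMap (interp Γ lam t split) (castMap rfl : Γ.HomSpace n n))) q s =
      entry f q (skip 0 s) * ((t (s 0) (s 1) (s 2) * √(lam (s 1)) : ℝ) : ℂ) := by
  have e₀ : 0 + (1 + n) = 1 + n := Nat.zero_add _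
  have e₁ : 0 + (2 + n) = 2 + n := Nat.zero_add _
  have h := entry_split_layer (k := 0) hlam ht (compMap f (castMap e₀.symm)) (q := q) (s := s)
    (by rwa [e₁])
  rw [entry_compMap_castMap] at h
  rw [← h, ← entry_compMap_castMap _ e₁]
  congr 1
  have h' : compMap (tensorMap (castMap rfl : Γ.HomSpace 0 0)
      (tensorMap (interp Γ lam t split) (castMap rfl : Γ.HomSpace n n))) (castMap e₁) =
      compMap (castMap e₀) (tensorMap (interp Γ lam t split) (castMap rfl)) :=
    MonoidalCategory.leftUnitor_naturality (C := GPA Γ) (X := ⟨1 + n⟩) (Y := ⟨2 + n⟩)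
      (tensorMap (interp Γ lam t split) (castMap rfl : Γ.HomSpace n n))
  rw [compMap_assoc, h', ← compMap_assoc, compMap_assoc f, castMap_trans, comp_id']

end GPA

/-! ### Amplitudes -/

namespace GPA
open LoopGraph Diagram

variable {V : Type} {Γ : LoopGraph V}

/-- A morphism `0 → n` has amplitude `φ` if its coefficient on a closed path `s` is
`φ s * ∏ i < n, √(lam (s i))`, divided by `lam (s 0)`. -/
def HasAmplitude (lam : V → ℝ) {n : ℕ} (f : Γ.HomSpace 0 n) (φ : (ℕ → V) → ℝ) : Prop :=
  ∀ s, Γ.IsWalk s n → s n = s 0 →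
    entry f s s = (((∏ i ∈ Finset.range n, √(lam (s i))) / lam (s 0) * φ s : ℝ) : ℂ)

open scoped Classical in
/-- The Kronecker delta. -/
noncomputable def kronecker (u v : V) : ℝ := if u = v then 1 else 0

variable {lam : V → ℝ} {t : V → V → V → ℝ} {n : ℕ} {f g : Γ.HomSpace 0 n} {φ ψ : (ℕ → V) → ℝ}

namespace HasAmplitude

theorem eq (hf : HasAmplitude lam f φ) (hg : HasAmplitude lam g ψ)
    (h : ∀ s, Γ.IsWalk s n → s n = s 0 → φ s = ψ s) : f = g := by
  refine ext_entry fun q r _ hr h₀ h₁ => ?_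
  have e : ∀ f' : Γ.HomSpace 0 n, entry f' q r = entry f' r r := fun f' =>
    entry_congr f' (fun i hi => by rw [Nat.le_zero.1 hi, h₀]) fun _ _ => rfl
  have hr' : r n = r 0 := h₁.symm.trans h₀
  rw [e, e, hf r hr hr', hg r hr hr', h r hr hr']

theorem add (hf : HasAmplitude lam f φ) (hg : HasAmplitude lam g ψ) :
    HasAmplitude lam (f + g) (fun s => φ s + ψ s) := fun s hs h => by
  rw [entry_add, hf s hs h, hg s hs h, ← Complex.ofReal_add, mul_add]

theorem smul {z : ℂ} {x : ℝ} (hz : z = x) (hf : HasAmplitude lam f φ) :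
    HasAmplitude lam (z • f) (fun s => x * φ s) := fun s hs h => by
  rw [entry_smul, hf s hs h, hz, ← Complex.ofReal_mul, mul_left_comm]

theorem zero : HasAmplitude lam (0 : Γ.HomSpace 0 n) (fun _ => 0) := fun s _ _ => by
  rw [entry_zero, mul_zero, Complex.ofReal_zero]

theorem one (hlam : ∀ v, 0 < lam v) :
    HasAmplitude lam (castMap rfl : Γ.HomSpace 0 0) (fun s => lam (s 0)) := fun s hs _ => by
  rw [entry_castMap_self _ hs fun _ _ => rfl, Finset.prod_range_zero,
    one_div_mul_cancel (hlam _).ne', Complex.ofReal_one]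

theorem coev [Finite V] (hlam : ∀ v, 0 < lam v) :
    HasAmplitude lam (coev Γ lam : Γ.HomSpace 0 2) (fun _ => 1) := fun s hs h => by
  rw [entry_coev hlam hs rfl h]
  have h₀ := Real.sqrt_pos.2 (hlam (s 0))
  congr 1
  rw [Finset.prod_range_succ, Finset.prod_range_one, mul_one]
  nth_rw 3 [← Real.mul_self_sqrt (hlam (s 0)).le]
  rw [mul_div_mul_left _ _ h₀.ne']

theorem tensor (hlam : ∀ v, 0 < lam v) {m : ℕ} {g : Γ.HomSpace 0 m} (hf : HasAmplitude lam f φ)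
    (hg : HasAmplitude lam g ψ) :
    HasAmplitude lam (tensorMap f g : Γ.HomSpace 0 (n + m))
      (fun s => kronecker (s n) (s 0) * (φ s * ψ (fun i => s (n + i)) / lam (s 0))) :=
    fun s hs h => by
  refine (entry_tensorMap f g s s).trans ?_
  beta_reduce
  by_cases h₀ : s n = s 0
  · have e : entry g (fun i => s (0 + i)) (fun i => s (n + i)) =
        entry g (fun i => s (n + i)) (fun i => s (n + i)) :=
      entry_congr g (fun i hi => by rw [Nat.le_zero.1 hi]; exact h₀.symm) fun _ _ => rfl
    rw [e, hf s (isWalk_add.1 hs).1 h₀, hg _ (isWalk_add.1 hs).2 (h.trans h₀.symm),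
      kronecker, if_pos h₀, one_mul, Finset.prod_range_add, ← Complex.ofReal_mul, Nat.add_zero, h₀]
    congr 1
    field_simp [(hlam (s 0)).ne']
  · have e : entry g (fun i => s (0 + i)) (fun i => s (n + i)) = 0 := by
      by_contra h₁
      exact h₀ (parallel_of_entry_ne_zero h₁).1.symm
    rw [e, kronecker, if_neg h₀, zero_mul, mul_zero, mul_zero, Complex.ofReal_zero]

theorem split_first [Finite V] (hlam : ∀ v, 0 < lam v) (ht : IsCellFunction Γ t)
    {f : Γ.HomSpace 0 (1 + n)} (hf : HasAmplitude lam f φ) :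
    HasAmplitude lam (compMap f (tensorMap (interp Γ lam t split) (castMap rfl : Γ.HomSpace n n)))
      (fun s => φ (skip 0 s) * t (s 0) (s 1) (s 2)) := fun s hs h => by
  rw [entry_split_first hlam ht f hs]
  by_cases h₂ : Γ.Adj (s 0) (s 2)
  · have hw : Γ.IsWalk (skip 0 s) (1 + n) := fun i hi => by
      rcases i.eq_zero_or_pos with rfl | hi'
      · exact h₂
      · rw [skip_of_lt s hi', skip_of_lt s (by omega)]
        exact hs _ (by omega)
    have e : entry f s (skip 0 s) = entry f (skip 0 s) (skip 0 s) :=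
      entry_congr f (fun i hi => by rw [Nat.le_zero.1 hi]; rfl) fun _ _ => rfl
    rw [e, hf _ hw ((skip_of_lt s (by omega)).trans ((congrArg s (by omega)).trans h)),
      ← Complex.ofReal_mul, Nat.add_comm 1 n, Nat.add_comm 2 n, Finset.prod_range_succ',
      Finset.prod_range_succ', Finset.prod_range_succ']
    congr 1
    have e' : ∀ i, skip 0 s (i + 1) = s (i + 1 + 1) := fun i => skip_of_lt s (by omega)
    simp only [e', skip_of_le s le_rfl, Nat.zero_add]
    ring
  · have e : t (s 0) (s 1) (s 2) = 0 := by rw [ht.swap_right, ht.eq_zero _ _ _ h₂]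
    simp [e]

end HasAmplitude

/-- The sequence `s n, s 0, s 1, …`. -/
def turn (n : ℕ) (s : ℕ → V) : ℕ → V
  | 0 => s n
  | i + 1 => s i

theorem HasAmplitude.rotate [Finite V] (hlam : ∀ v, 0 < lam v) {d : Diagram 0 (n + 1)}
    (hd : HasAmplitude lam (interp Γ lam t d) φ) :
    HasAmplitude lam (interp Γ lam t (Diagram.rotate d)) (fun s => φ (turn n s)) :=
    fun s hs h => by
  have hn : Γ.Adj (s n) (s 0) := h ▸ hs n (by omega)
  have hsq : ∀ v, √(lam v) ≠ 0 := fun v => (Real.sqrt_pos.2 (hlam v)).ne'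
  let w : ℕ → V := fun i => match i with | 0 => s 0 | i + 1 => turn n s i
  let w' : ℕ → V := fun i => match i with | 0 => s 0 | 1 => s n | _ => s 0
  have hw : Γ.IsWalk (turn n s) (n + 1) := fun i hi => by
    cases i with
    | zero => exact hn
    | succ i => exact hs i (by omega)
  have hws : ∀ i, w (2 + i) = s i := fun i => by rw [Nat.add_comm]; rfl
  have hww : Γ.IsWalk w (2 + (n + 1)) := isWalk_add.2
    ⟨isWalk_two.2 ⟨Γ.symm _ _ hn, hn⟩, hs.congr fun i _ => (hws i).symm⟩
  have e₁ : entry (interp Γ lam t (Diagram.tensor (Diagram.tensor (Diagram.one 1) d)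
      (Diagram.one 1))) w' w = (((∏ i ∈ Finset.range (n + 1), √(lam (turn n s i))) /
        lam (s n) * φ (turn n s) : ℝ) : ℂ) := by
    refine Eq.trans (entry_tensorMap_of (Eq.trans (entry_tensorMap_of ?_ ?_) (one_mul _)) ?_)
      (mul_one _)
    · exact entry_castMap_self _ (isWalk_one.2 (Γ.symm _ _ hn)) fun i hi => by
        interval_cases i <;> rfl
    · refine Eq.trans ?_ (hd (turn n s) hw rfl)
      refine entry_congr _ (fun i hi => ?_) fun i _ => ?_
      · rw [Nat.le_zero.1 hi]; rfl
      · rw [Nat.add_comm]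
    · refine entry_castMap_self _ (isWalk_one.2 hn) fun i hi => ?_
      interval_cases i
      · exact congrArg w (by omega : n + 2 = 1 + (n + 1) + 0)
      · exact Eq.trans h.symm (congrArg w (by omega : n + 3 = 1 + (n + 1) + 1))
  have e₂ : entry (GPA.coev Γ lam : Γ.HomSpace 0 2) s w' = ((√(lam (s n)) / √(lam (s 0)) : ℝ) : ℂ) :=
    entry_coev hlam (isWalk_two.2 ⟨Γ.symm _ _ hn, hn⟩) rfl rfl
  have e₃ : entry (interp Γ lam t (Diagram.tensor cap (Diagram.one (n + 1)))) w s =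
      ((√(lam (s n)) / √(lam (s 0)) : ℝ) : ℂ) := by
    refine Eq.trans (entry_tensorMap_of ?_ ?_) (mul_one _)
    · exact entry_ev hlam (isWalk_two.2 ⟨Γ.symm _ _ hn, hn⟩) rfl rfl
    · exact entry_castMap_self _ (hs.congr fun i _ => (hws i).symm) fun i _ =>
        (hws i).trans (congrArg s (Nat.zero_add i).symm)
  have e₄ : entry (interp Γ lam t (comp cup (Diagram.tensor (Diagram.tensor (Diagram.one 1) d)
      (Diagram.one 1)))) s w = ((√(lam (s n)) / √(lam (s 0)) : ℝ) : ℂ) *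
        (((∏ i ∈ Finset.range (n + 1), √(lam (turn n s i))) / lam (s n) * φ (turn n s) : ℝ) : ℂ) := by
    refine Eq.trans (entry_compMap_single w' _ _ isWalk_zero
      (fun i hi => hww i (by omega)) ?_) (congrArg₂ (· * ·) e₂ e₁)
    intro p hp h₁ h₂ i hi
    have e := eq_of_entry_castMap_ne_zero _ (ne_zero_of_entry_tensorMap_ne_zero
      (ne_zero_of_entry_tensorMap_ne_zero h₂).1).1
    have e' := parallel_of_entry_ne_zero h₁
    interval_cases i
    exacts [(e 0 zero_le_one).symm, (e 1 le_rfl).symm, e'.2]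
  refine (entry_compMap_castMap _ _ _ _).trans ?_
  refine Eq.trans (entry_compMap_single w _ _ isWalk_zero (fun i hi => hs i (by omega)) ?_) ?_
  · intro p hp h₁ h₂ i hi
    obtain ⟨h₂, h₃⟩ := ne_zero_of_entry_tensorMap_ne_zero h₂
    have e := eq_of_entry_castMap_ne_zero _ h₃
    have e' : ∀ j ≤ n + 1, p (2 + j) = s j := fun j hj =>
      (e j hj).trans (congrArg s (Nat.zero_add j))
    match i, hi with
    | 0, _ => exact (parallel_of_entry_ne_zero h₁).1
    | 1, _ =>
      have h₁' : entry (interp Γ lam t (comp cup (Diagram.tensor (Diagram.tensor (Diagram.one 1) d)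
          (Diagram.one 1)))) s p ≠ 0 := fun h' => h₁ ((entry_compMap_castMap _ _ _ _).trans h')
      obtain ⟨z, -, hz⟩ := exists_of_entry_compMap_ne_zero h₁'
      have hz' := (ne_zero_of_entry_tensorMap_ne_zero (ne_zero_of_entry_tensorMap_ne_zero hz).1).2
      have e₅ := (parallel_of_entry_ne_zero hz').1.symm.trans (parallel_of_entry_ne_zero hz').2
      exact ((e' n (by omega)).symm.trans (congrArg p (by omega))).trans e₅.symm
    | j + 2, hi =>
      rw [Nat.add_comm j 2, hws, e' j (by omega)]
  · refine (congrArg₂ (· * ·) ((entry_compMap_castMap _ _ _ _).trans e₄) e₃).trans ?_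
    have e₅ : ∏ i ∈ Finset.range (n + 1), √(lam (turn n s i)) =
        ∏ i ∈ Finset.range (n + 1), √(lam (s i)) := by
      rw [Finset.prod_range_succ', Finset.prod_range_succ]
      rfl
    have e₆ : √(lam (s n)) / √(lam (s 0)) * (√(lam (s n)) / √(lam (s 0))) =
        lam (s n) / lam (s 0) := by
      rw [div_mul_div_comm, Real.mul_self_sqrt (hlam _).le, Real.mul_self_sqrt (hlam _).le]
    rw [e₅, ← Complex.ofReal_mul, ← Complex.ofReal_mul, mul_right_comm, e₆]
    congr 1
    field_simp [(hlam (s n)).ne']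

theorem entry_fan [Finite V] (hlam : ∀ v, 0 < lam v) (ht : IsCellFunction Γ t) (k : ℕ) :
    ∀ {q s : ℕ → V}, Γ.IsWalk s (k + 2) → s (k + 2) = s 0 → q 0 = s 0 →
      entry (interp Γ lam t (fan k)) q s = ((√(lam (s (k + 1))) / √(lam (s 0)) *
        ∏ i ∈ Finset.range k, (t (s i) (s (i + 1)) (s (k + 1)) * √(lam (s (i + 1)))) : ℝ) : ℂ) := by
  induction k with
  | zero =>
    intro q s hs h h₀
    rw [Finset.prod_range_zero, mul_one]
    exact entry_coev hlam hs h₀ h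
  | succ k ih =>
    intro q s hs h h₀
    refine (entry_compMap_castMap _ _ _ _).trans
      ((entry_split_layer (n := 1) hlam ht _ hs).trans ?_)
    by_cases h₂ : Γ.Adj (s k) (s (k + 2))
    · have hw : Γ.IsWalk (skip k s) (k + 2) := fun i hi => by
        rcases lt_trichotomy i k with h' | rfl | h'
        · rw [skip_of_le s h'.le, skip_of_le s h']
          exact hs i (by omega)
        · rw [skip_of_le s le_rfl, skip_of_lt s (by omega)]
          exact h₂
        · rw [skip_of_lt s h', skip_of_lt s (by omega)]
          exact hs (i + 1) (by omega)
      have e₀ : skip k s 0 = s 0 := skip_of_le s (by omega)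
      have e₁ : skip k s (k + 1) = s (k + 2) := skip_of_lt s (by omega)
      refine (congrArg (· * _) (ih hw ((skip_of_lt s (by omega)).trans (h.trans e₀.symm))
        (h₀.trans e₀.symm))).trans ?_
      rw [Finset.prod_range_succ, ← Complex.ofReal_mul, e₀, e₁, ← mul_assoc, ← mul_assoc]
      have e₃ : ∏ i ∈ Finset.range k, (t (skip k s i) (skip k s (i + 1)) (s (k + 2)) *
          √(lam (skip k s (i + 1)))) =
          ∏ i ∈ Finset.range k, (t (s i) (s (i + 1)) (s (k + 2)) * √(lam (s (i + 1)))) := by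
        refine Finset.prod_congr rfl fun i hi => ?_
        have := Finset.mem_range.1 hi
        rw [skip_of_le s (by omega), skip_of_le s (by omega)]
      rw [e₃, mul_assoc]
    · have e₁ : t (s k) (s (k + 1)) (s (k + 2)) = 0 := by
        rw [ht.swap_right]; exact ht.eq_zero _ _ _ h₂
      rw [Finset.prod_range_succ, e₁]
      simp

theorem HasAmplitude.polygon [Fintype V] (hlam : ∀ v, 0 < lam v) (ht : IsCellFunction Γ t) (k : ℕ) :
    HasAmplitude lam (interp Γ lam t (polygon k)) (fun s => ∑ x, Γ.adjMatrix (s k) x *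
      (lam x * ∏ i ∈ Finset.range k, t (s i) (s (i + 1)) x)) := fun s hs h => by
  have hsq : ∀ v, √(lam v) ≠ 0 := fun v => (Real.sqrt_pos.2 (hlam v)).ne'
  let w : V → ℕ → V := fun x i => if i ≤ k then s i else if i = k + 1 then x else s k
  have w₀ : ∀ x, ∀ i ≤ k, w x i = s i := fun x i hi => if_pos hi
  have w₁ : ∀ x, w x (k + 1) = x := fun x => (if_neg (by omega)).trans (if_pos rfl)
  have w₂ : ∀ x, w x (k + 2) = s k := fun x => (if_neg (by omega)).trans (if_neg (by omega))
  refine (entry_compMap w _ _ isWalk_zero hs ?_ ?_).trans ?_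
  · intro x y hxy
    rw [← w₁ x, ← w₁ y]
    exact hxy _ (by omega)
  · intro p hp h₁ h₂
    obtain ⟨h₂, h₃⟩ := ne_zero_of_entry_tensorMap_ne_zero h₂
    have e := eq_of_entry_castMap_ne_zero _ h₂
    refine ⟨p (k + 1), fun i hi => ?_⟩
    rcases le_or_gt i k with hi' | hi'
    · rw [w₀ _ i hi', e i hi']
    · obtain rfl | rfl : i = k + 1 ∨ i = k + 2 := by omega
      · exact w₁ _
      · exact (w₂ _).trans (h.trans (parallel_of_entry_ne_zero h₁).2)
  · rw [Finset.mul_sum, Complex.ofReal_sum]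
    refine Finset.sum_congr rfl fun x _ => ?_
    by_cases hx : Γ.Adj (s k) x
    · have hw : Γ.IsWalk (w x) (k + 2) := fun i hi => by
        rcases lt_trichotomy i k with h' | rfl | h'
        · rw [w₀ x i h'.le, w₀ x (i + 1) h']
          exact hs i h'
        · rw [w₀ x i le_rfl, w₁ x]
          exact hx
        · obtain rfl : i = k + 1 := by omega
          rw [w₁ x, w₂ x]
          exact Γ.symm _ _ hx
      have e₁ := entry_fan hlam ht k hw ((w₂ x).trans (h.trans (w₀ x 0 (by omega)).symm))
        (w₀ x 0 (by omega)).symm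
      have e₂ : entry (interp Γ lam t (@Diagram.tensor k k 2 0 (Diagram.one k) cap)) (w x) s =
          ((√(lam x) / √(lam (s k)) : ℝ) : ℂ) := by
        refine Eq.trans (entry_tensorMap_of ?_ ?_) (one_mul _)
        · exact entry_castMap_self _ (isWalk_add.1 hw).1 (w₀ x)
        · refine (entry_ev hlam (isWalk_add.1 hw).2 (w₀ x k le_rfl)
            ((w₂ x).trans (w₀ x k le_rfl).symm)).trans ?_
          rw [w₁ x, Nat.add_zero, w₀ x k le_rfl]
      refine (congrArg₂ (· * ·) e₁ e₂).trans ?_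
      have e₃ : ∏ i ∈ Finset.range k, (t (w x i) (w x (i + 1)) (w x (k + 1)) *
          √(lam (w x (i + 1)))) = (∏ i ∈ Finset.range k, t (s i) (s (i + 1)) x) *
            ∏ i ∈ Finset.range k, √(lam (s i)) := by
        have e₄ : ∏ i ∈ Finset.range k, √(lam (s i)) =
            ∏ i ∈ Finset.range k, √(lam (s (i + 1))) := by
          have := (Finset.prod_range_succ (fun i => √(lam (s i))) k).symm.trans
            (Finset.prod_range_succ' (fun i => √(lam (s i))) k)
          rw [h] at this
          exact mul_right_cancel₀ (hsq _) this
        rw [e₄, ← Finset.prod_mul_distrib]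
        refine Finset.prod_congr rfl fun i hi => ?_
        have := Finset.mem_range.1 hi
        rw [w₀ x i (by omega), w₀ x (i + 1) (by omega), w₁]
      rw [e₃, w₁, w₀ x 0 (by omega), h, ← Complex.ofReal_mul, adjMatrix, if_pos (h ▸ hx), one_mul]
      congr 1
      have e₄ : √(lam x) / √(lam (s 0)) * (√(lam x) / √(lam (s 0))) = lam x / lam (s 0) := by
        rw [div_mul_div_comm, Real.mul_self_sqrt (hlam _).le, Real.mul_self_sqrt (hlam _).le]
      rw [mul_right_comm, e₄]
      ring
    · have e₁ : entry (interp Γ lam t (fan k)) s (w x) = 0 := by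
        by_contra h'
        have := (isWalk_of_entry_ne_zero h').2 k (by omega)
        rw [w₀ x k le_rfl, w₁ x] at this
        exact hx this
      refine (congrArg (· * _) e₁).trans ?_
      rw [adjMatrix, if_neg hx]
      simp

end GPA

/-! ### The skein relations as identities between cells -/

namespace GPA
open LoopGraph Diagram

variable {V : Type} {Γ : LoopGraph V}

variable (Γ) in
/-- The identities for a cell function that express the defining relations of a trivalent skein
theory: the values of the polygons with up to five sides. -/
structure SatisfiesPolygonIdentities [Fintype V] (lam : V → ℝ) (t : V → V → V → ℝ)
    (δ b c x y : ℝ) : Prop where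
  loop : ∀ u, ∑ w, Γ.adjMatrix u w * lam w = δ * lam u
  lollipop : ∀ u, Γ.Adj u u → ∑ w, lam w * t u u w = 0
  bigon : ∀ u₀ u₁, Γ.Adj u₀ u₁ → ∑ w, lam w * (t u₀ u₁ w * t u₁ u₀ w) = b
  trigon : ∀ u₀ u₁ u₂, Γ.Adj u₀ u₁ → Γ.Adj u₁ u₂ → Γ.Adj u₂ u₀ →
    ∑ w, lam w * (t u₀ u₁ w * t u₁ u₂ w * t u₂ u₀ w) = c * t u₀ u₁ u₂
  tetragon : ∀ u₀ u₁ u₂ u₃, Γ.Adj u₀ u₁ → Γ.Adj u₁ u₂ → Γ.Adj u₂ u₃ → Γ.Adj u₃ u₀ →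
    ∑ w, lam w * (t u₀ u₁ w * t u₁ u₂ w * t u₂ u₃ w * t u₃ u₀ w) =
      x * (t u₀ u₂ u₃ * t u₀ u₁ u₂ + t u₃ u₁ u₂ * t u₃ u₀ u₁) +
      y * (kronecker u₂ u₀ / lam u₀ + kronecker u₁ u₃ / lam u₃)
  pentagon : ∀ u₀ u₁ u₂ u₃ u₄, Γ.Adj u₀ u₁ → Γ.Adj u₁ u₂ → Γ.Adj u₂ u₃ → Γ.Adj u₃ u₄ →
    Γ.Adj u₄ u₀ → ∑ w, lam w * (t u₀ u₁ w * t u₁ u₂ w * t u₂ u₃ w * t u₃ u₄ w * t u₄ u₀ w) +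
      ((t u₀ u₃ u₄ * t u₀ u₂ u₃ * t u₀ u₁ u₂ + t u₄ u₂ u₃ * t u₄ u₁ u₂ * t u₄ u₀ u₁ +
        t u₃ u₁ u₂ * t u₃ u₀ u₁ * t u₃ u₄ u₀ + t u₂ u₀ u₁ * t u₂ u₄ u₀ * t u₂ u₃ u₄ +
        t u₁ u₄ u₀ * t u₁ u₃ u₄ * t u₁ u₂ u₃) +
      (kronecker u₃ u₀ * (t u₀ u₁ u₂ / lam u₀) + kronecker u₂ u₄ * (t u₄ u₀ u₁ / lam u₄) +
        kronecker u₁ u₃ * (t u₃ u₄ u₀ / lam u₃) + kronecker u₀ u₂ * (t u₂ u₃ u₄ / lam u₂) +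
        kronecker u₄ u₁ * (t u₁ u₂ u₃ / lam u₁))) = 0

variable {lam : V → ℝ} {t : V → V → V → ℝ}

theorem HasAmplitude.congr {n : ℕ} {f : Γ.HomSpace 0 n} {φ ψ : (ℕ → V) → ℝ}
    (hf : HasAmplitude lam f φ) (h : ∀ s, φ s = ψ s) : HasAmplitude lam f ψ :=
  (funext h : φ = ψ) ▸ hf

section
variable [Finite V]

theorem hasAmplitude_cup (hlam : ∀ v, 0 < lam v) :
    HasAmplitude lam (interp Γ lam t cup) fun _ => 1 :=
  HasAmplitude.coev hlam

theorem hasAmplitude_tripod (hlam : ∀ v, 0 < lam v) (ht : IsCellFunction Γ t) :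
    HasAmplitude lam (interp Γ lam t tripod) fun s => t (s 0) (s 1) (s 2) :=
  ((hasAmplitude_cup (t := t) hlam).split_first (n := 1) hlam ht).congr fun _ => one_mul _

theorem hasAmplitude_tree4 (hlam : ∀ v, 0 < lam v) (ht : IsCellFunction Γ t) :
    HasAmplitude lam (interp Γ lam t tree4)
      fun s => t (s 0) (s 2) (s 3) * t (s 0) (s 1) (s 2) :=
  (hasAmplitude_tripod hlam ht).split_first (n := 2) hlam ht

theorem hasAmplitude_tree5 (hlam : ∀ v, 0 < lam v) (ht : IsCellFunction Γ t) :
    HasAmplitude lam (interp Γ lam t tree5)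
      fun s => t (s 0) (s 3) (s 4) * t (s 0) (s 2) (s 3) * t (s 0) (s 1) (s 2) :=
  (hasAmplitude_tree4 hlam ht).split_first (n := 3) hlam ht

theorem hasAmplitude_twoArcs (hlam : ∀ v, 0 < lam v) :
    HasAmplitude lam (interp Γ lam t twoArcs)
      fun s => kronecker (s 2) (s 0) / lam (s 0) :=
  ((hasAmplitude_cup (t := t) hlam).tensor hlam (hasAmplitude_cup (t := t) hlam)).congr fun _ => by
    rw [mul_one, mul_one_div]

theorem hasAmplitude_tripodArc (hlam : ∀ v, 0 < lam v) (ht : IsCellFunction Γ t) :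
    HasAmplitude lam (interp Γ lam t tripodArc)
      fun s => kronecker (s 3) (s 0) * (t (s 0) (s 1) (s 2) / lam (s 0)) :=
  ((hasAmplitude_tripod hlam ht).tensor hlam (hasAmplitude_cup (t := t) hlam)).congr fun _ => by
    rw [mul_one]

theorem hasAmplitude_rotationSum5 (hlam : ∀ v, 0 < lam v) {d : Diagram 0 5} {φ : (ℕ → V) → ℝ}
    (hd : HasAmplitude lam (interp Γ lam t d) φ) :
    HasAmplitude lam (interp Γ lam t (rotationSum5 d)) fun s => φ s + (φ (turn 4 s) +
      (φ (turn 4 (turn 4 s)) + (φ (turn 4 (turn 4 (turn 4 s))) +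
        φ (turn 4 (turn 4 (turn 4 (turn 4 s))))))) := by
  have h₁ := hd.rotate hlam
  have h₂ := h₁.rotate hlam
  have h₃ := h₂.rotate hlam
  have h₄ := h₃.rotate hlam
  exact hd.add (h₁.add (h₂.add (h₃.add h₄)))

end

/-- In a polygon with at least one side, the adjacency condition on the inner vertex is implied by
the nonvanishing of the cells. -/
theorem sum_polygon [Fintype V] (ht : IsCellFunction Γ t) (k : ℕ) (s : ℕ → V) :
    ∑ x, Γ.adjMatrix (s (k + 1)) x * (lam x * ∏ i ∈ Finset.range (k + 1), t (s i) (s (i + 1)) x) =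
      ∑ x, lam x * ∏ i ∈ Finset.range (k + 1), t (s i) (s (i + 1)) x := by
  refine Finset.sum_congr rfl fun x _ => ?_
  by_cases h : Γ.Adj (s (k + 1)) x
  · rw [adjMatrix, if_pos h, one_mul]
  · have h' : t (s k) (s (k + 1)) x = 0 := by
      rw [ht.swap_left, ht.swap_right]; exact ht.eq_zero _ _ _ h
    rw [Finset.prod_range_succ, h']
    simp

/-- The relations of the `G₂` skein theory hold in a graph planar algebra if the cell function
satisfies the polygon identities. -/
theorem interp_eq_of_G2Rel [Fintype V] (hlam : ∀ v, 0 < lam v) (ht : IsCellFunction Γ t)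
    {δ b c x y : ℝ} (hp : SatisfiesPolygonIdentities Γ lam t δ b c x y) {q : ℂ}
    (hδ : q ^ (10 : ℤ) + q ^ (8 : ℤ) + q ^ (2 : ℤ) + 1 + q ^ (-2 : ℤ) + q ^ (-8 : ℤ) +
        q ^ (-10 : ℤ) = δ)
    (hb : quantumInt q 7 - 1 = b) (hc : -(q ^ (4 : ℤ) + 1 + q ^ (-4 : ℤ)) = c)
    (hx : q ^ (2 : ℤ) + q ^ (-2 : ℤ) = x) (hy : q ^ (2 : ℤ) + 1 + q ^ (-2 : ℤ) = y)
    {m n : ℕ} {f g : Diagram m n} (h : G2Rel q m n f g) : interp Γ lam t f = interp Γ lam t g := by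
  have h₁ : (-1 : ℂ) = ((-1 : ℝ) : ℂ) := by norm_num
  cases h with
  | loop =>
    refine (HasAmplitude.polygon hlam ht 0).eq ((HasAmplitude.one hlam).smul hδ) fun s _ _ => ?_
    simpa using hp.loop (s 0)
  | lollipop =>
    refine (HasAmplitude.polygon hlam ht 1).eq HasAmplitude.zero fun s hs h => ?_
    rw [sum_polygon ht]
    have h' := hs 0 (by omega)
    simp only [Nat.zero_add] at h'
    rw [h] at h'
    simpa [h] using hp.lollipop (s 0) h'
  | rotate =>
    refine ((hasAmplitude_tripod hlam ht).rotate hlam).eq (hasAmplitude_tripod hlam ht) fun s _ _ => ?_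
    exact (ht.swap_left _ _ _).trans (ht.swap_right _ _ _)
  | bigon =>
    refine (HasAmplitude.polygon hlam ht 2).eq ((hasAmplitude_cup hlam).smul hb) fun s hs h => ?_
    rw [sum_polygon ht]
    simpa [Finset.prod_range_succ, h] using hp.bigon (s 0) (s 1) (hs 0 (by omega))
  | trigon =>
    refine (HasAmplitude.polygon hlam ht 3).eq ((hasAmplitude_tripod hlam ht).smul hc)
      fun s hs h => ?_
    rw [sum_polygon ht]
    simpa [Finset.prod_range_succ, h] using hp.trigon (s 0) (s 1) (s 2) (hs 0 (by omega))
      (hs 1 (by omega)) (h ▸ hs 2 (by omega))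
  | tetragon =>
    have h₂ := hasAmplitude_tree4 hlam ht
    have h₃ := hasAmplitude_twoArcs (Γ := Γ) (t := t) hlam
    refine (HasAmplitude.polygon hlam ht 4).eq
      (((h₂.add (h₂.rotate hlam)).smul hx).add ((h₃.add (h₃.rotate hlam)).smul hy)) fun s hs h => ?_
    rw [sum_polygon ht]
    have := hp.tetragon (s 0) (s 1) (s 2) (s 3) (hs 0 (by omega))
      (hs 1 (by omega)) (hs 2 (by omega)) (h ▸ hs 3 (by omega))
    simpa [Finset.prod_range_succ, h, turn] using this
  | pentagon =>
    have h₂ := hasAmplitude_rotationSum5 hlam (hasAmplitude_tree5 hlam ht)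
    have h₃ := hasAmplitude_rotationSum5 hlam (hasAmplitude_tripodArc hlam ht)
    refine (HasAmplitude.polygon hlam ht 5).eq ((h₂.smul h₁).add (h₃.smul h₁)) fun s hs h => ?_
    rw [sum_polygon ht]
    have := hp.pentagon (s 0) (s 1) (s 2) (s 3) (s 4) (hs 0 (by omega))
      (hs 1 (by omega)) (hs 2 (by omega)) (hs 3 (by omega)) (h ▸ hs 4 (by omega))
    simp only [Finset.prod_range_succ, Finset.prod_range_zero, h, turn, one_mul, Nat.reduceAdd]
    linear_combination this

end GPA

/-! ### Reflection and positivity -/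

namespace Diagram

/-- The reflection of a diagram in a horizontal line, with conjugate coefficients. -/
def dagger : {m n : ℕ} → Diagram m n → Diagram n m
  | _, _, wires h => wires h.symm
  | _, _, cap => cup
  | _, _, cup => cap
  | _, _, vertex => split
  | _, _, comp f g => comp (dagger g) (dagger f)
  | _, _, tensor f g => tensor (dagger f) (dagger g)
  | _, _, zero => zero
  | _, _, add f g => add (dagger f) (dagger g)
  | _, _, smul z f => smul (starRingEnd ℂ z) (dagger f)

theorem dagger_coevN (n : ℕ) : dagger (coevN n) = evN n := by
  induction n with
  | zero => rfl
  | succ n ih =>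
    rw [evN, ← ih]
    rfl

end Diagram

namespace GPA
open LoopGraph Diagram

variable {V : Type} {Γ : LoopGraph V}

/-- The conjugate transpose of a morphism. -/
noncomputable def adjoint {m n : ℕ} (f : Γ.HomSpace m n) : Γ.HomSpace n m :=
  ⟨fun q p => starRingEnd ℂ (f.1 p q), fun q p h => by
    beta_reduce
    rw [f.2 p q fun h' => h ⟨h'.1.symm, h'.2.symm⟩, map_zero]⟩

theorem entry_adjoint {m n : ℕ} (f : Γ.HomSpace m n) (q r : ℕ → V) :
    entry (adjoint f) q r = starRingEnd ℂ (entry f r q) := by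
  by_cases h : Γ.IsWalk q n ∧ Γ.IsWalk r m
  · rw [entry_of_isWalk _ h.1 h.2, entry_of_isWalk _ h.2 h.1]
    rfl
  · rw [entry, dif_neg h, entry, dif_neg fun h' => h ⟨h'.2, h'.1⟩, map_zero]

theorem adjoint_castMap {m n : ℕ} (h : m = n) :
    adjoint (castMap h : Γ.HomSpace m n) = castMap h.symm := by
  subst h
  classical
  refine hom_ext fun q p => ?_
  change starRingEnd ℂ (if p = q then (1 : ℂ) else 0) = if q = p then 1 else 0
  by_cases h : p = q
  · rw [if_pos h, if_pos h.symm, map_one]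
  · rw [if_neg h, if_neg (Ne.symm h), map_zero]

variable [Finite V] {lam : V → ℝ} {t : V → V → V → ℝ}

theorem adjoint_compMap {a b c : ℕ} (f : Γ.HomSpace a b) (g : Γ.HomSpace b c) :
    adjoint (compMap f g) = compMap (adjoint g) (adjoint f) := hom_ext fun q p => by
  refine (map_sum (starRingEnd ℂ) _ _).trans (Finset.sum_congr rfl fun x _ => ?_)
  rw [map_mul, mul_comm]
  rfl

/-- Reflected diagrams are interpreted by conjugate transposes: the cells are real, and the
coefficients of the evaluation and of the coevaluation agree. -/
theorem interp_dagger (hlam : ∀ v, 0 < lam v) (ht : IsCellFunction Γ t) {m n : ℕ}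
    (d : Diagram m n) : interp Γ lam t (dagger d) = adjoint (interp Γ lam t d) := by
  induction d with
  | wires h => exact (adjoint_castMap h).symm
  | cap =>
    refine ext_entry fun q r hq hr h₀ h₁ => ?_
    rw [entry_adjoint]
    refine (entry_coev hlam hr h₀ (h₁.symm.trans h₀)).trans ?_
    refine Eq.trans ?_ (congrArg (starRingEnd ℂ) (entry_ev hlam hr h₀.symm (h₁.symm.trans h₀))).symm
    rw [Complex.conj_ofReal]
  | cup =>
    refine ext_entry fun q r hq hr h₀ h₁ => ?_
    rw [entry_adjoint]
    refine (entry_ev hlam hq h₀ (h₁.trans h₀.symm)).trans ?_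
    refine Eq.trans ?_ (congrArg (starRingEnd ℂ) (entry_coev hlam hq h₀.symm (h₁.trans h₀.symm))).symm
    rw [Complex.conj_ofReal]
  | vertex =>
    refine ext_entry fun q r hq hr h₀ h₁ => ?_
    rw [entry_adjoint]
    refine (entry_split hlam ht hq hr h₀ h₁).trans ?_
    refine Eq.trans ?_ (congrArg (starRingEnd ℂ) (entry_trivalent hr hq h₀.symm h₁.symm)).symm
    rw [Complex.conj_ofReal]
  | comp f g ihf ihg =>
    exact (congrArg₂ compMap ihg ihf).trans (adjoint_compMap _ _).symm
  | tensor f g ihf ihg =>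
    exact (congrArg₂ tensorMap ihf ihg).trans (hom_ext fun _ _ => (map_mul _ _ _).symm)
  | zero => exact hom_ext fun _ _ => (map_zero (starRingEnd ℂ)).symm
  | add f g ihf ihg =>
    exact (congrArg₂ (· + ·) ihf ihg).trans (hom_ext fun _ _ => (map_add (starRingEnd ℂ) _ _).symm)
  | smul z f ih =>
    exact (congrArg (_ • ·) ih).trans (hom_ext fun _ _ => (map_mul (starRingEnd ℂ) _ _).symm)

theorem eq_zero_of_compMap_adjoint {n : ℕ} {f : Γ.HomSpace 0 n} (h : compMap f (adjoint f) = 0) :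
    f = 0 := hom_ext fun p q => by
  have h₁ : ∑ x, f.1 p x * starRingEnd ℂ (f.1 p x) = 0 :=
    congrArg (fun g : Γ.HomSpace 0 0 => g.1 p p) h
  simp only [Complex.mul_conj] at h₁
  rw [← Complex.ofReal_sum, Complex.ofReal_eq_zero,
    Finset.sum_eq_zero_iff_of_nonneg fun _ _ => Complex.normSq_nonneg _] at h₁
  exact Complex.normSq_eq_zero.1 (h₁ q (Finset.mem_univ q))

theorem palindrome_of_entry_coevN_ne_zero (n : ℕ) : ∀ {q z : ℕ → V},
    entry (interp Γ lam t (coevN n)) q z ≠ 0 → ∀ i ≤ n + n, z i = z (n + n - i) := by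
  induction n with
  | zero =>
    intro q z _ i hi
    rw [Nat.le_zero.1 hi]
  | succ n ih =>
    intro q z h
    have h₁ : entry (compMap (compMap (interp Γ lam t (coevN n)) (castMap (by omega)))
        (interp Γ lam t (tensor (tensor (one n) cup) (one n)))) q z ≠ 0 := fun h' =>
      h ((entry_compMap_castMap _ _ _ _).trans h')
    obtain ⟨z', h₂, h₃⟩ := exists_of_entry_compMap_ne_zero h₁
    rw [entry_compMap_castMap] at h₂
    obtain ⟨h₃, h₄⟩ := ne_zero_of_entry_tensorMap_ne_zero h₃
    obtain ⟨h₃, h₅⟩ := ne_zero_of_entry_tensorMap_ne_zero h₃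
    have e₁ := eq_of_entry_castMap_ne_zero _ h₃
    have e₂ : ∀ j ≤ n, z' (n + j) = z (n + 2 + j) := eq_of_entry_castMap_ne_zero _ h₄
    have e₃ : z n = z (n + 2) := (parallel_of_entry_ne_zero h₅).1.symm.trans
      (parallel_of_entry_ne_zero h₅).2
    have e₄ : ∀ i ≤ n, z i = z (n + 2 + (n - i)) := fun i hi => by
      rw [← e₁ i hi, ih h₂ i (by omega), ← e₂ _ (by omega)]
      exact congrArg z' (by omega)
    intro i hi
    rcases lt_trichotomy i (n + 1) with h' | rfl | h'
    · rw [e₄ i (by omega)]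
      exact congrArg z (by omega)
    · exact congrArg z (by omega)
    · rw [e₄ (n + 1 + (n + 1) - i) (by omega)]
      exact congrArg z (by omega)

theorem entry_coevN_ne_zero (hlam : ∀ v, 0 < lam v) (n : ℕ) : ∀ {q z : ℕ → V},
    Γ.IsWalk z (n + n) → (∀ i ≤ n + n, z i = z (n + n - i)) → q 0 = z 0 →
      entry (interp Γ lam t (coevN n)) q z ≠ 0 := by
  induction n with
  | zero =>
    intro q z _ _ h₀
    refine (Eq.trans_ne (entry_castMap_self rfl isWalk_zero fun i hi => ?_) one_ne_zero)
    rw [Nat.le_zero.1 hi, h₀]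
  | succ n ih =>
    intro q z hz hp h₀
    let w : ℕ → V := fun i => if i ≤ n then z i else z (i + 2)
    have w₀ : ∀ i ≤ n, w i = z i := fun i hi => if_pos hi
    have e₀ : z n = z (n + 2) := (hp n (by omega)).trans (congrArg z (by omega))
    have w₁ : ∀ i, n ≤ i → w i = z (i + 2) := fun i hi => by
      rcases hi.eq_or_lt with rfl | hi
      · rw [w₀ _ le_rfl, e₀]
      · exact if_neg (by omega)
    have hw : Γ.IsWalk w (n + n) := fun i hi => by
      rcases lt_or_ge i n with h' | h'
      · rw [w₀ i h'.le, w₀ (i + 1) h']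
        exact hz i (by omega)
      · rw [w₁ i h', w₁ (i + 1) (by omega)]
        exact hz (i + 2) (by omega)
    have h₁ : entry (interp Γ lam t (coevN n)) q w ≠ 0 := by
      refine ih hw (fun i hi => ?_) (h₀.trans (w₀ 0 (by omega)).symm)
      rcases le_total i n with h' | h'
      · rw [w₀ i h', w₁ _ (by omega), hp i (by omega)]
        exact congrArg z (by omega)
      · rw [w₁ i h', w₀ _ (by omega), hp _ (by omega)]
        exact congrArg z (by omega)
    have hc : Γ.IsWalk (fun i => z (n + i)) 2 :=
      isWalk_two.2 ⟨hz n (by omega), hz (n + 1) (by omega)⟩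
    have h₂ : entry (interp Γ lam t (tensor (tensor (one n) cup) (one n))) w z =
        1 * ((√(lam (z (n + 1))) / √(lam (z n)) : ℝ) : ℂ) * 1 := by
      refine entry_tensorMap_of (entry_tensorMap_of ?_ ?_) ?_
      · exact entry_castMap_self _ (isWalk_add.1 hw).1 w₀
      · exact entry_coev hlam hc (w₀ n le_rfl) e₀.symm
      · exact entry_castMap_self _ (isWalk_add.1 hw).2 fun i hi =>
          (w₁ _ (by omega)).trans (congrArg z (by omega))
    refine Eq.trans_ne ((entry_compMap_castMap _ _ _ _).trans
      (entry_compMap_single w _ _ isWalk_zero (fun i hi => hz i (by omega)) ?_)) ?_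
    · intro p hp' h₃ h₄ i hi
      obtain ⟨h₄, h₅⟩ := ne_zero_of_entry_tensorMap_ne_zero h₄
      obtain ⟨h₄, h₆⟩ := ne_zero_of_entry_tensorMap_ne_zero h₄
      rcases le_total i n with h' | h'
      · rw [w₀ i h', eq_of_entry_castMap_ne_zero _ h₄ i h']
      · obtain ⟨j, rfl⟩ := Nat.exists_eq_add_of_le h'
        have : p (n + j) = z (n + 2 + j) := eq_of_entry_castMap_ne_zero _ h₅ j (by omega)
        rw [w₁ _ h', this]
        exact congrArg z (by omega)
    · refine mul_ne_zero ?_ ?_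
      · exact Eq.trans_ne (entry_compMap_castMap _ _ _ _) h₁
      · refine Eq.trans_ne h₂ ?_
        rw [one_mul, mul_one, Complex.ofReal_ne_zero]
        exact (div_pos (Real.sqrt_pos.2 (hlam _)) (Real.sqrt_pos.2 (hlam _))).ne'

/-- A morphism vanishes if bending its lower strands up gives zero. -/
theorem eq_zero_of_coevN_compMap (hlam : ∀ v, 0 < lam v) {m n : ℕ} {f : Γ.HomSpace m n}
    (h : compMap (interp Γ lam t (coevN m)) (tensorMap f (castMap rfl : Γ.HomSpace m m)) = 0) :
    f = 0 := by
  refine ext_entry fun p r hp hr h₀ h₁ => ?_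
  rw [entry_zero]
  let w : ℕ → V := fun i => if i ≤ m then p i else p (m + m - i)
  let s : ℕ → V := fun i => if i ≤ n then r i else p (n + m - i)
  have w₀ : ∀ i ≤ m, w i = p i := fun i hi => if_pos hi
  have w₁ : ∀ j ≤ m, w (m + j) = p (m - j) := fun j hj => by
    rcases j.eq_zero_or_pos with rfl | hj'
    · exact w₀ m le_rfl
    · exact (if_neg (by omega)).trans (congrArg p (by omega))
  have s₀ : ∀ i ≤ n, s i = r i := fun i hi => if_pos hi
  have s₁ : ∀ j ≤ m, s (n + j) = p (m - j) := fun j hj => by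
    rcases j.eq_zero_or_pos with rfl | hj'
    · exact (s₀ n le_rfl).trans h₁.symm
    · exact (if_neg (by omega)).trans (congrArg p (by omega))
  have hback : Γ.IsWalk (fun j => p (m - j)) m := fun j hj => by
    have := Γ.symm _ _ (hp (m - (j + 1)) (by omega))
    rwa [show m - (j + 1) + 1 = m - j by omega] at this
  have hw : Γ.IsWalk w (m + m) := isWalk_add.2
    ⟨hp.congr fun i hi => (w₀ i hi).symm, hback.congr fun j hj => (w₁ j hj).symm⟩
  have hs : Γ.IsWalk s (n + m) := isWalk_add.2
    ⟨hr.congr fun i hi => (s₀ i hi).symm, hback.congr fun j hj => (s₁ j hj).symm⟩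
  have h₂ : entry (interp Γ lam t (coevN m)) p w ≠ 0 := by
    refine entry_coevN_ne_zero hlam m hw (fun i hi => ?_) (w₀ 0 (by omega)).symm
    rcases le_total i m with h' | h'
    · obtain ⟨j, rfl⟩ := Nat.exists_eq_add_of_le h'
      rw [w₀ i h', show i + j + (i + j) - i = i + j + j by omega, w₁ j (by omega)]
      exact congrArg p (by omega)
    · obtain ⟨j, rfl⟩ := Nat.exists_eq_add_of_le h'
      rw [w₁ j (by omega), w₀ _ (by omega)]
      exact congrArg p (by omega)
  have h₃ := congrArg (fun g => entry g p s) h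
  simp only [entry_zero] at h₃
  rw [entry_compMap_single w _ _ isWalk_zero hs, mul_eq_zero, or_iff_right h₂, entry_tensorMap,
    entry_castMap_self _ (isWalk_add.1 hw).2, mul_one] at h₃
  · rw [← h₃]
    exact entry_congr f (fun i hi => (w₀ i hi).symm) fun i hi => (s₀ i hi).symm
  · exact fun j hj => (w₁ j hj).trans (s₁ j hj).symm
  · intro z _ h₄ h₅ i hi
    have e₁ := palindrome_of_entry_coevN_ne_zero m h₄
    have e₂ : ∀ j ≤ m, z (m + j) = p (m - j) := fun j hj =>
      (eq_of_entry_castMap_ne_zero _ (ne_zero_of_entry_tensorMap_ne_zero h₅).2 j hj).trans (s₁ j hj)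
    rcases le_total i m with h' | h'
    · obtain ⟨j, rfl⟩ := Nat.exists_eq_add_of_le h'
      rw [w₀ i h', e₁ i hi, show i + j + (i + j) - i = i + j + j by omega, e₂ j (by omega)]
      exact congrArg p (by omega)
    · obtain ⟨j, rfl⟩ := Nat.exists_eq_add_of_le h'
      rw [w₁ j (by omega), e₂ j (by omega)]

/-- Positivity: a morphism whose composite with its reflection has trace zero is interpreted by
zero. -/
theorem interp_eq_zero_of_trace (hlam : ∀ v, 0 < lam v) (ht : IsCellFunction Γ t) {m n : ℕ}
    {d : Diagram m n} (h : interp Γ lam t (trace (comp d (dagger d))) = 0) :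
    interp Γ lam t d = 0 := by
  refine eq_zero_of_coevN_compMap (t := t) hlam (eq_zero_of_compMap_adjoint ?_)
  have e₁ : interp Γ lam t (evN m) = adjoint (interp Γ lam t (coevN m)) := by
    rw [← dagger_coevN, interp_dagger hlam ht]
  have e₂ : adjoint (tensorMap (interp Γ lam t d) (castMap rfl : Γ.HomSpace m m)) =
      tensorMap (interp Γ lam t (dagger d)) (castMap rfl) := by
    rw [interp_dagger hlam ht]
    exact ((interp_dagger hlam ht (tensor d (one m))).symm.trans
      (congrArg (tensorMap · _) (interp_dagger hlam ht d)))
  rw [adjoint_compMap, e₂, ← e₁, compMap_assoc, ← compMap_assoc (tensorMap _ _), interchange,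
    comp_id']
  exact h

end GPA

/-! ### The semisimple quotient -/

namespace GPA
open LoopGraph Diagram

variable {V : Type} {Γ : LoopGraph V} [Finite V] {lam : V → ℝ} {t : V → V → V → ℝ} {q : ℂ}

section
variable (hlam : ∀ v, 0 < lam v) (ht : IsCellFunction Γ t)
  (hG : ∀ {m n : ℕ} {f g : Diagram m n}, G2Rel q m n f g → interp Γ lam t f = interp Γ lam t g)
include hlam hG

theorem interp_eq_of_cong_G2Rel {m n : ℕ} {f g : Diagram m n} (h : Cong (G2Rel q) f g) :
    interp Γ lam t f = interp Γ lam t g :=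
  realize_eq_of_cong (zigzag_left hlam) (zigzag_right hlam) hG h

include ht

/-- An interpretation of the `G₂` skein category factors through its semisimple quotient. -/
theorem interp_eq_of_cong_G2BarRel {m n : ℕ} {f g : Diagram m n} (h : Cong (G2BarRel q) f g) :
    interp Γ lam t f = interp Γ lam t g :=
  realize_eq_of_cong (zigzag_left hlam) (zigzag_right hlam) (fun h => by
    cases h with
    | skein h => exact hG h
    | negligible h =>
      exact interp_eq_zero_of_trace hlam ht (interp_eq_of_cong_G2Rel hlam hG (h _))) h

omit ht in
/-- A diagram interpreted by zero is negligible: its traces are multiples of the empty diagram, and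
the empty diagram is not interpreted by zero. -/
theorem negligible_of_interp_eq_zero [Nonempty V] {m n : ℕ} {d : Diagram m n}
    (h : interp Γ lam t d = 0) : Negligible (G2Rel q) d := fun g => by
  obtain ⟨z, hz⟩ := SkeinCat.exists_cong_smul_one (q := q) (trace (comp d g))
  have e₁ : interp Γ lam t (trace (comp d g)) = 0 := by
    refine (congrArg (fun x => compMap (interp Γ lam t (coevN m)) (compMap (tensorMap
      (compMap x (interp Γ lam t g)) (castMap rfl)) (interp Γ lam t (evN m)))) h).trans ?_
    rw [zero_compMap, zero_tensorMap, zero_compMap, compMap_zero]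
  have e₂ := (interp_eq_of_cong_G2Rel hlam hG hz).symm.trans e₁
  obtain ⟨v⟩ := ‹Nonempty V›
  have e₃ : z * entry (castMap rfl : Γ.HomSpace 0 0) (fun _ => v) (fun _ => v) = 0 := by
    rw [← entry_smul, ← entry_zero (Γ := Γ) (a := 0) (b := 0) (fun _ => v) (fun _ => v)]
    exact congrArg (fun f : Γ.HomSpace 0 0 => entry f (fun _ => v) (fun _ => v)) e₂
  rw [entry_castMap_self _ isWalk_zero fun _ _ => rfl, mul_one] at e₃
  rw [e₃] at hz
  exact hz.trans (Cong.zero_smul _)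

theorem faithful_realizeFunctor [Nonempty V] :
    (realizeFunctor (interp_eq_of_cong_G2BarRel hlam ht hG)).Faithful where
  map_injective {X Y} f g h := by
    have h' : (realizeFunctor (interp_eq_of_cong_G2BarRel hlam ht hG)).map (f - g) = 0 := by
      rw [Functor.map_sub, h, sub_self]
    rw [← sub_eq_zero]
    generalize f - g = k at h'
    induction k using Quotient.inductionOn with
    | h d =>
      exact SkeinCat.sound (Cong.rel (G2BarRel.negligible (negligible_of_interp_eq_zero hlam hG h')))

end

end GPA

/-! ### Exact real arithmetic -/

/-- A ring of exactly represented real numbers with a sound test for zero. -/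
class RealCode (R : Type) [Add R] [Mul R] where
  value : R → ℝ
  value_add : ∀ x y, value (x + y) = value x + value y
  value_mul : ∀ x y, value (x * y) = value x * value y
  isZero : R → Bool
  value_eq_zero : ∀ x, isZero x = true → value x = 0

/-- The ring `ℤ[√2, √3]`: `⟨a, b, c, d⟩` stands for `a + b√2 + c√3 + d√6`. -/
structure BiquadInt where
  a : ℤ
  b : ℤ
  c : ℤ
  d : ℤ
  deriving DecidableEq

namespace BiquadInt
open RealCode

instance : Add BiquadInt := ⟨fun x y => ⟨x.a + y.a, x.b + y.b, x.c + y.c, x.d + y.d⟩⟩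

instance : Mul BiquadInt := ⟨fun x y =>
  ⟨x.a * y.a + 2 * (x.b * y.b) + 3 * (x.c * y.c) + 6 * (x.d * y.d),
   x.a * y.b + x.b * y.a + 3 * (x.c * y.d + x.d * y.c),
   x.a * y.c + x.c * y.a + 2 * (x.b * y.d + x.d * y.b),
   x.a * y.d + x.d * y.a + x.b * y.c + x.c * y.b⟩⟩

noncomputable instance : RealCode BiquadInt where
  value x := x.a + x.b * √2 + x.c * √3 + x.d * (√2 * √3)
  value_add x y := by
    change ((x.a + y.a : ℤ) : ℝ) + ((x.b + y.b : ℤ) : ℝ) * √2 + ((x.c + y.c : ℤ) : ℝ) * √3 +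
      ((x.d + y.d : ℤ) : ℝ) * (√2 * √3) = _
    push_cast
    ring
  value_mul x y := by
    have h₂ : √2 * √2 = (2 : ℝ) := Real.mul_self_sqrt (by norm_num)
    have h₃ : √3 * √3 = (3 : ℝ) := Real.mul_self_sqrt (by norm_num)
    change ((x.a * y.a + 2 * (x.b * y.b) + 3 * (x.c * y.c) + 6 * (x.d * y.d) : ℤ) : ℝ) +
      ((x.a * y.b + x.b * y.a + 3 * (x.c * y.d + x.d * y.c) : ℤ) : ℝ) * √2 +
      ((x.a * y.c + x.c * y.a + 2 * (x.b * y.d + x.d * y.b) : ℤ) : ℝ) * √3 +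
      ((x.a * y.d + x.d * y.a + x.b * y.c + x.c * y.b : ℤ) : ℝ) * (√2 * √3) = _
    push_cast
    linear_combination (-(x.b * y.b : ℝ) - (x.b * y.d + x.d * y.b) * √3 -
      x.d * y.d * (√3 * √3)) * h₂ + (-(x.c * y.c : ℝ) - (x.c * y.d + x.d * y.c) * √2 -
      2 * (x.d * y.d)) * h₃
  isZero x := x.a == 0 && x.b == 0 && x.c == 0 && x.d == 0
  value_eq_zero x h := by
    simp only [Bool.and_eq_true, beq_iff_eq] at h
    simp [h.1.1.1, h.1.1.2, h.1.2, h.2]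

theorem value_def (x : BiquadInt) : value x = x.a + x.b * √2 + x.c * √3 + x.d * (√2 * √3) := rfl

end BiquadInt

/-- Elements of the quadratic extension `R[√δ]`: `mix a b` stands for `a + b√δ`.  Zero and the
elements `even a` of `R` and `odd b` of `R√δ` have constructors of their own, so that products of
homogeneous elements are computed without spurious zero terms. -/
inductive QuadExt {R : Type} (δ : R) : Type
  | nil
  | even (a : R)
  | odd (b : R)
  | mix (a b : R)
  deriving DecidableEq

namespace QuadExt
open RealCode

variable {R : Type} {δ : R}

/-- Addition in a quadratic extension. -/
protected def add [Add R] : QuadExt δ → QuadExt δ → QuadExt δ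
  | nil, y => y
  | x, nil => x
  | even a, even c => even (a + c)
  | even a, odd d => mix a d
  | even a, mix c d => mix (a + c) d
  | odd b, even c => mix c b
  | odd b, odd d => odd (b + d)
  | odd b, mix c d => mix c (b + d)
  | mix a b, even c => mix (a + c) b
  | mix a b, odd d => mix a (b + d)
  | mix a b, mix c d => mix (a + c) (b + d)

instance [Add R] : Add (QuadExt δ) := ⟨QuadExt.add⟩

/-- Multiplication in a quadratic extension. -/
protected def mul [Add R] [Mul R] : QuadExt δ → QuadExt δ → QuadExt δ
  | nil, _ => nil
  | _, nil => nil
  | even a, even c => even (a * c)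
  | even a, odd d => odd (a * d)
  | even a, mix c d => mix (a * c) (a * d)
  | odd b, even c => odd (b * c)
  | odd b, odd d => even (δ * (b * d))
  | odd b, mix c d => mix (δ * (b * d)) (b * c)
  | mix a b, even c => mix (a * c) (b * c)
  | mix a b, odd d => mix (δ * (b * d)) (a * d)
  | mix a b, mix c d => mix (a * c + δ * (b * d)) (a * d + b * c)

instance [Add R] [Mul R] : Mul (QuadExt δ) := ⟨QuadExt.mul⟩

variable [Add R] [Mul R] [RealCode R]

/-- The real number represented by an element of a quadratic extension. -/
noncomputable def toReal : QuadExt δ → ℝ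
  | nil => 0
  | even a => value a
  | odd b => value b * √(value δ)
  | mix a b => value a + value b * √(value δ)

noncomputable instance [h : Fact (0 ≤ value δ)] : RealCode (QuadExt δ) where
  value := toReal
  value_add x y := by
    change toReal (QuadExt.add x y) = _
    cases x <;> cases y <;> simp only [QuadExt.add, toReal, value_add] <;> ring
  value_mul x y := by
    have hδ := Real.mul_self_sqrt h.out
    change toReal (QuadExt.mul x y) = _
    cases x <;> cases y <;> simp only [QuadExt.mul, toReal, value_add, value_mul] <;>
      first
      | ring1
      | (rename_i b d; linear_combination (-(value b * value d)) * hδ)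
      | (rename_i b c d; linear_combination (-(value b * value d)) * hδ)
  isZero
    | nil => true
    | even a => isZero a
    | odd b => isZero b
    | mix a b => isZero a && isZero b
  value_eq_zero x h := by
    cases x with
    | nil => rfl
    | even a => exact value_eq_zero a h
    | odd b => exact mul_eq_zero_of_left (value_eq_zero b h) _
    | mix a b =>
      obtain ⟨ha, hb⟩ := Bool.and_eq_true_iff.1 h
      change value a + value b * _ = 0
      rw [value_eq_zero a ha, value_eq_zero b hb, zero_mul, zero_add]

end QuadExt

instance : Fact (0 ≤ RealCode.value (⟨-2, 1, 0, 1⟩ : BiquadInt)) := ⟨by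
  rw [BiquadInt.value_def]
  have h : √2 * √2 = (2 : ℝ) := Real.mul_self_sqrt (by norm_num)
  have h₃ : √3 * √3 = (3 : ℝ) := Real.mul_self_sqrt (by norm_num)
  have : 1 ≤ √2 := Real.one_le_sqrt.2 (by norm_num)
  have : 1 ≤ √3 := Real.one_le_sqrt.2 (by norm_num)
  push_cast
  nlinarith⟩

/-- The extension of `ℤ[√2, √3]` by the square root of `-2 + √2 + √6`. -/
abbrev CodeG : Type := QuadExt (⟨-2, 1, 0, 1⟩ : BiquadInt)

instance : Fact (0 ≤ RealCode.value (QuadExt.even ⟨2, 3, 0, -1⟩ : CodeG)) := ⟨by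
  change 0 ≤ RealCode.value (⟨2, 3, 0, -1⟩ : BiquadInt)
  rw [BiquadInt.value_def]
  have h₃ : √3 ≤ 3 := (Real.sqrt_le_left (by norm_num)).2 (by norm_num)
  push_cast
  nlinarith [Real.sqrt_nonneg 2]⟩

/-- The extension of `CodeG` by the square root of `2 + 3√2 - √6`. -/
abbrev CodeA : Type := QuadExt (QuadExt.even ⟨2, 3, 0, -1⟩ : CodeG)

instance : Fact (0 ≤ RealCode.value (QuadExt.even (QuadExt.even ⟨0, 1, 2, 1⟩) : CodeA)) := ⟨by
  change 0 ≤ RealCode.value (⟨0, 1, 2, 1⟩ : BiquadInt)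
  rw [BiquadInt.value_def]
  push_cast
  positivity⟩

/-- The extension of `CodeA` by the square root of `√2 + 2√3 + √6`. -/
abbrev Code : Type := QuadExt (QuadExt.even (QuadExt.even ⟨0, 1, 2, 1⟩) : CodeA)

/-! ### The cell function on `Γ₄` -/

namespace Code
open RealCode
open QuadExt

/-- An element of `ℤ[√2, √3]` as an element of `Code`. -/
def ofBiquad (x : BiquadInt) : Code := even (even (even x))

/-- The function on `Fin 6` with the given values. -/
def tuple {α : Type} (a b c d e f : α) : Fin 6 → α
  | 0 => a | 1 => b | 2 => c | 3 => d | 4 => e | 5 => f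

/-- The values, times four, of the cell function at triangles `u, u, x`. -/
def cellDiag (u x : Fin 6) : Code :=
  let a₁ : Code := even (even (odd ⟨-2, -1, 0, -1⟩))
  let a₃ : Code := even (even (odd ⟨0, 0, 2, 0⟩))
  let a₅ : Code := even (even (odd ⟨2, 0, 0, 0⟩))
  let a₈ : Code := even (mix (odd ⟨0, -1, 0, 0⟩) (even ⟨0, 1, 0, 0⟩))
  let a₉ : Code := even (mix (odd ⟨0, -1, 0, 0⟩) (even ⟨0, -1, 0, 0⟩))
  tuple nil (tuple a₁ a₃ a₈ nil a₉ a₅ x) (tuple nil a₉ a₃ a₁ a₅ a₈ x) nil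
    (tuple nil a₈ a₅ a₁ a₃ a₉ x) (tuple a₁ a₅ a₉ nil a₈ a₃ x) u

/-- The values, times four, of the cell function at triangles with three different vertices.  A set
of vertices is encoded by the sum of the corresponding powers of two, which makes the values
symmetric. -/
def cellDist (u v w : Fin 6) : Code :=
  match 2 ^ u.1 + 2 ^ v.1 + 2 ^ w.1 with
  | 35 => even (even (odd ⟨2, -1, 0, 1⟩))
  | 28 => even (even (odd ⟨2, -1, 0, 1⟩))
  | 22 => odd (even (even ⟨2, 0, 0, 0⟩))
  | 38 => odd (even (even ⟨2, 0, 0, 0⟩))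
  | 50 => odd (even (even ⟨2, 0, 0, 0⟩))
  | 52 => odd (even (even ⟨-2, 0, 0, 0⟩))
  | _ => nil

/-- The values, times four, of the cell function. -/
def cell (u v w : Fin 6) : Code :=
  if u = v then cellDiag u w else if v = w then cellDiag v u else
    if u = w then cellDiag u v else cellDist u v w

/-- The Frobenius-Perron eigenvector: `√6 - 2` at the two vertices without a loop, and `1` at the
other vertices. -/
def weight : Fin 6 → Code :=
  tuple (ofBiquad ⟨-2, 0, 0, 1⟩) (ofBiquad ⟨1, 0, 0, 0⟩) (ofBiquad ⟨1, 0, 0, 0⟩)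
    (ofBiquad ⟨-2, 0, 0, 1⟩) (ofBiquad ⟨1, 0, 0, 0⟩) (ofBiquad ⟨1, 0, 0, 0⟩)

/-- Twice the inverses of the weights. -/
def weightInv : Fin 6 → Code :=
  tuple (ofBiquad ⟨2, 0, 0, 1⟩) (ofBiquad ⟨2, 0, 0, 0⟩) (ofBiquad ⟨2, 0, 0, 0⟩)
    (ofBiquad ⟨2, 0, 0, 1⟩) (ofBiquad ⟨2, 0, 0, 0⟩) (ofBiquad ⟨2, 0, 0, 0⟩)

/-- The adjacency relation of `Γ₄`, read off from the binary digits of a number for each vertex. -/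
def adj (u v : Fin 6) : Bool := (tuple 34 55 62 20 62 55 u : ℕ).testBit v.1

/-- The sum of the six values of a function. -/
noncomputable def sum (f : Fin 6 → Code) : Code := f 0 + (f 1 + (f 2 + (f 3 + (f 4 + f 5))))

/-- Twice the Kronecker delta of `u` and `v`, divided by the weight of `w`. -/
noncomputable def arc (u v w : Fin 6) : Code := if u = v then weightInv w else nil

/-! ### Verification of the polygon identities -/

theorem adj_iff : ∀ u v, Γ₄.Adj u v ↔ adj u v = true := by
  change ∀ u v, s(u, v) ∈ ({s(1, 1), s(2, 2), s(4, 4), s(5, 5), s(0, 1), s(0, 5), s(1, 2), s(1, 4),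
    s(1, 5), s(2, 3), s(2, 4), s(2, 5), s(3, 4), s(4, 5)} : Finset (Sym2 (Fin 6))) ↔ adj u v = true
  decide +kernel

theorem cell_swap_left : ∀ u v w, cell u v w = cell v u w := by decide +kernel

theorem cell_swap_right : ∀ u v w, cell u v w = cell u w v := by decide +kernel

theorem cell_eq_nil : ∀ u v w, ¬ adj u v = true → cell u v w = nil := by decide +kernel

/-- The polygon identities are evaluated with all terms on one side.  As `cell` is four times the
cell function, and `arc` carries a factor of two, the identity for a `k`-gon is multiplied by `4 ^ k`
and its coefficients are adjusted accordingly. -/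
theorem loop : ∀ u, isZero ((sum fun x => if adj u x = true then weight x else nil) +
    ofBiquad ⟨-2, 0, 0, -1⟩ * weight u) = true := by decide +kernel

theorem lollipop : ∀ u, isZero (sum fun x => weight x * cell u u x) = true := by decide +kernel

theorem bigon : ∀ u v, adj u v = true → isZero ((sum fun x => weight x * (cell u v x * cell v u x)) +
    ofBiquad ⟨0, -24, -16, -8⟩) = true := by decide +kernel

theorem trigon : ∀ u v, adj u v = true → ∀ w, adj v w = true → adj w u = true →
    isZero ((sum fun x => weight x * (cell u v x * (cell v w x * cell w u x))) +
      ofBiquad ⟨16, 0, 16, 0⟩ * cell u v w) = true := by decide +kernel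

set_option maxRecDepth 100000 in
theorem tetragon : ∀ a b : Fin 6, adj a b = true → ∀ c, adj b c = true → ∀ d, adj c d = true →
    adj d a = true →
    isZero ((sum fun x => weight x * (cell a b x * (cell b c x * (cell c d x * cell d a x)))) +
      (ofBiquad ⟨0, -8, 0, -8⟩ * (cell a c d * cell a b c + cell d b c * cell d a b) +
        ofBiquad ⟨-128, -64, 0, -64⟩ * (arc c a a + arc b d d))) = true := by decide +kernel

set_option maxRecDepth 100000 in
/-- The pentagon identity at closed paths that start at their minimum and then go on to the smaller of its
neighbours; every orbit under rotation and reflection contains such a path. -/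
theorem pentagon : ∀ a b : Fin 6, a ≤ b → adj a b = true → ∀ c, a ≤ c → adj b c = true →
    ∀ d, a ≤ d → adj c d = true → ∀ e, a ≤ e → b ≤ e → adj d e = true → adj e a = true →
    isZero ((sum fun x => weight x * (cell a b x * (cell b c x * (cell c d x *
        (cell d e x * cell e a x))))) +
      (ofBiquad ⟨16, 0, 0, 0⟩ * (cell a d e * (cell a c d * cell a b c) +
        (cell e c d * (cell e b c * cell e a b) + (cell d b c * (cell d a b * cell d e a) +
        (cell c a b * (cell c e a * cell c d e) + cell b e a * (cell b d e * cell b c d))))) +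
      ofBiquad ⟨128, 0, 0, 0⟩ * (arc d a a * cell a b c + (arc c e e * cell e a b +
        (arc b d d * cell d e a + (arc a c c * cell c d e + arc e b b * cell b c d)))))) = true := by
  decide +kernel

theorem value_ofBiquad (x : BiquadInt) : value (ofBiquad x) =
    x.a + x.b * √2 + x.c * √3 + x.d * (√2 * √3) := rfl

theorem value_nil : value (nil : Code) = 0 := rfl

theorem value_sum (f : Fin 6 → Code) : value (sum f) = ∑ x, value (f x) := by
  simp only [sum, value_add, Fin.sum_univ_six]
  ring

/-- The entries of the normalized Frobenius-Perron eigenvector. -/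
noncomputable def weightValue (u : Fin 6) : ℝ := value (weight u)

/-- The values of the cell function. -/
noncomputable def cellValue (u v w : Fin 6) : ℝ := value (cell u v w) / 4

theorem value_cell (u v w : Fin 6) : value (cell u v w) = 4 * cellValue u v w := by
  rw [cellValue]; ring

theorem weightValue_eq (u : Fin 6) : weightValue u = if u = 0 ∨ u = 3 then √2 * √3 - 2 else 1 := by
  fin_cases u <;> simp [weightValue, weight, tuple, value_ofBiquad] <;> ring

theorem two_lt_sqrt_two_mul_sqrt_three : 2 < √2 * √3 := by
  rw [← Real.sqrt_mul (by norm_num)]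
  exact Real.lt_sqrt_of_sq_lt (by norm_num)

theorem weightValue_pos (u : Fin 6) : 0 < weightValue u := by
  rw [weightValue_eq]
  have := two_lt_sqrt_two_mul_sqrt_three
  split_ifs
  · linarith
  · exact one_pos

theorem value_weightInv (u : Fin 6) : value (weightInv u) = 2 / weightValue u := by
  rw [eq_div_iff (weightValue_pos u).ne']
  have h₂ : √2 * √2 = (2 : ℝ) := Real.mul_self_sqrt (by norm_num)
  have h₃ : √3 * √3 = (3 : ℝ) := Real.mul_self_sqrt (by norm_num)
  fin_cases u <;> simp [weightValue, weight, weightInv, tuple, value_ofBiquad]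
  all_goals linear_combination (√3 * √3) * h₂ + 2 * h₃

theorem value_arc (u v w : Fin 6) :
    value (arc u v w) = 2 * (GPA.kronecker u v / weightValue w) := by
  rw [arc, GPA.kronecker]
  split_ifs with h
  · rw [value_weightInv]; ring
  · rw [value_nil]; simp

theorem isCellFunction_cellValue : GPA.IsCellFunction Γ₄ cellValue where
  swap_left u v w := by rw [cellValue, cell_swap_left]; rfl
  swap_right u v w := by rw [cellValue, cell_swap_right]; rfl
  eq_zero u v w h := by
    rw [adj_iff] at h
    rw [cellValue, cell_eq_nil u v w h, value_nil, zero_div]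

/-- A property of closed paths of length five that is invariant under rotation and reflection may be
checked on those that start at their minimum and then go on to the smaller of its neighbours. -/
theorem closed_path_induction {P : Fin 6 → Fin 6 → Fin 6 → Fin 6 → Fin 6 → Prop}
    (hrot : ∀ a b c d e, P b c d e a → P a b c d e) (hrefl : ∀ a b c d e, P a e d c b → P a b c d e)
    (h : ∀ a b c d e, a ≤ b → a ≤ c → a ≤ d → a ≤ e → b ≤ e → P a b c d e) (a b c d e : Fin 6) :
    P a b c d e := by
  have h' : ∀ a b c d e, a ≤ b → a ≤ c → a ≤ d → a ≤ e → P a b c d e := fun a b c d e h₁ h₂ h₃ h₄ =>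
    (le_total b e).elim (h a b c d e h₁ h₂ h₃ h₄) fun h₅ =>
      hrefl _ _ _ _ _ (h a e d c b h₄ h₃ h₂ h₁ h₅)
  have : (a ≤ b ∧ a ≤ c ∧ a ≤ d ∧ a ≤ e) ∨ (b ≤ c ∧ b ≤ d ∧ b ≤ e ∧ b ≤ a) ∨
      (c ≤ d ∧ c ≤ e ∧ c ≤ a ∧ c ≤ b) ∨ (d ≤ e ∧ d ≤ a ∧ d ≤ b ∧ d ≤ c) ∨
      (e ≤ a ∧ e ≤ b ∧ e ≤ c ∧ e ≤ d) := by grind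
  rcases this with h₁ | h₁ | h₁ | h₁ | h₁
  · exact h' _ _ _ _ _ h₁.1 h₁.2.1 h₁.2.2.1 h₁.2.2.2
  · exact hrot _ _ _ _ _ (h' _ _ _ _ _ h₁.1 h₁.2.1 h₁.2.2.1 h₁.2.2.2)
  · exact hrot _ _ _ _ _ (hrot _ _ _ _ _ (h' _ _ _ _ _ h₁.1 h₁.2.1 h₁.2.2.1 h₁.2.2.2))
  · exact hrot _ _ _ _ _ (hrot _ _ _ _ _ (hrot _ _ _ _ _
      (h' _ _ _ _ _ h₁.1 h₁.2.1 h₁.2.2.1 h₁.2.2.2)))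
  · exact hrot _ _ _ _ _ (hrot _ _ _ _ _ (hrot _ _ _ _ _ (hrot _ _ _ _ _
      (h' _ _ _ _ _ h₁.1 h₁.2.1 h₁.2.2.1 h₁.2.2.2))))

theorem satisfiesPolygonIdentities : GPA.SatisfiesPolygonIdentities Γ₄ weightValue cellValue
    (2 + √2 * √3) ((√2 * √3 + √2) / 2 + √3 + √2) (-(1 + √3)) ((√2 * √3 + √2) / 2)
    (1 + (√2 * √3 + √2) / 2) := by
  have hw : ∀ u, value (weight u) = weightValue u := fun _ => rfl
  have hc := isCellFunction_cellValue
  have hk : ∀ u v x y, GPA.kronecker u v * (cellValue v x y / weightValue v) =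
      GPA.kronecker v u * (cellValue u y x / weightValue u) := fun u v x y => by
    by_cases h : u = v
    · rw [h, hc.swap_right]
    · rw [GPA.kronecker, if_neg h, GPA.kronecker, if_neg (Ne.symm h), zero_mul, zero_mul]
  refine ⟨fun u => ?_, fun u _ => ?_, fun u v h => ?_, fun a b c h₁ h₂ h₃ => ?_,
    fun a b c d h₁ h₂ h₃ h₄ => ?_, ?_⟩
  · have h := value_eq_zero _ (loop u)
    have e : ∀ w, value (if adj u w = true then weight w else nil) =
        Γ₄.adjMatrix u w * weightValue w := fun w => by
      by_cases hw : adj u w = true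
      · rw [if_pos hw, LoopGraph.adjMatrix, if_pos ((adj_iff u w).2 hw), one_mul]; rfl
      · rw [if_neg hw, LoopGraph.adjMatrix, if_neg fun h => hw ((adj_iff u w).1 h), zero_mul]; rfl
    simp only [value_add, value_mul, value_sum, e, value_ofBiquad, hw] at h
    push_cast at h
    linear_combination h
  · have h := value_eq_zero _ (lollipop u)
    simp only [value_mul, value_sum, value_cell, hw, mul_left_comm _ (4 : ℝ), ← Finset.mul_sum] at h
    linear_combination h / 4
  · have h := value_eq_zero _ (bigon u v ((adj_iff _ _).1 h))
    simp only [value_add, value_mul, value_sum, value_cell, hw, value_ofBiquad, mul_left_comm _ (4 : ℝ),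
      mul_assoc (4 : ℝ), ← Finset.mul_sum] at h
    push_cast at h
    linear_combination h / 16
  · have h := value_eq_zero _ (trigon a b ((adj_iff _ _).1 h₁) c ((adj_iff _ _).1 h₂)
      ((adj_iff _ _).1 h₃))
    simp only [value_add, value_mul, value_sum, value_cell, hw, value_ofBiquad, mul_left_comm _ (4 : ℝ),
      mul_assoc (4 : ℝ), ← Finset.mul_sum] at h
    push_cast at h
    simp only [mul_assoc]
    linear_combination h / 64
  · have h := value_eq_zero _ (tetragon a b ((adj_iff _ _).1 h₁) c ((adj_iff _ _).1 h₂) d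
      ((adj_iff _ _).1 h₃) ((adj_iff _ _).1 h₄))
    simp only [value_add, value_mul, value_sum, value_cell, value_arc, hw, value_ofBiquad,
      mul_left_comm _ (4 : ℝ), mul_assoc (4 : ℝ), ← Finset.mul_sum] at h
    push_cast at h
    simp only [mul_assoc]
    linear_combination h / 256
  · refine closed_path_induction (fun a b c d e h h₁ h₂ h₃ h₄ h₅ => ?_)
      (fun a b c d e h h₁ h₂ h₃ h₄ h₅ => ?_)
      fun a b c d e k₁ k₂ k₃ k₄ k₅ h₁ h₂ h₃ h₄ h₅ => ?_
    · have e : ∑ w, weightValue w * (cellValue b c w * cellValue c d w * cellValue d e w *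
          cellValue e a w * cellValue a b w) = ∑ w, weightValue w * (cellValue a b w *
          cellValue b c w * cellValue c d w * cellValue d e w * cellValue e a w) :=
        Finset.sum_congr rfl fun _ _ => by ring
      linear_combination h h₂ h₃ h₄ h₅ h₁ - e
    · have hs : ∑ w, weightValue w * (cellValue a e w * cellValue e d w * cellValue d c w *
          cellValue c b w * cellValue b a w) = ∑ w, weightValue w * (cellValue a b w *
          cellValue b c w * cellValue c d w * cellValue d e w * cellValue e a w) :=
        Finset.sum_congr rfl fun _ _ => by
          rw [hc.swap_left a e, hc.swap_left e d, hc.swap_left d c, hc.swap_left c b,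
            hc.swap_left b a]
          ring
      have h' := h (Γ₄.symm _ _ h₅) (Γ₄.symm _ _ h₄) (Γ₄.symm _ _ h₃) (Γ₄.symm _ _ h₂)
        (Γ₄.symm _ _ h₁)
      rw [hs] at h'
      rw [hk d a, hk c e, hk b d, hk a c, hk e b]
      simp only [hc.swap_right a c b, hc.swap_right a d c, hc.swap_right a e d,
        hc.swap_right b d c, hc.swap_right b e d, hc.swap_right b a e, hc.swap_right c e d,
        hc.swap_right c a e, hc.swap_right c b a, hc.swap_right d a e, hc.swap_right d b a,
        hc.swap_right d c b, hc.swap_right e b a, hc.swap_right e c b, hc.swap_right e d c] at h' ⊢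
      linear_combination h'
    · have h := value_eq_zero _ (pentagon a b k₁ ((adj_iff _ _).1 h₁) c k₂ ((adj_iff _ _).1 h₂) d k₃
        ((adj_iff _ _).1 h₃) e k₄ k₅ ((adj_iff _ _).1 h₄) ((adj_iff _ _).1 h₅))
      simp only [value_add, value_mul, value_sum, value_cell, value_arc, hw, value_ofBiquad,
        mul_left_comm _ (4 : ℝ), mul_assoc (4 : ℝ), ← Finset.mul_sum] at h
      push_cast at h
      simp only [mul_assoc]
      linear_combination h / 1024

/-! ### The eigenvector, the root of unity and the coordinates -/

/-- Every Frobenius-Perron eigenvector is a multiple of the normalized one. -/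
theorem exists_eq_mul_weightValue {lam : Fin 6 → ℝ} (h : Γ₄.IsFrobeniusPerron lam) :
    ∃ κ, 0 < κ ∧ ∀ v, lam v = κ * weightValue v := by
  obtain ⟨hpos, d, hd⟩ := h
  have hA : ∀ u v, Γ₄.adjMatrix u v = if adj u v = true then 1 else 0 := fun u v => by
    simp only [LoopGraph.adjMatrix, adj_iff]
  have e : ∀ u, ∑ v, (if adj u v = true then (1 : ℝ) else 0) * lam v = d * lam u := fun u => by
    have := congrFun hd u
    simpa only [Matrix.mulVec, dotProduct, hA, Pi.smul_apply, smul_eq_mul] using this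
  have e₀ := e 0
  have e₁ := e 1
  have e₂ := e 2
  have e₃ := e 3
  have e₄ := e 4
  have e₅ := e 5
  simp [Fin.sum_univ_six, adj, tuple, Nat.testBit, Nat.shiftRight_eq_div_pow] at e₀ e₁ e₂ e₃ e₄ e₅
  have p₀ := hpos 0
  have p₁ := hpos 1
  have p₂ := hpos 2
  have p₃ := hpos 3
  have p₄ := hpos 4
  have p₅ := hpos 5
  have hd : d ≠ 0 := by
    rintro rfl
    linarith
  have h₁ : lam 5 = lam 1 := mul_left_cancel₀ hd (by linarith)
  have h₂ : lam 4 = lam 2 := mul_left_cancel₀ hd (by linarith)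
  rw [h₁, h₂] at e₁ e₂
  rw [h₁] at e₀
  rw [h₂] at e₃
  have hd₂ : 2 < d := by
    by_contra h'
    nlinarith
  -- The reflection-odd part of an eigenvector has eigenvalue `d` with `d ^ 2 = 2`.
  have h₃ : lam 2 = lam 1 := by
    have : (2 - d ^ 2) * (lam 1 - lam 2) = 0 := by linear_combination e₀ - e₃ + d * e₁ - d * e₂
    rcases mul_eq_zero.1 this with h' | h'
    · nlinarith
    · linarith
  have h₄ : lam 3 = lam 0 := by
    rw [h₃] at e₂
    linarith
  have h₅ : lam 0 = lam 1 * (√2 * √3 - 2) := by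
    have h₂ : √2 * √2 = (2 : ℝ) := Real.mul_self_sqrt (by norm_num)
    have h₃' : √3 * √3 = (3 : ℝ) := Real.mul_self_sqrt (by norm_num)
    have e₆ : lam 0 * lam 0 + 4 * (lam 0 * lam 1) - 2 * (lam 1 * lam 1) = 0 := by
      rw [h₃] at e₁
      linear_combination lam 0 * e₁ - lam 1 * e₀
    have : (lam 0 - lam 1 * (√2 * √3 - 2)) * (lam 0 + lam 1 * (√2 * √3 + 2)) = 0 := by
      linear_combination e₆ - lam 1 * lam 1 * (√3 * √3 * h₂ + 2 * h₃')
    rcases mul_eq_zero.1 this with h' | h'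
    · linarith
    · have : 0 < lam 1 * (√2 * √3 + 2) := by positivity
      linarith
  refine ⟨lam 1, p₁, fun v => ?_⟩
  fin_cases v <;> simp [weightValue_eq, h₁, h₂, h₃, h₄, h₅]

theorem q₄_zpow_add (k : ℤ) :
    q₄ ^ k + q₄ ^ (-k) = ((2 * Real.cos (k * (Real.pi / 24)) : ℝ) : ℂ) := by
  rw [q₄, ← Complex.exp_int_mul, ← Complex.exp_int_mul]
  push_cast
  rw [Complex.two_cos]
  congr 2 <;> ring

theorem sqrt_six : √6 = √2 * √3 := by
  rw [← Real.sqrt_mul (by norm_num)]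
  norm_num

theorem two_cos_two : q₄ ^ (2 : ℤ) + q₄ ^ (-2 : ℤ) = (((√2 * √3 + √2) / 2 : ℝ) : ℂ) := by
  rw [q₄_zpow_add]
  congr 1
  rw [show ((2 : ℤ) : ℝ) * (Real.pi / 24) = Real.pi / 3 - Real.pi / 4 by push_cast; ring,
    Real.cos_sub, Real.cos_pi_div_three, Real.cos_pi_div_four, Real.sin_pi_div_three,
    Real.sin_pi_div_four]
  ring

theorem two_cos_four : q₄ ^ (4 : ℤ) + q₄ ^ (-4 : ℤ) = ((√3 : ℝ) : ℂ) := by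
  rw [q₄_zpow_add]
  congr 1
  rw [show ((4 : ℤ) : ℝ) * (Real.pi / 24) = Real.pi / 6 by push_cast; ring, Real.cos_pi_div_six]
  ring

theorem two_cos_six : q₄ ^ (6 : ℤ) + q₄ ^ (-6 : ℤ) = ((√2 : ℝ) : ℂ) := by
  rw [q₄_zpow_add]
  congr 1
  rw [show ((6 : ℤ) : ℝ) * (Real.pi / 24) = Real.pi / 4 by push_cast; ring, Real.cos_pi_div_four]
  ring

theorem two_cos_eight : q₄ ^ (8 : ℤ) + q₄ ^ (-8 : ℤ) = ((1 : ℝ) : ℂ) := by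
  rw [q₄_zpow_add]
  congr 1
  rw [show ((8 : ℤ) : ℝ) * (Real.pi / 24) = Real.pi / 3 by push_cast; ring, Real.cos_pi_div_three]
  norm_num

theorem two_cos_ten : q₄ ^ (10 : ℤ) + q₄ ^ (-10 : ℤ) = (((√2 * √3 - √2) / 2 : ℝ) : ℂ) := by
  rw [q₄_zpow_add]
  congr 1
  rw [show ((10 : ℤ) : ℝ) * (Real.pi / 24) = Real.pi / 6 + Real.pi / 4 by push_cast; ring,
    Real.cos_add, Real.cos_pi_div_six, Real.cos_pi_div_four, Real.sin_pi_div_six,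
    Real.sin_pi_div_four]
  ring

/-- The relations of the `G₂` skein theory at `q₄` hold in the graph planar algebra of `Γ₄`. -/
theorem interp_eq {m n : ℕ} {f g : Diagram m n} (h : G2Rel q₄ m n f g) :
    GPA.interp Γ₄ weightValue cellValue f = GPA.interp Γ₄ weightValue cellValue g := by
  refine GPA.interp_eq_of_G2Rel weightValue_pos isCellFunction_cellValue satisfiesPolygonIdentities
    ?_ ?_ ?_ two_cos_two ?_ h
  · have h₁ := two_cos_two
    have h₂ := two_cos_eight
    have h₃ := two_cos_ten
    push_cast at h₁ h₂ h₃ ⊢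
    linear_combination h₁ + h₂ + h₃
  · have h₁ := two_cos_two
    have h₂ := two_cos_four
    have h₃ := two_cos_six
    simp only [quantumInt, Finset.sum_range_succ, Finset.sum_range_zero]
    norm_num
    norm_num at h₁ h₂ h₃
    linear_combination h₁ + h₂ + h₃
  · have h₁ := two_cos_four
    push_cast
    linear_combination -h₁
  · have h₁ := two_cos_two
    push_cast at h₁ ⊢
    linear_combination h₁

/-- Four times the absolute values of the coordinates of the trivalent vertex; at the indices `3`
and `6`, without the factor `√(weightValue 0)`. -/
def alphaCode : Fin 9 → Code := ![even (even (odd ⟨2, 1, 0, 1⟩)), even (even (odd ⟨2, -1, 0, 1⟩)),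
  even (even (odd ⟨0, 0, 2, 0⟩)), even (even (odd ⟨2, 1, 0, 1⟩)), even (even (odd ⟨2, 0, 0, 0⟩)),
  odd (even (even ⟨2, 0, 0, 0⟩)), even (even (odd ⟨2, -1, 0, 1⟩)),
  even (mix (odd ⟨0, -1, 0, 0⟩) (even ⟨0, 1, 0, 0⟩)), even (mix (odd ⟨0, 1, 0, 0⟩) (even ⟨0, 1, 0, 0⟩))]

/-- Every cell is, up to sign, the one of some `alphaCode i`, with an index that matches the factor
`√(weightValue v)` in the coordinates of the trivalent vertex. -/
theorem exists_cell_eq : ∀ u v w, adj u v = true → adj v w = true → adj u w = true → ∃ i,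
    ((v = 0 ∨ v = 3) ↔ (i = 3 ∨ i = 6)) ∧
      (cell u v w = alphaCode i ∨ cell u v w = ofBiquad ⟨-1, 0, 0, 0⟩ * alphaCode i) := by
  decide +kernel

/-- Every `alphaCode i` occurs, up to sign, as a cell. -/
theorem exists_alphaCode_eq : ∀ i, ∃ u v w, adj u v = true ∧ adj v w = true ∧ adj u w = true ∧
    ((v = 0 ∨ v = 3) ↔ (i = 3 ∨ i = 6)) ∧
      (cell u v w = alphaCode i ∨ cell u v w = ofBiquad ⟨-1, 0, 0, 0⟩ * alphaCode i) := by
  decide +kernel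

theorem sqrt_eq_of_mul_self_eq {x y : ℝ} (hy : 0 ≤ y) (h : y * y = x) : √x = y := by
  rw [← h, Real.sqrt_mul_self hy]

/-- The nested radicals of the statement, written with the three square roots that generate the tower
of quadratic extensions (`G`, `A`, `B` in the proof) and the square root `W` of `weightValue 0`.  The
radicals are evaluated by squaring. -/
theorem α₄_eq (i : Fin 9) : α₄ i = value (alphaCode i) / 4 *
    √(if i = 3 ∨ i = 6 then √2 * √3 - 2 else 1) := by
  have ha : √2 * √2 = (2 : ℝ) := Real.mul_self_sqrt (by norm_num)
  have hb : √3 * √3 = (3 : ℝ) := Real.mul_self_sqrt (by norm_num)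
  have hab := two_lt_sqrt_two_mul_sqrt_three
  have pa : 1 < √2 := Real.lt_sqrt_of_sq_lt (by norm_num)
  have pa' : √2 < 2 := (Real.sqrt_lt' (by norm_num)).2 (by norm_num)
  have pb : 1 < √3 := Real.lt_sqrt_of_sq_lt (by norm_num)
  have pb' : √3 < 2 := (Real.sqrt_lt' (by norm_num)).2 (by norm_num)
  have hs : √(2 + √3) = (√2 * √3 + √2) / 2 := sqrt_eq_of_mul_self_eq (by positivity) (by grind)
  have hs' : √(6 - 3 * √3) = (3 * √2 - √2 * √3) / 2 :=
    sqrt_eq_of_mul_self_eq (by nlinarith) (by grind)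
  have h₃₂ : √(3 / 2) = √2 * √3 / 2 := sqrt_eq_of_mul_self_eq (by positivity) (by grind)
  have h₁₂ : 1 / √2 = √2 / 2 := by field_simp; linarith
  obtain ⟨G, hG⟩ : ∃ G, G = √(-2 + √2 + √2 * √3) := ⟨_, rfl⟩
  obtain ⟨A, hA⟩ : ∃ A, A = √(2 + 3 * √2 - √2 * √3) := ⟨_, rfl⟩
  obtain ⟨B, hB⟩ : ∃ B, B = √(√2 + 2 * √3 + √2 * √3) := ⟨_, rfl⟩
  obtain ⟨W, hW⟩ : ∃ W, W = √(√2 * √3 - 2) := ⟨_, rfl⟩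
  have gG : G * G = -2 + √2 + √2 * √3 := hG ▸ Real.mul_self_sqrt (by linarith)
  have gA : A * A = 2 + 3 * √2 - √2 * √3 := hA ▸ Real.mul_self_sqrt (by nlinarith)
  have gB : B * B = √2 + 2 * √3 + √2 * √3 := hB ▸ Real.mul_self_sqrt (by positivity)
  have gW : W * W = √2 * √3 - 2 := hW ▸ Real.mul_self_sqrt (by linarith)
  have pG : 0 ≤ G := hG ▸ Real.sqrt_nonneg _
  have pA : 0 ≤ A := hA ▸ Real.sqrt_nonneg _
  have pB : 0 ≤ B := hB ▸ Real.sqrt_nonneg _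
  have pW : 0 ≤ W := hW ▸ Real.sqrt_nonneg _
  have r₁ : √(1 + (3 * √2 - √2 * √3) / 2) = √2 * A / 2 :=
    sqrt_eq_of_mul_self_eq (by positivity) (by grind)
  have r₂ : √((√2 * √3 + √2) / 2 - 1) = √2 * G / 2 :=
    sqrt_eq_of_mul_self_eq (by positivity) (by grind)
  have vG : √(value (⟨-2, 1, 0, 1⟩ : BiquadInt)) = G := by
    rw [hG, BiquadInt.value_def]; congr 1; push_cast; ring
  have vA : √(value (even ⟨2, 3, 0, -1⟩ : CodeG)) = A := by
    change √(value (⟨2, 3, 0, -1⟩ : BiquadInt)) = A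
    rw [hA, BiquadInt.value_def]; congr 1; push_cast; ring
  have vB : √(value (even (even ⟨0, 1, 2, 1⟩) : CodeA)) = B := by
    change √(value (⟨0, 1, 2, 1⟩ : BiquadInt)) = B
    rw [hB, BiquadInt.value_def]; congr 1; push_cast; ring
  have v₁ : ∀ x, value (even (even (odd x)) : Code) = value x * G := fun x => by rw [← vG]; rfl
  have v₂ : ∀ x, value (odd (even (even x)) : Code) = value x * B := fun x => by rw [← vB]; rfl
  have v₃ : ∀ x y, value (even (mix (odd x) (even y)) : Code) = value x * G + value y * A :=
    fun x y => by rw [← vG, ← vA]; rfl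
  fin_cases i
  · change √(1 / 2 * (1 + 2 * √2 + √3 + √6)) = value (even (even (odd ⟨2, 1, 0, 1⟩)) : Code) / 4 *
      √(if _ then _ else 1)
    rw [if_neg (by decide), v₁, BiquadInt.value_def, sqrt_six, Real.sqrt_one, mul_one]
    push_cast
    exact sqrt_eq_of_mul_self_eq (by positivity) (by grind)
  · change √(1 / 2 * (-1 + √2 + √3)) = value (even (even (odd ⟨2, -1, 0, 1⟩)) : Code) / 4 *
      √(if _ then _ else 1)
    rw [if_neg (by decide), v₁, BiquadInt.value_def, Real.sqrt_one, mul_one]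
    push_cast
    have : 0 ≤ 2 + -1 * √2 + 0 * √3 + 1 * (√2 * √3) := by linarith
    exact sqrt_eq_of_mul_self_eq (by positivity) (by grind)
  · change √(3 / 2 * (√(2 + √3) - 1)) = value (even (even (odd ⟨0, 0, 2, 0⟩)) : Code) / 4 *
      √(if _ then _ else 1)
    rw [if_neg (by decide), v₁, BiquadInt.value_def, hs, Real.sqrt_one, mul_one]
    push_cast
    exact sqrt_eq_of_mul_self_eq (by positivity) (by grind)
  · change √(2 + √3 - √(2 + √3)) = value (even (even (odd ⟨2, 1, 0, 1⟩)) : Code) / 4 *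
      √(if _ then _ else 1)
    rw [if_pos (by decide), v₁, BiquadInt.value_def, hs, ← hW]
    push_cast
    exact sqrt_eq_of_mul_self_eq (by positivity) (by grind)
  · change √(1 / 2 * (√(2 + √3) - 1)) = value (even (even (odd ⟨2, 0, 0, 0⟩)) : Code) / 4 *
      √(if _ then _ else 1)
    rw [if_neg (by decide), v₁, BiquadInt.value_def, hs, Real.sqrt_one, mul_one]
    push_cast
    exact sqrt_eq_of_mul_self_eq (by positivity) (by grind)
  · change √(1 / 2 * (√3 + √(2 + √3))) = value (odd (even (even ⟨2, 0, 0, 0⟩)) : Code) / 4 *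
      √(if _ then _ else 1)
    rw [if_neg (by decide), v₂, BiquadInt.value_def, hs, Real.sqrt_one, mul_one]
    push_cast
    exact sqrt_eq_of_mul_self_eq (by positivity) (by grind)
  · change √(1 - √(3 / 2) + 1 / √2) = value (even (even (odd ⟨2, -1, 0, 1⟩)) : Code) / 4 *
      √(if _ then _ else 1)
    rw [if_pos (by decide), v₁, BiquadInt.value_def, h₃₂, h₁₂, ← hW]
    push_cast
    have : 0 ≤ 2 + -1 * √2 + 0 * √3 + 1 * (√2 * √3) := by linarith
    exact sqrt_eq_of_mul_self_eq (by positivity) (by grind)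
  · change 1 / 2 * (√(1 + √(6 - 3 * √3)) - √(√(2 + √3) - 1)) =
      value (even (mix (odd ⟨0, -1, 0, 0⟩) (even ⟨0, 1, 0, 0⟩)) : Code) / 4 * √(if _ then _ else 1)
    rw [if_neg (by decide), v₃, BiquadInt.value_def, BiquadInt.value_def, hs, hs', r₁, r₂,
      Real.sqrt_one]
    push_cast
    ring
  · change 1 / 2 * (√(1 + √(6 - 3 * √3)) + √(√(2 + √3) - 1)) =
      value (even (mix (odd ⟨0, 1, 0, 0⟩) (even ⟨0, 1, 0, 0⟩)) : Code) / 4 * √(if _ then _ else 1)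
    rw [if_neg (by decide), v₃, BiquadInt.value_def, hs, hs', r₁, r₂,
      Real.sqrt_one]
    push_cast
    ring

open GPA LoopGraph

/-- The evaluation depends on the eigenvector only up to a scalar. -/
theorem ev_eq {lam : Fin 6 → ℝ} {κ : ℝ} (hκ : 0 < κ) (h : ∀ v, lam v = κ * weightValue v) :
    ev Γ₄ weightValue = ev Γ₄ lam := by
  have e : ∀ u v, weightValue u / weightValue v = lam u / lam v := fun u v => by
    rw [h, h, mul_div_mul_left _ _ hκ.ne']
  simp only [ev, e]

/-- The coevaluation depends on the eigenvector only up to a scalar. -/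
theorem coev_eq {lam : Fin 6 → ℝ} {κ : ℝ} (hκ : 0 < κ) (h : ∀ v, lam v = κ * weightValue v) :
    coev Γ₄ weightValue = coev Γ₄ lam := by
  have e : ∀ u v, weightValue u / weightValue v = lam u / lam v := fun u v => by
    rw [h, h, mul_div_mul_left _ _ hκ.ne']
  simp only [coev, e]

/-- The coordinate at `u, v, w` of the trivalent vertex, up to sign. -/
theorem coordinate_eq {u v w : Fin 6} {i : Fin 9} (h : (v = 0 ∨ v = 3) ↔ (i = 3 ∨ i = 6))
    (hc : cell u v w = alphaCode i ∨ cell u v w = ofBiquad ⟨-1, 0, 0, 0⟩ * alphaCode i) :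
    cellValue u v w * √(weightValue v) = α₄ i ∨ cellValue u v w * √(weightValue v) = -α₄ i := by
  rw [α₄_eq, weightValue_eq, if_congr h rfl rfl, cellValue]
  rcases hc with hc | hc
  · exact Or.inl (by rw [hc])
  · refine Or.inr ?_
    rw [hc, value_mul, value_ofBiquad]
    push_cast
    ring

theorem trivalent_apply {p : Γ₄.EdgePath 2} {r : Γ₄.EdgePath 1} (h : p.Parallel r) :
    (trivalent weightValue cellValue : Γ₄.HomSpace 2 1).1 p r =
      ((cellValue (p.1 0) (p.1 1) (p.1 2) * √(weightValue (p.1 1)) : ℝ) : ℂ) :=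
  if_pos h

end Code

theorem mainTheorem7 (lam : Fin 6 → ℝ) (hlam : Γ₄.IsFrobeniusPerron lam) :
    ∃ (F : G2Bar q₄ ⥤ GPA Γ₄) (_ : F.Monoidal) (hF : IsStrict F),
      F.Faithful ∧ F.Additive ∧ F.Linear ℂ ∧
      hF.image Diagram.cap = GPA.ev Γ₄ lam ∧
      hF.image Diagram.cup = GPA.coev Γ₄ lam ∧
      (∀ (p : Γ₄.EdgePath 2) (r : Γ₄.EdgePath 1), p.Parallel r → ∃ i : Fin 9,
        GPA.coeff (hF.image Diagram.vertex) p r = (α₄ i : ℂ) ∨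
          GPA.coeff (hF.image Diagram.vertex) p r = -(α₄ i : ℂ)) ∧
      (∀ i : Fin 9, ∃ (p : Γ₄.EdgePath 2) (r : Γ₄.EdgePath 1), p.Parallel r ∧
        (GPA.coeff (hF.image Diagram.vertex) p r = (α₄ i : ℂ) ∨
          GPA.coeff (hF.image Diagram.vertex) p r = -(α₄ i : ℂ))) := by
  obtain ⟨κ, hκ, h⟩ := Code.exists_eq_mul_weightValue hlam
  have hc : ∀ {m n : ℕ} {f g : Diagram m n}, Diagram.Cong (G2BarRel q₄) f g →
      GPA.interp Γ₄ Code.weightValue Code.cellValue f =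
        GPA.interp Γ₄ Code.weightValue Code.cellValue g :=
    GPA.interp_eq_of_cong_G2BarRel Code.weightValue_pos Code.isCellFunction_cellValue Code.interp_eq
  have hv : ∀ {p : Γ₄.EdgePath 2} {r : Γ₄.EdgePath 1}, p.Parallel r → ∀ {i : Fin 9},
      (Code.cellValue (p.1 0) (p.1 1) (p.1 2) * √(Code.weightValue (p.1 1)) = α₄ i ∨
        Code.cellValue (p.1 0) (p.1 1) (p.1 2) * √(Code.weightValue (p.1 1)) = -α₄ i) →
      GPA.coeff ((GPA.realizeFunctor_isStrict hc).image Diagram.vertex) p r = (α₄ i : ℂ) ∨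
        GPA.coeff ((GPA.realizeFunctor_isStrict hc).image Diagram.vertex) p r = -(α₄ i : ℂ) := by
    intro p r hpr i hi
    have e : GPA.coeff ((GPA.realizeFunctor_isStrict hc).image Diagram.vertex) p r = _ :=
      (congrArg (fun f : Γ₄.HomSpace 2 1 => f.1 p r)
        (GPA.realizeFunctor_image hc Diagram.vertex)).trans (Code.trivalent_apply hpr)
    rw [e]
    exact hi.imp (fun h => by rw [h]) fun h => by rw [h, Complex.ofReal_neg]
  refine ⟨GPA.realizeFunctor hc, inferInstance, GPA.realizeFunctor_isStrict hc,
    GPA.faithful_realizeFunctor Code.weightValue_pos Code.isCellFunction_cellValue Code.interp_eq,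
    inferInstance, inferInstance, (GPA.realizeFunctor_image hc _).trans (Code.ev_eq hκ h),
    (GPA.realizeFunctor_image hc _).trans (Code.coev_eq hκ h), fun p r hpr => ?_, fun i => ?_⟩
  · have h₀ : p.1 0 = r.1 0 := hpr.1
    have h₂ : p.1 2 = r.1 1 := hpr.2
    have h₁ : Γ₄.Adj (p.1 0) (p.1 2) := by rw [h₀, h₂]; exact r.2 0
    obtain ⟨i, hi, hi'⟩ := Code.exists_cell_eq (p.1 0) (p.1 1) (p.1 2) ((Code.adj_iff _ _).1 (p.2 0))
      ((Code.adj_iff _ _).1 (p.2 1)) ((Code.adj_iff _ _).1 h₁)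
    exact ⟨i, hv hpr (Code.coordinate_eq hi hi')⟩
  · obtain ⟨u, v, w, h₁, h₂, h₃, hi, hi'⟩ := Code.exists_alphaCode_eq i
    let p : Γ₄.EdgePath 2 := ⟨![u, v, w], fun j => by
      fin_cases j
      exacts [(Code.adj_iff _ _).2 h₁, (Code.adj_iff _ _).2 h₂]⟩
    let r : Γ₄.EdgePath 1 := ⟨![u, w], fun j => by
      fin_cases j
      exact (Code.adj_iff _ _).2 h₃⟩
    have hpr : p.Parallel r := ⟨rfl, rfl⟩
    exact ⟨p, r, hpr, hv hpr (Code.coordinate_eq hi hi')⟩
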